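/- Let $H=\bigoplus_{(k,p)\in\mathbb Z\times\mathbb Z_2}H_{k,p}$ be a real graded vector space of arbitrary dimension ($k$ is the ghost degree and $p$ the Grassmann parity, which governs all signs; without fermions $p=k\bmod 2$). Let $(l_n)_{n\ge1}$ be an $L_\infty$-algebra structure on $H$: graded symmetric multilinear maps $l_n:H^{\times n}\to H$ of ghost degree $1$ and odd parity that satisfy the generalized Jacobi identities. Put $D=l_1$. The functions on the formal pointed graded manifold $M_H$ are the formal series $f=\sum_n\frac1{n!}\psi^{A_1}\cdots\psi^{A_n}f_n(e_{A_1},\dots,e_{A_n})$, where each $f_n$ is a graded symmetric $n$-linear form on $H$ and $\psi^A$ are the coordinates dual to a homogeneous basis $e_A$; they carry the graded commutative product of series and the topology of pointwise convergence of all Taylor coefficients $f_n$. The homological vector field $Q$ on $M_H$ is the derivation determined by $Q\Psi=\sum_{n\ge1}\frac1{n!}l_n(\Psi,\dots,\Psi)$, $\Psi=\psi^Ae_A$. A morphism $M_H\to M_K$ is given by a continuous degree-preserving unital algebra homomorphism from functions on $M_K$ to functions on $M_H$ that preserves the value at the base point; it is a $Q$-map if it intertwines the vector fields $Q$. An $L_\infty$-morphism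 is a $Q$-map of the associated formal manifolds; it is a quasi-isomorphism if its linear part induces an isomorphism of the cohomologies of the first structure maps. A minimal model of $(H,l_n)$ is an $L_\infty$-algebra $(H',l'_n)$ with $l'_1=0$ and an $L_\infty$-quasi-isomorphism from $(H',l'_n)$ to $(H,l_n)$. A formal pointed $Q$-manifold $(N,Q_N)$ is an equivalent reduction of $(M_H,Q)$, with section $i:N\to M_H$, if $i$ is a $Q$-map and there are a $Q$-map $\pi:M_H\to N$ with $\pi\circ i=\mathrm{id}$, a graded vector space $V$, and an isomorphism of $Q$-manifolds $M_H\cong N\times (T[1]V,d_V)$ that carries $\pi$ to the projection onto $N$. Then there are graded subspaces $E,F\subset H$ with $H=E\oplus F\oplus\operatorname{Im}D$ and $E\oplus\operatorname{Im}D=\operatorname{Ker}D$. For every such pair $(E,F)$, the map $E\to H_D(H)=\operatorname{Ker}D/\operatorname{Im}D$, $x\mapsto[x]$, is a linear isomorphism, and there are an $L_\infty$-algebra structure $(l'_n)$ on $E$, with associated formal $Q$-manifold $(N,Q_N)=(M_E,Q_N)$, and a $Q$-map $i:N\to M_H$ such that 1. $(N,Q_N)$ is an equivalent reduction of $(M_H,Q)$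 with section $i$; 2. $(E,l'_n)$ is a minimal model of $(H,l_n)$; moreover the linear part of $i$ is the inclusion $E\subset H$, and it is a quasi-isomorphism $(E,l'_1)\to(H,D)$; 3. $N$ is the submanifold of $M_H$ cut out by $W$ and $QW$ (so that $Q_N=Q|_N$), where $W$ is the space of linear functions on $M_H$ given by the linear functionals on $H$ that vanish on $E\oplus F$: the restriction $i^*$ of functions is surjective and its kernel is the closed ideal generated by $W\cup QW$. If $H$ is finite-dimensional, the kernel is the ideal generated by $W\cup QW$, without closure. -/

import Mathlib

universe u

namespace QMan

/-- A real graded (super) vector space `H = ⨁ H_(k,p)`. The first label is the ghost degree, the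
second one the Grassmann parity, which governs all signs. In the absence of fermions the only
nonzero pieces are those with `p = k mod 2`. -/
structure GrSpace : Type (u + 1) where
  carrier : Type u
  [addCommGroup : AddCommGroup carrier]
  [module : Module ℝ carrier]
  gr : ℤ × ZMod 2 → Submodule ℝ carrier
  internal : DirectSum.IsInternal gr

namespace GrSpace

instance : CoeSort GrSpace.{u} (Type u) := ⟨GrSpace.carrier⟩

attribute [instance] GrSpace.addCommGroup GrSpace.module

theorem bijective_coe (H : GrSpace.{u}) : Function.Bijective (DirectSum.coeLinearMap H.gr) :=
  H.internal

/-- The linear projection onto the even (`ε = 0`) or odd (`ε = 1`) part. -/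
noncomputable def parityProj (H : GrSpace.{u}) (ε : ZMod 2) : H →ₗ[ℝ] H :=
  (DirectSum.toModule ℝ (ℤ × ZMod 2) H
      (fun d => if d.2 = ε then (H.gr d).subtype else 0)).comp
    (LinearEquiv.ofBijective (DirectSum.coeLinearMap H.gr) H.bijective_coe).symm.toLinearMap

theorem parityProj_of_mem (H : GrSpace.{u}) (ε : ZMod 2) {d : ℤ × ZMod 2} {x : H}
    (hx : x ∈ H.gr d) : H.parityProj ε x = if d.2 = ε then x else 0 := by
  have h : (LinearEquiv.ofBijective (DirectSum.coeLinearMap H.gr) H.bijective_coe).symm x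
      = DirectSum.lof ℝ (ℤ × ZMod 2) (fun d => H.gr d) d ⟨x, hx⟩ := by
    rw [LinearEquiv.symm_apply_eq]
    simp [LinearEquiv.ofBijective_apply]
  simp only [parityProj, LinearMap.comp_apply, LinearEquiv.coe_coe]
  rw [h, DirectSum.toModule_lof]
  split_ifs <;> simp

/-- A graded subspace: a subspace that is the sum of its homogeneous parts. -/
def IsGraded (H : GrSpace.{u}) (E : Submodule ℝ H) : Prop :=
  E = ⨆ d, E ⊓ H.gr d

theorem iSupIndep_gr (H : GrSpace.{u}) : iSupIndep H.gr :=
  (DirectSum.isInternal_submodule_iff_iSupIndep_and_iSup_eq_top _).1 H.internal |>.1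

theorem iSup_gr (H : GrSpace.{u}) : ⨆ d, H.gr d = ⊤ :=
  (DirectSum.isInternal_submodule_iff_iSupIndep_and_iSup_eq_top _).1 H.internal |>.2

/-- A graded subspace as a graded space. -/
abbrev sub (H : GrSpace.{u}) (E : Submodule ℝ H) (hE : H.IsGraded E) : GrSpace.{u} where
  carrier := E
  gr d := (H.gr d).comap E.subtype
  internal := by
    rw [DirectSum.isInternal_submodule_iff_iSupIndep_and_iSup_eq_top]
    constructor
    · rw [iSupIndep_def]
      intro d
      rw [Submodule.disjoint_def]
      intro x hx hx'
      have h1 : E.subtype x ∈ ⨆ (j) (_ : j ≠ d), H.gr j := by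
        have h2 := Submodule.mem_map_of_mem (f := E.subtype) hx'
        simp only [Submodule.map_iSup] at h2
        refine SetLike.le_def.1 (iSup₂_mono fun j _ => ?_) h2
        exact Submodule.map_comap_le _ _
      have h3 := (Submodule.disjoint_def.1 ((iSupIndep_def.1 H.iSupIndep_gr) d)) _ hx h1
      exact Subtype.ext h3
    · apply Submodule.map_injective_of_injective E.injective_subtype
      rw [Submodule.map_iSup, Submodule.map_top, Submodule.range_subtype]
      simp only [Submodule.map_comap_subtype]
      exact hE.symm

/-- The direct sum of two graded spaces. -/
abbrev prod (H K : GrSpace.{u}) : GrSpace.{u} where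
  carrier := H × K
  gr d := (H.gr d).prod (K.gr d)
  internal := by
    rw [DirectSum.isInternal_submodule_iff_iSupIndep_and_iSup_eq_top]
    constructor
    · rw [iSupIndep_def]
      intro d
      rw [Submodule.disjoint_def]
      rintro x ⟨hx1, hx2⟩ hx'
      have h1 : x.1 ∈ ⨆ (j) (_ : j ≠ d), H.gr j := by
        have h2 := Submodule.mem_map_of_mem (f := LinearMap.fst ℝ H K) hx'
        simp only [Submodule.map_iSup] at h2
        refine SetLike.le_def.1 (iSup₂_mono fun j _ => ?_) h2
        rw [Submodule.map_le_iff_le_comap]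
        exact fun y hy => hy.1
      have h1' : x.2 ∈ ⨆ (j) (_ : j ≠ d), K.gr j := by
        have h2 := Submodule.mem_map_of_mem (f := LinearMap.snd ℝ H K) hx'
        simp only [Submodule.map_iSup] at h2
        refine SetLike.le_def.1 (iSup₂_mono fun j _ => ?_) h2
        rw [Submodule.map_le_iff_le_comap]
        exact fun y hy => hy.2
      exact Prod.ext
        ((Submodule.disjoint_def.1 ((iSupIndep_def.1 H.iSupIndep_gr) d)) _ hx1 h1)
        ((Submodule.disjoint_def.1 ((iSupIndep_def.1 K.iSupIndep_gr) d)) _ hx2 h1')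
    · rw [eq_top_iff]
      have hl : Submodule.map (LinearMap.inl ℝ H K) ⊤ ≤ ⨆ d, (H.gr d).prod (K.gr d) := by
        rw [← H.iSup_gr, Submodule.map_iSup]
        refine iSup_mono fun d => ?_
        rw [Submodule.map_le_iff_le_comap]
        exact fun y hy => ⟨hy, (K.gr d).zero_mem⟩
      have hr : Submodule.map (LinearMap.inr ℝ H K) ⊤ ≤ ⨆ d, (H.gr d).prod (K.gr d) := by
        rw [← K.iSup_gr, Submodule.map_iSup]
        refine iSup_mono fun d => ?_
        rw [Submodule.map_le_iff_le_comap]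
        exact fun y hy => ⟨(H.gr d).zero_mem, hy⟩
      rintro ⟨a, b⟩ -
      have : ((a, b) : H × K) = LinearMap.inl ℝ H K a + LinearMap.inr ℝ H K b := by simp
      rw [this]
      exact add_mem (hl (Submodule.mem_map_of_mem trivial))
        (hr (Submodule.mem_map_of_mem trivial))

/-- The shifted space `V[1]`, with `(V[1])_d = V_{d+1}` (the parity is flipped as well). -/
abbrev shift (V : GrSpace.{u}) : GrSpace.{u} where
  carrier := V
  gr d := V.gr (d + (1, 1))
  internal := by
    rw [DirectSum.isInternal_submodule_iff_iSupIndep_and_iSup_eq_top]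
    refine ⟨V.iSupIndep_gr.comp (add_left_injective _), ?_⟩
    rw [← V.iSup_gr]
    exact (Equiv.addRight ((1, 1) : ℤ × ZMod 2)).iSup_comp (g := V.gr)

end GrSpace

/-! ### Koszul signs and graded symmetrization -/

/-- The Koszul sign `ε(σ; p)` with `x_{σ 1} ⋯ x_{σ n} = ε(σ; p) x_1 ⋯ x_n` in a graded commutative
algebra, the parity of `x_i` being `p i`: a factor `-1` for each inverted pair of odd elements. -/
def koszul {n : ℕ} (σ : Equiv.Perm (Fin n)) (p : Fin n → ZMod 2) : ℝ :=
  ∏ ij : Fin n × Fin n,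
    if ij.1 < ij.2 ∧ σ ij.2 < σ ij.1 ∧ p (σ ij.1) = 1 ∧ p (σ ij.2) = 1 then -1 else 1

theorem koszul_mul {n : ℕ} (τ σ : Equiv.Perm (Fin n)) (p : Fin n → ZMod 2) :
    koszul (τ * σ) p = koszul τ p * koszul σ (p ∘ τ) := by
  have key : koszul τ p = ∏ ij : Fin n × Fin n,
      if ij.1 < ij.2 ∧ ((σ ij.1 < σ ij.2 ∧ τ (σ ij.2) < τ (σ ij.1)) ∨
        (σ ij.2 < σ ij.1 ∧ τ (σ ij.1) < τ (σ ij.2))) ∧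
        p (τ (σ ij.1)) = 1 ∧ p (τ (σ ij.2)) = 1 then (-1 : ℝ) else 1 := by
    unfold koszul
    rw [← Finset.prod_filter, ← Finset.prod_filter]
    symm
    refine Finset.prod_bij'
      (fun ij _ => if σ ij.1 < σ ij.2 then (σ ij.1, σ ij.2) else (σ ij.2, σ ij.1))
      (fun ij _ => if σ.symm ij.1 < σ.symm ij.2 then (σ.symm ij.1, σ.symm ij.2)
        else (σ.symm ij.2, σ.symm ij.1)) ?_ ?_ ?_ ?_ ?_
    · rintro ⟨i, j⟩ h
      simp only [Finset.mem_filter, Finset.mem_univ, true_and] at h ⊢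
      split_ifs with h1 <;> grind
    · rintro ⟨i, j⟩ h
      simp only [Finset.mem_filter, Finset.mem_univ, true_and] at h ⊢
      have hne : σ.symm i ≠ σ.symm j := fun e => by
        have := σ.symm.injective e
        grind
      split_ifs with h1 <;> simp only [Equiv.apply_symm_apply] <;> grind
    · rintro ⟨i, j⟩ h
      simp only [Finset.mem_filter, Finset.mem_univ, true_and] at h ⊢
      split_ifs with h1 h2 h2 <;> simp only [Equiv.symm_apply_apply] at * <;> grind
    · rintro ⟨i, j⟩ h
      simp only [Finset.mem_filter, Finset.mem_univ, true_and] at h ⊢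
      split_ifs with h1 h2 h2 <;> simp only [Equiv.apply_symm_apply] at * <;> grind
    · intros; rfl
  rw [key]
  unfold koszul
  rw [← Finset.prod_mul_distrib]
  refine Finset.prod_congr rfl ?_
  rintro ⟨i, j⟩ -
  simp only [Equiv.Perm.mul_apply, Function.comp_apply]
  by_cases hij : i < j
  · have h1 : σ i ≠ σ j := fun e => hij.ne (σ.injective e)
    have h2 : τ (σ i) ≠ τ (σ j) := fun e => h1 (τ.injective e)
    by_cases hp : p (τ (σ i)) = 1 <;> by_cases hq : p (τ (σ j)) = 1 <;>
    rcases lt_or_gt_of_ne h1 with h1' | h1' <;> rcases lt_or_gt_of_ne h2 with h2' | h2' <;>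
    simp [hij, hp, hq, h1', h2', h1'.not_gt, h2'.not_gt]
  · simp [hij]

/-- The tuple `x` consists of homogeneous elements of degrees `d`. -/
def HomTuple (H : GrSpace.{u}) {n : ℕ} (d : Fin n → ℤ × ZMod 2) (x : Fin n → H) : Prop :=
  ∀ i, x i ∈ H.gr (d i)

/-- The multilinear map whose value at homogeneous `x_1, …, x_n` is
`∑_σ ε(σ; x) t(x_{σ 1}, …, x_{σ n})`. -/
noncomputable def symmetrize {H : GrSpace.{u}} {n : ℕ}
    (t : MultilinearMap ℝ (fun _ : Fin n => H) ℝ) : MultilinearMap ℝ (fun _ : Fin n => H) ℝ :=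
  ∑ σ : Equiv.Perm (Fin n), ∑ p : Fin n → ZMod 2,
    koszul σ p • (t.domDomCongr σ).compLinearMap (fun i => H.parityProj (p i))

theorem symmetrize_apply {H : GrSpace.{u}} {n : ℕ}
    (t : MultilinearMap ℝ (fun _ : Fin n => H) ℝ) {d : Fin n → ℤ × ZMod 2} {x : Fin n → H}
    (hx : HomTuple H d x) :
    symmetrize t x
      = ∑ σ : Equiv.Perm (Fin n), koszul σ (fun i => (d i).2) * t (fun i => x (σ i)) := by
  simp only [symmetrize, sum_apply]
  refine Finset.sum_congr rfl fun σ _ => ?_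
  rw [Finset.sum_eq_single (fun i => (d i).2)]
  · simp [H.parityProj_of_mem _ (hx _)]
  · intro p _ hp
    obtain ⟨i, hi⟩ : ∃ i, p i ≠ (d i).2 := by
      by_contra! h
      exact hp (funext h)
    simp only [smul_apply, MultilinearMap.compLinearMap_apply,
      MultilinearMap.domDomCongr_apply]
    rw [MultilinearMap.map_coord_zero t (σ.symm i), smul_zero]
    simp [H.parityProj_of_mem _ (hx _), hi.symm]
  · simp

/-- Graded symmetry of a multilinear map. -/
def IsGradedSymm (H : GrSpace.{u}) {M : Type*} [AddCommGroup M] [Module ℝ M] {n : ℕ}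
    (t : MultilinearMap ℝ (fun _ : Fin n => H) M) : Prop :=
  ∀ (d : Fin n → ℤ × ZMod 2) (x : Fin n → H), HomTuple H d x → ∀ σ : Equiv.Perm (Fin n),
    t (fun i => x (σ i)) = koszul σ (fun i => (d i).2) • t x

theorem koszul_mul_self {n : ℕ} (σ : Equiv.Perm (Fin n)) (p : Fin n → ZMod 2) :
    koszul σ p * koszul σ p = 1 := by
  unfold koszul
  rw [← Finset.prod_mul_distrib]
  refine Finset.prod_eq_one fun ij _ => ?_
  split_ifs <;> norm_num

theorem isGradedSymm_symmetrize {H : GrSpace.{u}} {n : ℕ}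
    (t : MultilinearMap ℝ (fun _ : Fin n => H) ℝ) : IsGradedSymm H (symmetrize t) := by
  intro d x hx τ
  rw [symmetrize_apply t hx,
    symmetrize_apply t (d := fun i => d (τ i)) (x := fun i => x (τ i)) (fun i => hx (τ i)),
    smul_eq_mul, Finset.mul_sum]
  rw [← Equiv.sum_comp (Equiv.mulLeft τ)
    (fun σ => koszul τ (fun i => (d i).2) *
      (koszul σ (fun i => (d i).2) * t (fun i => x (σ i))))]
  refine Finset.sum_congr rfl fun σ _ => ?_
  simp only [Equiv.coe_mulLeft, Equiv.Perm.mul_apply]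
  rw [koszul_mul, ← mul_assoc, ← mul_assoc, koszul_mul_self, one_mul]
  rfl

/-- The identification `{1,…,k} ⊔ {1,…,n-k} = {1,…,n}` (first block, second block). -/
def split {n : ℕ} (k : Fin (n + 1)) : Fin (k : ℕ) ⊕ Fin (n - k) ≃ Fin n :=
  finSumFinEquiv.trans (finCongr (by omega))

/-! ### Functions on the formal pointed graded manifold of a graded space -/

/-- Sequences `(f_n)` of graded symmetric multilinear forms on `H`. -/
def formalFun (H : GrSpace.{u}) :
    Submodule ℝ (∀ n : ℕ, MultilinearMap ℝ (fun _ : Fin n => H) ℝ) where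
  carrier := {f | ∀ n, IsGradedSymm H (f n)}
  add_mem' := fun hf hg n d x hx σ => by
    simp [hf n d x hx σ, hg n d x hx σ, mul_add]
  zero_mem' := fun n d x hx σ => by simp
  smul_mem' := fun c f hf n d x hx σ => by
    simp [hf n d x hx σ, mul_left_comm]

/-- The algebra of functions on the formal pointed graded manifold `M_H`: the completed graded
symmetric algebra of the dual of `H`. The sequence `(f_n)` stands for the formal series
`∑_n (1/n!) ψ^{A_1} ⋯ ψ^{A_n} f_n(e_{A_1}, …, e_{A_n})` in the coordinates `ψ^A` dual to a
homogeneous basis `e_A` of `H`. -/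
abbrev FormalFun (H : GrSpace.{u}) : Type u := formalFun H

namespace FormalFun

variable {H : GrSpace.{u}}

/-- Convergence of formal series: pointwise convergence of all Taylor coefficients. -/
instance : TopologicalSpace (FormalFun H) :=
  TopologicalSpace.induced
    (fun (f : FormalFun H) (a : Σ n : ℕ, (Fin n → H)) => f.1 a.1 a.2) inferInstance

/-- The constant function `1`. -/
noncomputable instance : One (FormalFun H) :=
  ⟨⟨fun n => if n = 0 then
      MultilinearMap.mkPiAlgebra ℝ (Fin n) ℝ |>.compLinearMap (fun _ => (0 : H →ₗ[ℝ] ℝ)) else 0, by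
    rintro (_ | n) d x hx σ
    · simp [koszul]
    · simp⟩⟩

/-- The product of formal series: for homogeneous `x_1, …, x_n`,
`(f g)_n(x) = ∑_k 1/(k!(n-k)!) ∑_σ ε(σ; x) f_k(x_{σ 1}, …, x_{σ k}) g_{n-k}(x_{σ(k+1)}, …)`. -/
noncomputable instance : Mul (FormalFun H) :=
  ⟨fun f g => ⟨fun n => ∑ k : Fin (n + 1), ((Nat.factorial k : ℝ) * (Nat.factorial (n - k) : ℝ))⁻¹ •
      symmetrize (((LinearMap.mul' ℝ ℝ).compMultilinearMap
        ((f.1 k).domCoprod (g.1 (n - k)))).domDomCongr (split k)), by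
    intro n d x hx σ
    simp only [sum_apply, smul_apply, Finset.smul_sum]
    refine Finset.sum_congr rfl fun k _ => ?_
    rw [isGradedSymm_symmetrize _ d x hx σ, smul_comm]⟩⟩

/-- The value at the base point (constant term). -/
def const (f : FormalFun H) : ℝ := f.1 0 Fin.elim0

/-- `f` is homogeneous of degree `d`, where the coordinate dual to a vector of degree `e`
has degree `-e`. -/
def IsHomogeneous (f : FormalFun H) (d : ℤ × ZMod 2) : Prop :=
  ∀ (n : ℕ) (e : Fin n → ℤ × ZMod 2) (x : Fin n → H), HomTuple H e x → f.1 n x ≠ 0 →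
    d = -∑ i, e i

/-- `f` is a linear function, i.e. given by a linear functional on `H`. -/
def IsLinear (f : FormalFun H) : Prop := ∀ n, n ≠ 1 → f.1 n = 0

/-- Ideals of the algebra of functions. -/
def IsIdeal (J : Submodule ℝ (FormalFun H)) : Prop :=
  ∀ f : FormalFun H, ∀ g ∈ J, f * g ∈ J ∧ g * f ∈ J

/-- The ideal generated by a set of functions. -/
def idealGen (S : Set (FormalFun H)) : Submodule ℝ (FormalFun H) :=
  sInf {J | IsIdeal J ∧ S ⊆ J}

/-- The closed ideal generated by a set of functions. -/
def closedIdealGen (S : Set (FormalFun H)) : Submodule ℝ (FormalFun H) :=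
  sInf {J | IsIdeal J ∧ IsClosed (J : Set (FormalFun H)) ∧ S ⊆ J}

end FormalFun

/-- A morphism `M_H → M_K` of formal pointed graded manifolds, given by its pullback of
functions. -/
structure FormalMap (H K : GrSpace.{u}) where
  pullback : FormalFun K →ₗ[ℝ] FormalFun H
  map_one : pullback 1 = 1
  map_mul : ∀ f g, pullback (f * g) = pullback f * pullback g
  continuous : Continuous pullback
  degree : ∀ f d, FormalFun.IsHomogeneous f d → FormalFun.IsHomogeneous (pullback f) d
  basePoint : ∀ f, (pullback f).const = f.const

/-- The linear map `χ` is the differential at the base point (the first Taylor coefficient) of the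
map `φ : M_H → M_K`. -/
def FormalMap.HasLinearPart {H K : GrSpace.{u}} (φ : FormalMap H K) (χ : H →ₗ[ℝ] K) : Prop :=
  ∀ (f : FormalFun K) (x : H), (φ.pullback f).1 1 (fun _ => x) = f.1 1 (fun _ => χ x)

/-! ### `L_∞`-algebras and their formal pointed `Q`-manifolds -/

/-- `L_∞`-algebra structures on `H`, in the convention where all maps are graded symmetric of
degree `1`. The generalized Jacobi identities are written as sums over all permutations; because of
the graded symmetry, the factor `1/(k!(n-k)!)` turns them into sums over unshuffles. -/
structure LInfty (H : GrSpace.{u}) where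
  l : ∀ n : ℕ, MultilinearMap ℝ (fun _ : Fin n => H) H
  l_zero : l 0 = 0
  degree : ∀ (n : ℕ) (d : Fin n → ℤ × ZMod 2) (x : Fin n → H), HomTuple H d x →
    l n x ∈ H.gr (∑ i, d i + (1, 1))
  symm : ∀ n, IsGradedSymm H (l n)
  jacobi : ∀ (n : ℕ) (d : Fin n → ℤ × ZMod 2) (x : Fin n → H), HomTuple H d x →
    ∑ k : Fin (n + 1), ((Nat.factorial k : ℝ) * (Nat.factorial (n - k) : ℝ))⁻¹ •
      ∑ σ : Equiv.Perm (Fin n), koszul σ (fun i => (d i).2) •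
        l (n - k + 1) (Fin.cons (l k (fun i => x (σ (split k (Sum.inl i)))))
          (fun j => x (σ (split k (Sum.inr j))))) = 0

namespace LInfty

variable {H K : GrSpace.{u}}

/-- The differential `D = l_1`. -/
def D (L : LInfty H) : H →ₗ[ℝ] H :=
  (MultilinearMap.ofSubsingleton ℝ (H : Type u) (H : Type u) (0 : Fin 1)).symm (L.l 1)

/-- The homological vector field of `M_H`, acting on functions. It is the derivation with
`Q Ψ = ∑_k (1/k!) l_k(Ψ, …, Ψ)`; for homogeneous `x_1, …, x_n`,
`(Q f)_n(x) = ∑_k 1/(k!(n-k)!) ∑_σ ε(σ; x) f_{n-k+1}(l_k(x_{σ 1}, …, x_{σ k}), x_{σ(k+1)}, …)`. -/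
noncomputable def Q (L : LInfty H) (f : FormalFun H) : FormalFun H :=
  ⟨fun n => ∑ k : Fin (n + 1), ((Nat.factorial k : ℝ) * (Nat.factorial (n - k) : ℝ))⁻¹ •
      symmetrize ((MultilinearMap.uncurrySum (R := ℝ) (N := fun _ => (H : Type u))
        ((f.1 (n - k + 1)).curryLeft.compMultilinearMap (L.l k))).domDomCongr (split k)), by
    intro n d x hx σ
    simp only [sum_apply, smul_apply, Finset.smul_sum]
    refine Finset.sum_congr rfl fun k _ => ?_
    rw [isGradedSymm_symmetrize _ d x hx σ, smul_comm]⟩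

/-- `φ : M_H → M_K` is a `Q`-map; equivalently, its Taylor coefficients form an
`L_∞`-morphism. -/
def IsQMap (L : LInfty H) (L' : LInfty K) (φ : FormalMap H K) : Prop :=
  ∀ f, φ.pullback (L'.Q f) = L.Q (φ.pullback f)

/-- The linear map `χ : K → H` induces an isomorphism `H_{D'}(K) ≅ H_D(H)` of cohomology. -/
structure IsQuasiIso (L' : LInfty K) (L : LInfty H) (χ : K →ₗ[ℝ] H) : Prop where
  comm : ∀ x, χ (L'.D x) = L.D (χ x)
  injective : ∀ x, L'.D x = 0 → χ x ∈ LinearMap.range L.D → x ∈ LinearMap.range L'.D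
  surjective : ∀ y, L.D y = 0 → ∃ x, L'.D x = 0 ∧ y - χ x ∈ LinearMap.range L.D

/-- The cohomology `Ker D / Im D`. -/
abbrev Cohomology (L : LInfty H) : Type u :=
  LinearMap.ker L.D ⧸ (LinearMap.range L.D).submoduleOf (LinearMap.ker L.D)

/-- `(K, L')` is a minimal model of `(H, L)`: `l'_1 = 0` and there is an `L_∞`-quasi-isomorphism
from `(K, L')` to `(H, L)`. -/
def IsMinimalModel (L' : LInfty K) (L : LInfty H) : Prop :=
  L'.l 1 = 0 ∧ ∃ (m : FormalMap K H) (χ : K →ₗ[ℝ] H),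
    IsQMap L' L m ∧ m.HasLinearPart χ ∧ IsQuasiIso L' L χ

/-! ### Contractible `Q`-manifolds, products, equivalent reductions -/

/-- The `L_∞`-algebra given by a complex: `l_1` is the differential, all other maps vanish. -/
def ofDifferential (δ : H →ₗ[ℝ] H) (hdeg : ∀ d, ∀ x ∈ H.gr d, δ x ∈ H.gr (d + (1, 1)))
    (hsq : ∀ x, δ (δ x) = 0) : LInfty H where
  l n := match n with
    | 1 => MultilinearMap.ofSubsingleton ℝ (H : Type u) (H : Type u) (0 : Fin 1) δ
    | _ => 0
  l_zero := rfl
  degree := by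
    rintro (_ | _ | n) d x hx
    · exact Submodule.zero_mem _
    · simpa using hdeg _ _ (hx 0)
    · exact Submodule.zero_mem _
  symm := by
    rintro (_ | _ | n) d x hx σ
    · simp
    · have h1 : koszul σ (fun i => (d i).2) = 1 := by
        refine Finset.prod_eq_one fun ij _ => ?_
        rw [if_neg]
        omega
      have h2 : ∀ i, σ i = i := fun i => by omega
      simp only [h1, one_smul, h2]
    · simp
  jacobi := by
    rintro (_ | _ | n) d x hx
    · simp
    · simp [Fin.sum_univ_two, hsq]
    · refine Finset.sum_eq_zero fun k _ => ?_
      rw [Finset.sum_eq_zero, smul_zero]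
      intro σ _
      obtain ⟨k, hk⟩ := k
      rcases k with _ | _ | k
      · simp
      · exact smul_zero _
      · rw [MultilinearMap.map_coord_zero _ 0, smul_zero]
        simp

/-- The product of formal pointed `Q`-manifolds, as an `L_∞`-structure on the direct sum. -/
def prod (L : LInfty H) (L' : LInfty K) : LInfty (H.prod K) where
  l n := MultilinearMap.prod
    ((L.l n).compLinearMap (fun _ => LinearMap.fst ℝ H K))
    ((L'.l n).compLinearMap (fun _ => LinearMap.snd ℝ H K))
  l_zero := by
    rw [L.l_zero, L'.l_zero]
    rfl
  degree := fun n d x hx =>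
    ⟨L.degree n d (fun i => (x i).1) (fun i => (hx i).1),
      L'.degree n d (fun i => (x i).2) (fun i => (hx i).2)⟩
  symm := fun n d x hx σ => Prod.ext
    (L.symm n d (fun i => (x i).1) (fun i => (hx i).1) σ)
    (L'.symm n d (fun i => (x i).2) (fun i => (hx i).2) σ)
  jacobi := fun n d x hx => by
    have h1 := L.jacobi n d (fun i => (x i).1) (fun i => (hx i).1)
    have h2 := L'.jacobi n d (fun i => (x i).2) (fun i => (hx i).2)
    refine Prod.ext ?_ ?_
    · rw [Prod.fst_sum]
      simp only [Prod.smul_fst, Prod.fst_sum]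
      refine Eq.trans ?_ h1
      refine Finset.sum_congr rfl fun k _ => congrArg _ (Finset.sum_congr rfl fun σ _ =>
        congrArg _ (congrArg (L.l (n - k + 1)) (funext fun j => ?_)))
      refine Fin.cases ?_ (fun j => ?_) j <;> rfl
    · rw [Prod.snd_sum]
      simp only [Prod.smul_snd, Prod.snd_sum]
      refine Eq.trans ?_ h2
      refine Finset.sum_congr rfl fun k _ => congrArg _ (Finset.sum_congr rfl fun σ _ =>
        congrArg _ (congrArg (L'.l (n - k + 1)) (funext fun j => ?_)))
      refine Fin.cases ?_ (fun j => ?_) j <;> rfl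

/-- The contractible `Q`-manifold `(T[1]V, d_V)`: the underlying graded space is `V ⊕ V[1]`, and
`d_V v^a = dv^a`, `d_V dv^a = 0` for the linear coordinates `v^a` on `V` and the corresponding
coordinates `dv^a` on `V[1]`. -/
def shiftedTangent (V : GrSpace.{u}) : LInfty (V.prod V.shift) :=
  ofDifferential (H := V.prod V.shift)
    ((LinearMap.inl ℝ V V).comp (LinearMap.snd ℝ V V))
    (fun _ _ hx => ⟨hx.2, Submodule.zero_mem _⟩)
    (fun _ => rfl)

end LInfty

/-- The pullback of functions along the projection `M_H × M_K → M_H`. -/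
def FormalFun.fstPullback {H : GrSpace.{u}} (K : GrSpace.{u}) (f : FormalFun H) :
    FormalFun (H.prod K) :=
  ⟨fun n => (f.1 n).compLinearMap (fun _ => LinearMap.fst ℝ H K),
    fun n d x hx σ => f.2 n d (fun i => (x i).1) (fun i => (hx i).1) σ⟩

namespace LInfty

variable {H K : GrSpace.{u}}

/-- `(M_K, Q')` is an equivalent reduction of `(M_H, Q)`, with `s : M_K → M_H` as global
`Q`-section: there is a `Q`-map `π : M_H → M_K` with `π ∘ s = id` that is a trivial `Q`-bundle with
contractible fibre, i.e. for some `V` there is an isomorphism of `Q`-manifolds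
`t : M_H → M_K × T[1]V` (with inverse `t'`) over `M_K`. As the body of a formal pointed manifold is
one point, local triviality means triviality. -/
def IsEquivalentReduction (L' : LInfty K) (L : LInfty H) (s : FormalMap K H) : Prop :=
  IsQMap L' L s ∧
  ∃ π : FormalMap H K, IsQMap L L' π ∧ (∀ f, s.pullback (π.pullback f) = f) ∧
  ∃ (V : GrSpace.{u}) (t : FormalMap H (K.prod (V.prod V.shift)))
    (t' : FormalMap (K.prod (V.prod V.shift)) H),
    IsQMap L (L'.prod (shiftedTangent V)) t ∧
    IsQMap (L'.prod (shiftedTangent V)) L t' ∧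
    (∀ f, t'.pullback (t.pullback f) = f) ∧
    (∀ f, t.pullback (t'.pullback f) = f) ∧
    ∀ f : FormalFun K, t.pullback (f.fstPullback (V.prod V.shift)) = π.pullback f

/-- A splitting `H = E ⊕ F ⊕ Im D` into graded subspaces with `E ⊕ Im D = Ker D`. -/
structure IsSplitting (L : LInfty H) (E F : Submodule ℝ H) : Prop where
  gradedE : H.IsGraded E
  gradedF : H.IsGraded F
  disjoint : Disjoint E (LinearMap.range L.D)
  sup_eq : E ⊔ LinearMap.range L.D = LinearMap.ker L.D
  isCompl : IsCompl F (LinearMap.ker L.D)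

end LInfty

/-- The linear functions on `M_H` whose linear functionals vanish on `E ⊕ F`. -/
def linearVanishing (H : GrSpace.{u}) (E F : Submodule ℝ H) : Set (FormalFun H) :=
  {w | w.IsLinear ∧ ∀ x ∈ E ⊔ F, w.1 1 (fun _ => x) = 0}

end QMan

/-!
The functions `e(x)` and `e(Q x)` on `M_H`, for `e` the projection onto `Im D` along `E ⊕ F`,
assemble to a `Q`-map `M_H → T[1] Im D`. Together with the projection onto `E` it has bijective
linear part, so by the formal inverse function theorem `M_H` is `E × T[1] Im D` as a manifold, with
a vector field `Q` that projects to `d_V`. Let `η` be the contracting homotopy of the fibres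
`T[1] Im D`. The vector field `Θ = [Q, η]` commutes with `Q`, and its linear part is the projection
onto the fibre directions, so its formal flow contracts `M_H` onto the zero section: every function
on the zero section extends to exactly one function annihilated by `Θ`. Extending the coordinates
of `E` this way gives a retraction `ρ` onto the zero section that intertwines `Q` with the
restricted field, and in the coordinates `(ρ(x), e(x), e(Q x))` the field `Q` is `Q_N × d_V`.

In these coordinates `N` is cut out by the functions `w` and `Q w` with `w ∈ W`. By Euler's identity
a function vanishing on `N` is a sum of products of these coordinates with partial derivatives; the
sum is finite if `H` is finite-dimensional and converges coefficientwise in general.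
-/

namespace QMan

variable {H K : GrSpace.{u}} {M M' M'' : Type*} [AddCommGroup M] [Module ℝ M]
  [AddCommGroup M'] [Module ℝ M'] [AddCommGroup M''] [Module ℝ M'']

/-! ### Graded vector spaces and graded subspaces -/

theorem GrSpace.exists_homogeneous_basis (H : GrSpace.{u}) :
    ∃ (J : Type u) (b : Module.Basis J ℝ H) (deg : J → ℤ × ZMod 2), ∀ j, b j ∈ H.gr (deg j) :=
  ⟨_, H.internal.collectedBasis fun d => Module.Basis.ofVectorSpace ℝ (H.gr d), Sigma.fst,
    fun j => H.internal.collectedBasis_mem _ j⟩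

theorem multilinearMap_ext_homogeneous {n : ℕ} {f g : MultilinearMap ℝ (fun _ : Fin n => H) M}
    (h : ∀ d x, HomTuple H d x → f x = g x) : f = g := by
  obtain ⟨J, b, deg, hb⟩ := H.exists_homogeneous_basis
  exact Module.Basis.ext_multilinear (fun _ => b) fun v => h _ _ fun i => hb (v i)

theorem linearMap_ext_homogeneous {f g : H →ₗ[ℝ] M} (h : ∀ d, ∀ x ∈ H.gr d, f x = g x) :
    f = g := by
  obtain ⟨J, b, deg, hb⟩ := H.exists_homogeneous_basis
  exact b.ext fun j => h _ _ (hb j)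

theorem map_mem_of_homogeneous {S : Submodule ℝ M} {f : H →ₗ[ℝ] M}
    (h : ∀ d, ∀ x ∈ H.gr d, f x ∈ S) (x : H) : f x ∈ S := by
  have : S.mkQ ∘ₗ f = 0 := linearMap_ext_homogeneous fun d x hx => by simpa using h d x hx
  simpa using LinearMap.congr_fun this x

namespace GrSpace

noncomputable instance (H : GrSpace.{u}) : DirectSum.Decomposition H.gr :=
  H.internal.chooseDecomposition

/-- The projection of `H` onto its homogeneous part of degree `d`. -/
noncomputable def degProj (H : GrSpace.{u}) (d : ℤ × ZMod 2) : H →ₗ[ℝ] H :=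
  (H.gr d).subtype ∘ₗ DirectSum.component ℝ (ℤ × ZMod 2) (fun d => H.gr d) d ∘ₗ
    (DirectSum.decomposeLinearEquiv H.gr).toLinearMap

theorem degProj_mem (d : ℤ × ZMod 2) (x : H) : H.degProj d x ∈ H.gr d := Subtype.property _

theorem degProj_of_mem {d : ℤ × ZMod 2} {x : H} (hx : x ∈ H.gr d) (e : ℤ × ZMod 2) :
    H.degProj e x = if d = e then x else 0 := by
  split_ifs with h
  · exact h ▸ DirectSum.decompose_of_mem_same H.gr hx
  · exact DirectSum.decompose_of_mem_ne H.gr hx h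

theorem degProj_self {d : ℤ × ZMod 2} {x : H} (hx : x ∈ H.gr d) : H.degProj d x = x := by
  rw [degProj_of_mem hx, if_pos rfl]

theorem mem_of_degProj_mem {E : Submodule ℝ H} {x : H} (h : ∀ d, H.degProj d x ∈ E) : x ∈ E := by
  classical
  rw [← DirectSum.sum_support_decompose H.gr x]
  exact sum_mem fun d _ => h d

theorem degProj_mem_of_mem_iSup {A : ℤ × ZMod 2 → Submodule ℝ H} (hA : ∀ d, A d ≤ H.gr d) {x : H}
    (hx : x ∈ ⨆ d, A d) (d : ℤ × ZMod 2) : H.degProj d x ∈ A d := by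
  suffices ⨆ d, A d ≤ (A d).comap (H.degProj d) from this hx
  refine iSup_le fun c y hy => ?_
  rw [Submodule.mem_comap, degProj_of_mem (hA c hy)]
  split_ifs with h
  · exact h ▸ hy
  · exact zero_mem _

theorem isGraded_iff {E : Submodule ℝ H} :
    H.IsGraded E ↔ ∀ x ∈ E, ∀ d, H.degProj d x ∈ E := by
  refine ⟨fun hE x hx d => ?_, fun h => le_antisymm (fun x hx => ?_) (iSup_le fun _ => inf_le_left)⟩
  · rw [hE] at hx
    exact (degProj_mem_of_mem_iSup (fun _ => inf_le_right) hx d).1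
  · exact mem_of_degProj_mem fun d => Submodule.mem_iSup_of_mem d ⟨h x hx d, degProj_mem d x⟩

theorem IsGraded.sup {E F : Submodule ℝ H} (hE : H.IsGraded E) (hF : H.IsGraded F) :
    H.IsGraded (E ⊔ F) := by
  refine isGraded_iff.2 fun x hx d => ?_
  obtain ⟨y, hy, z, hz, rfl⟩ := Submodule.mem_sup.1 hx
  rw [map_add]
  exact add_mem (Submodule.mem_sup_left (isGraded_iff.1 hE y hy d))
    (Submodule.mem_sup_right (isGraded_iff.1 hF z hz d))

theorem exists_isGraded_compl {A B : Submodule ℝ H} (hAB : A ≤ B) (hA : H.IsGraded A)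
    (hB : H.IsGraded B) :
    ∃ E : Submodule ℝ H, H.IsGraded E ∧ Disjoint E A ∧ E ⊔ A = B := by
  choose C hC using fun d => Submodule.exists_isCompl (A ⊓ H.gr d)
  let E : ℤ × ZMod 2 → Submodule ℝ H := fun d => C d ⊓ (B ⊓ H.gr d)
  have E_le_gr (d) : E d ≤ H.gr d := inf_le_right.trans inf_le_right
  have sup_E (d) : A ⊓ H.gr d ⊔ E d = B ⊓ H.gr d := by
    rw [← sup_inf_assoc_of_le _ (inf_le_inf_right _ hAB), (hC d).sup_eq_top, top_inf_eq]
  refine ⟨⨆ d, E d, isGraded_iff.2 fun x hx d => ?_, Submodule.disjoint_def.2 fun x hx hxA => ?_,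
    le_antisymm (sup_le (iSup_le fun d => inf_le_right.trans inf_le_left) hAB) ?_⟩
  · exact Submodule.mem_iSup_of_mem d (degProj_mem_of_mem_iSup E_le_gr hx d)
  · refine (Submodule.mem_bot ℝ).1 (mem_of_degProj_mem fun d => ?_)
    exact Submodule.disjoint_def.1 (hC d).disjoint _
      ⟨isGraded_iff.1 hA x hxA d, degProj_mem d x⟩ (degProj_mem_of_mem_iSup E_le_gr hx d).1
  · rw [hB]
    refine iSup_le fun d => ?_
    rw [← sup_E d]
    exact sup_le (inf_le_left.trans le_sup_right) ((le_iSup E d).trans le_sup_left)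

theorem projectionOnto_mem_gr {E F : Submodule ℝ H} (hE : H.IsGraded E) (hF : H.IsGraded F)
    (hEF : IsCompl E F) {d : ℤ × ZMod 2} {x : H} (hx : x ∈ H.gr d) :
    (E.projectionOnto F hEF x : H) ∈ H.gr d := by
  have hy := isGraded_iff.1 hE _ (Submodule.coe_mem (E.projectionOnto F hEF x)) d
  have hz := isGraded_iff.1 hF _ (Submodule.coe_mem (F.projectionOnto E hEF.symm x)) d
  have split : H.degProj d (E.projectionOnto F hEF x) +
      H.degProj d (F.projectionOnto E hEF.symm x) = x := by
    rw [← map_add, Submodule.coe_projectionOnto_apply, Submodule.coe_projectionOnto_apply,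
      Submodule.projection_add_projection_eq_self, degProj_self hx]
  have hyx : E.projectionOnto F hEF x = H.degProj d (E.projectionOnto F hEF x) := by
    conv_lhs => rw [← split, map_add, Submodule.projectionOnto_apply_of_mem_left hEF hy,
      Submodule.projectionOnto_apply_of_mem_right hEF hz, add_zero]
  exact hyx ▸ degProj_mem d _

theorem symm_apply_mem_gr {e : H ≃ₗ[ℝ] K} (he : ∀ d, ∀ x ∈ H.gr d, e x ∈ K.gr d)
    {d : ℤ × ZMod 2} {y : K} (hy : y ∈ K.gr d) : e.symm y ∈ H.gr d := by
  have commute : e.toLinearMap ∘ₗ H.degProj d = K.degProj d ∘ₗ e :=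
    linearMap_ext_homogeneous fun c x hx => by
      simp [degProj_of_mem hx, degProj_of_mem (he c x hx), apply_ite e]
  have fixed : e (H.degProj d (e.symm y)) = y := by
    simpa [degProj_self hy] using LinearMap.congr_fun commute (e.symm y)
  rw [← (LinearEquiv.eq_symm_apply e).2 fixed]
  exact degProj_mem d _

theorem inl_mem_gr {d : ℤ × ZMod 2} {x : H} (hx : x ∈ H.gr d) :
    LinearMap.inl ℝ H K x ∈ (H.prod K).gr d := ⟨hx, zero_mem _⟩

theorem inr_mem_gr {d : ℤ × ZMod 2} {y : K} (hy : y ∈ K.gr d) :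
    LinearMap.inr ℝ H K y ∈ (H.prod K).gr d := ⟨zero_mem _, hy⟩

theorem fst_mem_gr {d : ℤ × ZMod 2} {z : H.prod K} (hz : z ∈ (H.prod K).gr d) :
    LinearMap.fst ℝ H K z ∈ H.gr d := hz.1

theorem snd_mem_gr {d : ℤ × ZMod 2} {z : H.prod K} (hz : z ∈ (H.prod K).gr d) :
    LinearMap.snd ℝ H K z ∈ K.gr d := hz.2

end GrSpace

/-! ### Homogeneous arguments, signs and permutations -/

theorem HomTuple.cons {n : ℕ} {d : Fin n → ℤ × ZMod 2} {x : Fin n → H} (hx : HomTuple H d x)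
    {e : ℤ × ZMod 2} {y : H} (hy : y ∈ H.gr e) :
    HomTuple H (Fin.cons e d : Fin (n + 1) → ℤ × ZMod 2) (Fin.cons y x : Fin (n + 1) → H) :=
  Fin.cases (by simpa using hy) fun j => by simpa using hx j

theorem HomTuple.comp {n m : ℕ} {d : Fin n → ℤ × ZMod 2} {x : Fin n → H} (hx : HomTuple H d x)
    (s : Fin m → Fin n) : HomTuple H (fun i => d (s i)) (fun i => x (s i)) :=
  fun i => hx (s i)

/-- The Koszul sign `(-1)^(a b)` of exchanging two elements of parities `a` and `b`. -/
def swapSign (a b : ZMod 2) : ℝ := if a = 1 ∧ b = 1 then -1 else 1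

theorem zmod_two_eq_zero_or_one (a : ZMod 2) : a = 0 ∨ a = 1 := by
  revert a; decide

@[simp] theorem swapSign_zero_left (a : ZMod 2) : swapSign 0 a = 1 := by simp [swapSign]

@[simp] theorem swapSign_zero_right (a : ZMod 2) : swapSign a 0 = 1 := by simp [swapSign]

@[simp] theorem swapSign_one_one : swapSign 1 1 = -1 := by simp [swapSign]

theorem swapSign_comm (a b : ZMod 2) : swapSign a b = swapSign b a := by
  simp [swapSign, and_comm]

theorem swapSign_add_right (a b c : ZMod 2) :
    swapSign a (b + c) = swapSign a b * swapSign a c := by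
  have h : (1 + 1 : ZMod 2) = 0 := by decide
  rcases zmod_two_eq_zero_or_one a with rfl | rfl <;>
    rcases zmod_two_eq_zero_or_one b with rfl | rfl <;>
    rcases zmod_two_eq_zero_or_one c with rfl | rfl <;> simp [h]

theorem swapSign_add_left (a b c : ZMod 2) :
    swapSign (a + b) c = swapSign a c * swapSign b c := by
  rw [swapSign_comm, swapSign_add_right, swapSign_comm c, swapSign_comm c]

@[simp] theorem swapSign_mul_self (a b : ZMod 2) : swapSign a b * swapSign a b = 1 := by
  unfold swapSign; split_ifs <;> norm_num

theorem swapSign_sum {ι : Type*} (s : Finset ι) (a : ZMod 2) (p : ι → ZMod 2) :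
    swapSign a (∑ i ∈ s, p i) = ∏ i ∈ s, swapSign a (p i) := by
  classical
  induction s using Finset.induction_on with
  | empty => simp
  | insert i s hi ih => rw [Finset.sum_insert hi, Finset.prod_insert hi, swapSign_add_right, ih]

/-- The operator `x ↦ (-1)^(δ |x|) x`. -/
noncomputable def parityOp (H : GrSpace.{u}) (δ : ZMod 2) : H →ₗ[ℝ] H :=
  H.parityProj 0 + swapSign δ 1 • H.parityProj 1

theorem parityOp_of_mem (δ : ZMod 2) {d : ℤ × ZMod 2} {x : H} (hx : x ∈ H.gr d) :
    parityOp H δ x = swapSign δ d.2 • x := by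
  simp only [parityOp, LinearMap.add_apply, LinearMap.smul_apply, H.parityProj_of_mem _ hx]
  rcases zmod_two_eq_zero_or_one d.2 with h | h <;> simp [h]

theorem parityOp_mem (δ : ZMod 2) {d : ℤ × ZMod 2} {x : H} (hx : x ∈ H.gr d) :
    parityOp H δ x ∈ H.gr d := by
  rw [parityOp_of_mem δ hx]
  exact Submodule.smul_mem _ _ hx

/-- The permutation of `Fin (n + 1)` that sends `j` to `0` and is given by `τ` on the remaining
elements. Every permutation has this form, which turns sums over permutations of `n + 1` arguments
into sums over permutations of `n` arguments and the position of the first argument. -/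
def insertPerm {n : ℕ} (j : Fin (n + 1)) (τ : Equiv.Perm (Fin n)) : Equiv.Perm (Fin (n + 1)) :=
  (finSuccEquiv' j).trans ((Equiv.optionCongr τ).trans (finSuccEquiv' 0).symm)

@[simp] theorem insertPerm_self {n : ℕ} (j : Fin (n + 1)) (τ : Equiv.Perm (Fin n)) :
    insertPerm j τ j = 0 := by simp [insertPerm]

@[simp] theorem insertPerm_succAbove {n : ℕ} (j : Fin (n + 1)) (τ : Equiv.Perm (Fin n))
    (i : Fin n) : insertPerm j τ (j.succAbove i) = (τ i).succ := by simp [insertPerm]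

theorem insertPerm_bijective (n : ℕ) : Function.Bijective
    (fun a : Fin (n + 1) × Equiv.Perm (Fin n) => insertPerm a.1 a.2) := by
  rw [Fintype.bijective_iff_injective_and_card]
  refine ⟨?_, by simp [Fintype.card_perm, Nat.factorial_succ]⟩
  rintro ⟨j, τ⟩ ⟨j', τ'⟩ h
  have happly (i) : insertPerm j τ i = insertPerm j' τ' i := Equiv.congr_fun h i
  obtain rfl : j = j' := (insertPerm j' τ').injective (by rw [← happly]; simp)
  exact Prod.ext rfl (Equiv.ext fun i => by simpa using happly (j.succAbove i))

theorem sum_perm_succ {A : Type*} [AddCommMonoid A] {n : ℕ} (F : Equiv.Perm (Fin (n + 1)) → A) :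
    ∑ σ, F σ = ∑ j : Fin (n + 1), ∑ τ : Equiv.Perm (Fin n), F (insertPerm j τ) := by
  rw [← Fintype.sum_prod_type']
  exact ((insertPerm_bijective n).sum_comp F).symm

theorem cons_insertPerm {n : ℕ} {α : Type*} (j : Fin (n + 1)) (τ : Equiv.Perm (Fin n)) (y : α)
    (x : Fin n → α) :
    (fun i => (Fin.cons y x : Fin (n + 1) → α) (insertPerm j τ i))
      = j.insertNth (α := fun _ => α) y (fun i => x (τ i)) := by
  rw [Fin.eq_insertNth_iff]
  exact ⟨by simp, funext fun i => by simp [Fin.removeNth]⟩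

theorem koszul_insertPerm {n : ℕ} (j : Fin (n + 1)) (τ : Equiv.Perm (Fin n))
    (p : Fin (n + 1) → ZMod 2) :
    koszul (insertPerm j τ) p
      = (∏ i : Fin n, if i.castSucc < j then swapSign (p 0) (p (τ i).succ) else 1)
        * koszul τ (fun i => p i.succ) := by
  unfold koszul
  rw [Fintype.prod_prod_type, Fintype.prod_prod_type, Fin.prod_univ_succAbove _ j]
  have no_inversion_at_j (b : Fin (n + 1)) : (if j < b ∧ insertPerm j τ b < insertPerm j τ j ∧
      p (insertPerm j τ j) = 1 ∧ p (insertPerm j τ b) = 1 then (-1 : ℝ) else 1) = 1 := by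
    simp
  simp only [no_inversion_at_j, Finset.prod_const_one, one_mul]
  rw [← Finset.prod_mul_distrib]
  refine Finset.prod_congr rfl fun a _ => ?_
  rw [Fin.prod_univ_succAbove _ j]
  congr 1
  · simp only [insertPerm_self, insertPerm_succAbove, Fin.succAbove_lt_iff_castSucc_lt, swapSign,
      Fin.succ_pos, true_and]
    split_ifs <;> grind
  · refine Finset.prod_congr rfl fun b _ => ?_
    simp [Fin.succAbove_lt_succAbove_iff]

theorem koszul_one {n : ℕ} (p : Fin n → ZMod 2) : koszul 1 p = 1 :=
  Finset.prod_eq_one fun _ _ => if_neg fun h => h.1.asymm h.2.1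

theorem IsGradedSymm.insertNth {n : ℕ} {t : MultilinearMap ℝ (fun _ : Fin (n + 1) => H) M}
    (ht : IsGradedSymm H t) {d : Fin n → ℤ × ZMod 2} {x : Fin n → H} (hx : HomTuple H d x)
    {e : ℤ × ZMod 2} {y : H} (hy : y ∈ H.gr e) (j : Fin (n + 1)) :
    t (j.insertNth (α := fun _ => (H : Type u)) y x)
      = (∏ i : Fin n, if i.castSucc < j then swapSign e.2 (d i).2 else 1) • t (Fin.cons y x) := by
  have h := ht _ _ (hx.cons hy) (insertPerm j 1)
  rw [cons_insertPerm, koszul_insertPerm, koszul_one] at h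
  simpa using h

theorem IsGradedSymm.curryLeft {n : ℕ} {t : MultilinearMap ℝ (fun _ : Fin (n + 1) => H) M}
    (ht : IsGradedSymm H t) (y : H) : IsGradedSymm H (t.curryLeft y) := by
  intro d x hx σ
  let evalAt (w : Fin n → H) : H →ₗ[ℝ] M :=
    { toFun := fun z => t.curryLeft z w
      map_add' := by simp
      map_smul' := by simp }
  suffices evalAt (fun i => x (σ i)) = koszul σ (fun i => (d i).2) • evalAt x from
    LinearMap.congr_fun this y
  refine linearMap_ext_homogeneous fun e z hz => ?_
  have h := ht _ _ (hx.cons hz) (insertPerm 0 σ)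
  rw [cons_insertPerm, koszul_insertPerm] at h
  change t (Fin.cons z fun i => x (σ i)) = koszul σ (fun i => (d i).2) • t (Fin.cons z x)
  simpa using h

/-! ### Formal series with values in a vector space -/

/-- Sequences of graded symmetric multilinear maps on `H` with values in `M`. -/
def formalSeries (H : GrSpace.{u}) (M : Type*) [AddCommGroup M] [Module ℝ M] :
    Submodule ℝ (∀ n : ℕ, MultilinearMap ℝ (fun _ : Fin n => H) M) where
  carrier := {f | ∀ n, IsGradedSymm H (f n)}
  add_mem' := fun hf hg n d x hx σ => by simp [hf n d x hx σ, hg n d x hx σ]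
  zero_mem' := fun n d x _hx σ => by simp
  smul_mem' := fun c f hf n d x hx σ => by simp [hf n d x hx σ, smul_comm c]

/-- Formal functions on `M_H` with values in `M`. Functions correspond to `M = ℝ`, vector fields to
`M = H`, and maps from `M_H` to `M_K` to certain series with values in `K`. -/
abbrev FormalSeries (H : GrSpace.{u}) (M : Type*) [AddCommGroup M] [Module ℝ M] :=
  formalSeries H M

/-- The Taylor coefficient of order `n`. -/
def coeff (n : ℕ) : FormalSeries H M →ₗ[ℝ] MultilinearMap ℝ (fun _ : Fin n => H) M where
  toFun f := f.1 n
  map_add' _ _ := rfl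
  map_smul' _ _ := rfl

theorem isGradedSymm_coeff (n : ℕ) (f : FormalSeries H M) : IsGradedSymm H (coeff n f) := f.2 n

theorem formalSeries_ext {f g : FormalSeries H M}
    (h : ∀ n d x, HomTuple H d x → coeff n f x = coeff n g x) : f = g :=
  Subtype.ext (funext fun n => multilinearMap_ext_homogeneous (h n))

/-- The value of a series at the base point. -/
def constantCoeff : FormalSeries H M →ₗ[ℝ] M where
  toFun f := coeff 0 f Fin.elim0
  map_add' _ _ := rfl
  map_smul' _ _ := rfl

theorem coeff_zero_apply (f : FormalSeries H M) (x : Fin 0 → H) :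
    coeff 0 f x = constantCoeff f :=
  congrArg _ (Subsingleton.elim _ _)

/-- The derivative in the direction of a constant vector. -/
def pderiv : H →ₗ[ℝ] FormalSeries H M →ₗ[ℝ] FormalSeries H M :=
  LinearMap.mk₂ ℝ
    (fun y f => ⟨fun n => (coeff (n + 1) f).curryLeft y, fun n => (f.2 (n + 1)).curryLeft y⟩)
    (fun y z f => Subtype.ext (funext fun n => map_add (coeff (n + 1) f).curryLeft y z))
    (fun c y f => Subtype.ext (funext fun n => map_smul (coeff (n + 1) f).curryLeft c y))
    (fun _ _ _ => rfl) (fun _ _ _ => rfl)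

@[simp] theorem coeff_pderiv (y : H) (f : FormalSeries H M) (n : ℕ) (x : Fin n → H) :
    coeff n (pderiv y f) x = coeff (n + 1) f (Fin.cons y x) := rfl

/-- The differential of a series, as the linear family of its derivatives in constant
directions. -/
abbrev differential (f : FormalSeries H M) : H →ₗ[ℝ] FormalSeries H M := pderiv.flip f

theorem coeff_succ_apply (f : FormalSeries H M) {n : ℕ} (x : Fin (n + 1) → H) :
    coeff (n + 1) f x = coeff n (pderiv (x 0) f) (Fin.tail x) := by
  rw [coeff_pderiv, Fin.cons_self_tail]

theorem pderiv_pderiv {d e : ℤ × ZMod 2} {y z : H} (hy : y ∈ H.gr d) (hz : z ∈ H.gr e)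
    (f : FormalSeries H M) :
    pderiv y (pderiv z f) = swapSign d.2 e.2 • pderiv z (pderiv y f) := by
  refine formalSeries_ext fun n c x hx => ?_
  have insertNth_one : (Fin.insertNth (α := fun _ => (H : Type u)) 1 z (Fin.cons y x) :
      Fin (n + 2) → H) = Fin.cons y (Fin.cons z x) := by
    rw [eq_comm, Fin.eq_insertNth_iff]
    refine ⟨rfl, funext fun i => ?_⟩
    refine Fin.cases ?_ (fun i => ?_) i <;> simp [Fin.removeNth]
  have only_first (i : Fin n) : ¬ i.succ.castSucc < (1 : Fin (n + 2)) := by simp [Fin.lt_def]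
  have h := (isGradedSymm_coeff (n + 2) f).insertNth (hx.cons hy) hz 1
  rw [insertNth_one, Fin.prod_univ_succ] at h
  simp only [Fin.castSucc_zero, Fin.zero_lt_one, if_true, Fin.cons_zero, only_first, if_false,
    Finset.prod_const_one, mul_one] at h
  simp only [coeff_pderiv, map_smul, smul_apply]
  rw [h, smul_smul, swapSign_comm d.2, swapSign_mul_self, one_smul]

/-- The constant series. -/
def const : M →ₗ[ℝ] FormalSeries H M where
  toFun m := ⟨fun n => match n with
    | 0 => MultilinearMap.constOfIsEmpty ℝ _ m
    | _ + 1 => 0, by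
    rintro (_ | n) d x _ σ
    · simp [koszul]
    · simp⟩
  map_add' m m' := Subtype.ext (funext fun n => by cases n <;> ext x <;> simp)
  map_smul' c m := Subtype.ext (funext fun n => by cases n <;> ext x <;> simp)

@[simp] theorem constantCoeff_const (m : M) : constantCoeff (const m : FormalSeries H M) = m := rfl

@[simp] theorem pderiv_const (y : H) (m : M) : pderiv y (const m : FormalSeries H M) = 0 := rfl

/-- The substitution `x ↦ (-1)^(δ |x|) x` in a series: the sign of moving an element of parity `δ`
past all arguments. -/
noncomputable def twist (δ : ZMod 2) : FormalSeries H M →ₗ[ℝ] FormalSeries H M where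
  toFun f := ⟨fun n => (coeff n f).compLinearMap fun _ => parityOp H δ, fun n d x hx σ =>
    f.2 n d (fun i => parityOp H δ (x i)) (fun i => parityOp_mem δ (hx i)) σ⟩
  map_add' _ _ := rfl
  map_smul' _ _ := rfl

theorem coeff_twist (δ : ZMod 2) (f : FormalSeries H M) {n : ℕ} (x : Fin n → H) :
    coeff n (twist δ f) x = coeff n f (fun i => parityOp H δ (x i)) := rfl

theorem coeff_twist_of_homTuple (δ : ZMod 2) (f : FormalSeries H M) {n : ℕ}
    {d : Fin n → ℤ × ZMod 2} {x : Fin n → H} (hx : HomTuple H d x) :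
    coeff n (twist δ f) x = (∏ i, swapSign δ (d i).2) • coeff n f x := by
  rw [coeff_twist, ← MultilinearMap.map_smul_univ]
  exact congrArg _ (funext fun i => parityOp_of_mem δ (hx i))

theorem pderiv_twist (δ : ZMod 2) (f : FormalSeries H M) {d : ℤ × ZMod 2} {y : H}
    (hy : y ∈ H.gr d) : pderiv y (twist δ f) = swapSign δ d.2 • twist δ (pderiv y f) := by
  refine formalSeries_ext fun n c x hx => ?_
  rw [coeff_pderiv, coeff_twist_of_homTuple δ f (hx.cons hy), Fin.prod_univ_succ, map_smul,
    smul_apply, coeff_twist_of_homTuple δ _ hx, smul_smul]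
  rfl

@[simp] theorem twist_twist (δ ε : ZMod 2) (f : FormalSeries H M) :
    twist δ (twist ε f) = twist (δ + ε) f := by
  refine formalSeries_ext fun n c x hx => ?_
  rw [coeff_twist_of_homTuple _ _ hx, coeff_twist_of_homTuple _ _ hx,
    coeff_twist_of_homTuple _ _ hx, smul_smul, ← Finset.prod_mul_distrib]
  simp only [swapSign_add_left]

@[simp] theorem twist_zero (f : FormalSeries H M) : twist 0 f = f := by
  refine formalSeries_ext fun n c x hx => ?_
  rw [coeff_twist_of_homTuple _ _ hx]
  simp

@[simp] theorem constantCoeff_twist (δ : ZMod 2) (f : FormalSeries H M) :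
    constantCoeff (twist δ f) = constantCoeff f :=
  coeff_zero_apply f _

/-- Composition with a linear map of the values. -/
def postcomp (φ : M →ₗ[ℝ] M') : FormalSeries H M →ₗ[ℝ] FormalSeries H M' where
  toFun f := ⟨fun n => φ.compMultilinearMap (coeff n f), fun n d x hx σ => by
    simp [isGradedSymm_coeff n f d x hx σ]⟩
  map_add' f g := Subtype.ext (funext fun n => MultilinearMap.ext fun x => map_add φ _ _)
  map_smul' c f := Subtype.ext (funext fun n => MultilinearMap.ext fun x => map_smul φ _ _)

@[simp] theorem coeff_postcomp (φ : M →ₗ[ℝ] M') (f : FormalSeries H M) (n : ℕ) (x : Fin n → H) :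
    coeff n (postcomp φ f) x = φ (coeff n f x) := rfl

@[simp] theorem constantCoeff_postcomp (φ : M →ₗ[ℝ] M') (f : FormalSeries H M) :
    constantCoeff (postcomp φ f) = φ (constantCoeff f) := rfl

@[simp] theorem pderiv_postcomp (φ : M →ₗ[ℝ] M') (y : H) (f : FormalSeries H M) :
    pderiv y (postcomp φ f) = postcomp φ (pderiv y f) := rfl

theorem twist_postcomp (δ : ZMod 2) (φ : M →ₗ[ℝ] M') (f : FormalSeries H M) :
    twist δ (postcomp φ f) = postcomp φ (twist δ f) := rfl

@[simp] theorem postcomp_postcomp (φ : M →ₗ[ℝ] M') (ψ : M' →ₗ[ℝ] M'') (f : FormalSeries H M) :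
    postcomp ψ (postcomp φ f) = postcomp (ψ ∘ₗ φ) f := rfl

@[simp] theorem postcomp_zero_left (f : FormalSeries H M) :
    postcomp (0 : M →ₗ[ℝ] M') f = 0 := rfl

@[simp] theorem postcomp_id (f : FormalSeries H M) : postcomp LinearMap.id f = f := rfl

/-! ### Contraction of a series with a linear family of series -/

/-- The multilinear map whose value at homogeneous `x_1, …, x_n` is
`∑_σ ε(σ; x) t(x_{σ 1}, …, x_{σ n})`, for vector-valued `t`. -/
noncomputable def gradedSymmetrize {n : ℕ} (t : MultilinearMap ℝ (fun _ : Fin n => H) M) :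
    MultilinearMap ℝ (fun _ : Fin n => H) M :=
  ∑ σ : Equiv.Perm (Fin n), ∑ p : Fin n → ZMod 2,
    koszul σ p • (t.domDomCongr σ).compLinearMap (fun i => H.parityProj (p i))

theorem gradedSymmetrize_apply {n : ℕ} (t : MultilinearMap ℝ (fun _ : Fin n => H) M)
    {d : Fin n → ℤ × ZMod 2} {x : Fin n → H} (hx : HomTuple H d x) :
    gradedSymmetrize t x
      = ∑ σ : Equiv.Perm (Fin n), koszul σ (fun i => (d i).2) • t (fun i => x (σ i)) := by
  simp only [gradedSymmetrize, sum_apply]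
  refine Finset.sum_congr rfl fun σ _ => ?_
  rw [Finset.sum_eq_single (fun i => (d i).2)]
  · simp [H.parityProj_of_mem _ (hx _)]
  · intro p _ hp
    obtain ⟨i, hi⟩ : ∃ i, p i ≠ (d i).2 := by
      by_contra! h
      exact hp (funext h)
    simp only [smul_apply, MultilinearMap.compLinearMap_apply, MultilinearMap.domDomCongr_apply]
    rw [MultilinearMap.map_coord_zero t (σ.symm i), smul_zero]
    simp [H.parityProj_of_mem _ (hx _), hi.symm]
  · simp

theorem isGradedSymm_gradedSymmetrize {n : ℕ} (t : MultilinearMap ℝ (fun _ : Fin n => H) M) :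
    IsGradedSymm H (gradedSymmetrize t) := by
  intro d x hx τ
  rw [gradedSymmetrize_apply t hx,
    gradedSymmetrize_apply t (d := fun i => d (τ i)) (x := fun i => x (τ i)) (hx.comp τ),
    Finset.smul_sum, ← Equiv.sum_comp (Equiv.mulLeft τ) fun σ =>
      koszul τ (fun i => (d i).2) • koszul σ (fun i => (d i).2) • t (fun i => x (σ i))]
  refine Finset.sum_congr rfl fun σ _ => ?_
  simp only [Equiv.coe_mulLeft, Equiv.Perm.mul_apply]
  rw [koszul_mul, smul_smul, ← mul_assoc, koszul_mul_self, one_mul]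
  rfl

/-- The identification of two consecutive blocks of lengths `a` and `b` with `Fin n`. In contrast to
`split`, the lengths are independent variables, so that they can be changed one at a time. -/
def blocks {a b n : ℕ} (h : a + b = n) : Fin a ⊕ Fin b ≃ Fin n :=
  finSumFinEquiv.trans (finCongr h)

theorem prod_blocks {a b n : ℕ} (h : a + b = n) (F : Fin n → ℝ) :
    ∏ i, F i = (∏ i, F (blocks h (Sum.inl i))) * ∏ i, F (blocks h (Sum.inr i)) := by
  rw [← (blocks h).prod_comp, Fintype.prod_sum_type]

theorem sum_blocks {A : Type*} [AddCommMonoid A] {a b n : ℕ} (h : a + b = n) (F : Fin n → A) :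
    ∑ i, F i = (∑ i, F (blocks h (Sum.inl i))) + ∑ i, F (blocks h (Sum.inr i)) := by
  rw [← (blocks h).sum_comp, Fintype.sum_sum_type]

section InsertIntoBlocks

variable {α : Type*} {a b n : ℕ} (h : a + b = n) (y : α) (w : Fin n → α)

theorem insertNth_blocks_inl_inl (h' : a + 1 + b = n + 1) (j : Fin (a + 1)) :
    (fun i => (blocks h' (Sum.inl j)).insertNth (α := fun _ => α) y w (blocks h' (Sum.inl i)))
      = j.insertNth (α := fun _ => α) y (fun i => w (blocks h (Sum.inl i))) := by
  rw [Fin.eq_insertNth_iff]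
  refine ⟨by simp, funext fun i => ?_⟩
  have skip : blocks h' (Sum.inl (j.succAbove i))
      = (blocks h' (Sum.inl j)).succAbove (blocks h (Sum.inl i)) := by
    ext
    simp [blocks, Fin.succAbove, Fin.lt_def]
    split_ifs <;> simp
  simp only [Fin.removeNth, skip, Fin.insertNth_apply_succAbove]

theorem insertNth_blocks_inl_inr (h' : a + 1 + b = n + 1) (j : Fin (a + 1)) :
    (fun i => (blocks h' (Sum.inl j)).insertNth (α := fun _ => α) y w (blocks h' (Sum.inr i)))
      = fun i => w (blocks h (Sum.inr i)) := by
  funext i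
  have skip : blocks h' (Sum.inr i)
      = (blocks h' (Sum.inl j)).succAbove (blocks h (Sum.inr i)) := by
    ext
    simp [blocks, Fin.succAbove, Fin.lt_def]
    split_ifs <;> simp <;> omega
  simp only [skip, Fin.insertNth_apply_succAbove]

theorem insertNth_blocks_inr_inr (h' : a + (b + 1) = n + 1) (j : Fin (b + 1)) :
    (fun i => (blocks h' (Sum.inr j)).insertNth (α := fun _ => α) y w (blocks h' (Sum.inr i)))
      = j.insertNth (α := fun _ => α) y (fun i => w (blocks h (Sum.inr i))) := by
  rw [Fin.eq_insertNth_iff]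
  refine ⟨by simp, funext fun i => ?_⟩
  have skip : blocks h' (Sum.inr (j.succAbove i))
      = (blocks h' (Sum.inr j)).succAbove (blocks h (Sum.inr i)) := by
    ext
    simp [blocks, Fin.succAbove, Fin.lt_def]
    split_ifs <;> simp
    omega
  simp only [Fin.removeNth, skip, Fin.insertNth_apply_succAbove]

theorem insertNth_blocks_inr_inl (h' : a + (b + 1) = n + 1) (j : Fin (b + 1)) :
    (fun i => (blocks h' (Sum.inr j)).insertNth (α := fun _ => α) y w (blocks h' (Sum.inl i)))
      = fun i => w (blocks h (Sum.inl i)) := by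
  funext i
  have skip : blocks h' (Sum.inl i)
      = (blocks h' (Sum.inr j)).succAbove (blocks h (Sum.inl i)) := by
    ext
    simp [blocks, Fin.succAbove, Fin.lt_def]
    split_ifs <;> simp
    omega
  simp only [skip, Fin.insertNth_apply_succAbove]

end InsertIntoBlocks

section ContractPart

variable {a b n : ℕ} (f : FormalSeries H M) (G : M →ₗ[ℝ] FormalSeries H M')

/-- The part of the contraction of `f` with `G` in which `f` has `a` arguments and the values of
`G` have `b` arguments. -/
noncomputable def contractPart (h : a + b = n) : MultilinearMap ℝ (fun _ : Fin n => H) M' :=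
  ((Nat.factorial a : ℝ) * (Nat.factorial b : ℝ))⁻¹ •
    gradedSymmetrize ((MultilinearMap.uncurrySum (R := ℝ) (N := fun _ => (H : Type u))
      ((coeff b ∘ₗ G).compMultilinearMap (coeff a f))).domDomCongr (blocks h))

/-- The summand of `contractPart` that belongs to the permutation `σ`. -/
noncomputable def contractTerm (h : a + b = n) (d : Fin n → ℤ × ZMod 2) (x : Fin n → H)
    (σ : Equiv.Perm (Fin n)) : M' :=
  koszul σ (fun i => (d i).2) •
    coeff b (G (coeff a f fun i => x (σ (blocks h (Sum.inl i))))) fun j =>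
      x (σ (blocks h (Sum.inr j)))

theorem contractPart_apply (h : a + b = n) {d : Fin n → ℤ × ZMod 2} {x : Fin n → H}
    (hx : HomTuple H d x) :
    contractPart f G h x = ((Nat.factorial a : ℝ) * (Nat.factorial b : ℝ))⁻¹ •
      ∑ σ : Equiv.Perm (Fin n), contractTerm f G h d x σ := by
  rw [contractPart, smul_apply, gradedSymmetrize_apply _ hx]
  rfl

variable {d : Fin n → ℤ × ZMod 2} {x : Fin n → H} {e : ℤ × ZMod 2} {y : H}

theorem contractTerm_insertPerm_inl (h : a + b = n) (h' : a + 1 + b = n + 1)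
    (hx : HomTuple H d x) (hy : y ∈ H.gr e) (j : Fin (a + 1)) (τ : Equiv.Perm (Fin n)) :
    contractTerm f G h' (Fin.cons e d) (Fin.cons y x) (insertPerm (blocks h' (Sum.inl j)) τ)
      = contractTerm (pderiv y f) G h d x τ := by
  have left_lt (i : Fin a) :
      (blocks h (Sum.inl i)).castSucc < blocks h' (Sum.inl j) ↔ i.castSucc < j := by
    simp [blocks, Fin.lt_def]
  have right_not_lt (i : Fin b) : ¬ (blocks h (Sum.inr i)).castSucc < blocks h' (Sum.inl j) := by
    simp [blocks, Fin.lt_def]; omega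
  simp only [contractTerm, congrFun (cons_insertPerm (blocks h' (Sum.inl j)) τ y x)]
  rw [insertNth_blocks_inl_inl h, insertNth_blocks_inl_inr h,
    (isGradedSymm_coeff (a + 1) f).insertNth (hx.comp _) hy j, koszul_insertPerm, prod_blocks h]
  simp only [Fin.cons_zero, Fin.cons_succ, left_lt, right_not_lt, if_false,
    Finset.prod_const_one, mul_one, map_smul, smul_apply, coeff_pderiv]
  rw [smul_smul, mul_right_comm, ← Finset.prod_mul_distrib, Finset.prod_eq_one, one_mul]
  intro i _
  split_ifs <;> simp

theorem contractTerm_insertPerm_inr (h : a + b = n) (h' : a + (b + 1) = n + 1)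
    (hx : HomTuple H d x) (hy : y ∈ H.gr e) (j : Fin (b + 1)) (τ : Equiv.Perm (Fin n)) :
    contractTerm f G h' (Fin.cons e d) (Fin.cons y x) (insertPerm (blocks h' (Sum.inr j)) τ)
      = contractTerm (twist e.2 f) (pderiv y ∘ₗ G) h d x τ := by
  have left_lt (i : Fin a) : (blocks h (Sum.inl i)).castSucc < blocks h' (Sum.inr j) := by
    simp [blocks, Fin.lt_def]; omega
  have right_lt (i : Fin b) :
      (blocks h (Sum.inr i)).castSucc < blocks h' (Sum.inr j) ↔ i.castSucc < j := by
    simp [blocks, Fin.lt_def]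
  simp only [contractTerm, congrFun (cons_insertPerm (blocks h' (Sum.inr j)) τ y x)]
  rw [insertNth_blocks_inr_inr h, insertNth_blocks_inr_inl h,
    (isGradedSymm_coeff (b + 1) _).insertNth (hx.comp _) hy j, koszul_insertPerm, prod_blocks h,
    coeff_twist_of_homTuple e.2 f (hx.comp _)]
  simp only [Fin.cons_zero, Fin.cons_succ, left_lt, right_lt, if_true, map_smul, smul_apply,
    coeff_pderiv, LinearMap.comp_apply]
  have signs_cancel : (∏ i : Fin b, if i.castSucc < j then
        swapSign e.2 (d (τ (blocks h (Sum.inr i)))).2 else 1) *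
      (∏ i : Fin b, if i.castSucc < j then
        swapSign e.2 (d (τ (blocks h (Sum.inr i)))).2 else 1) = 1 := by
    rw [← Finset.prod_mul_distrib]
    refine Finset.prod_eq_one fun i _ => ?_
    split_ifs <;> simp
  rw [smul_smul, smul_smul]
  congr 1
  linear_combination (∏ i : Fin a, swapSign e.2 (d (τ (blocks h (Sum.inl i)))).2) *
    koszul τ (fun i => (d i).2) * signs_cancel

theorem inv_factorial_succ_mul_smul (a : ℕ) (c : ℝ) (m : M) :
    (((a + 1).factorial : ℝ) * c)⁻¹ • (a + 1) • m = ((a.factorial : ℝ) * c)⁻¹ • m := by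
  rw [← Nat.cast_smul_eq_nsmul ℝ, smul_smul, Nat.factorial_succ]
  congr 1
  have := Nat.cast_add_one_ne_zero (R := ℝ) a
  push_cast
  rw [mul_assoc, mul_inv, mul_right_comm, inv_mul_cancel₀ this, one_mul]

/-- The summands of `contractPart` in which the first argument is an argument of `f`. -/
noncomputable def contractPartLeft (h : a + b = n + 1) (d : Fin (n + 1) → ℤ × ZMod 2)
    (x : Fin (n + 1) → H) : M' :=
  ((Nat.factorial a : ℝ) * (Nat.factorial b : ℝ))⁻¹ •
    ∑ j : Fin a, ∑ τ, contractTerm f G h d x (insertPerm (blocks h (Sum.inl j)) τ)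

/-- The summands of `contractPart` in which the first argument is an argument of a value
of `G`. -/
noncomputable def contractPartRight (h : a + b = n + 1) (d : Fin (n + 1) → ℤ × ZMod 2)
    (x : Fin (n + 1) → H) : M' :=
  ((Nat.factorial a : ℝ) * (Nat.factorial b : ℝ))⁻¹ •
    ∑ j : Fin b, ∑ τ, contractTerm f G h d x (insertPerm (blocks h (Sum.inr j)) τ)

theorem contractPart_eq_left_add_right (h : a + b = n + 1) {d : Fin (n + 1) → ℤ × ZMod 2}
    {x : Fin (n + 1) → H} (hx : HomTuple H d x) :
    contractPart f G h x = contractPartLeft f G h d x + contractPartRight f G h d x := by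
  rw [contractPart_apply f G h hx, sum_perm_succ, sum_blocks h, smul_add]
  rfl

theorem contractPartLeft_succ {a' b' : ℕ} (h : a' + b' = n + 1) (h' : a + b = n)
    (ha : a' = a + 1) (hx : HomTuple H d x) (hy : y ∈ H.gr e) :
    contractPartLeft f G h (Fin.cons e d) (Fin.cons y x)
      = contractPart (pderiv y f) G h' x := by
  obtain rfl : b' = b := by omega
  subst ha
  rw [contractPart_apply _ _ _ hx, contractPartLeft]
  simp only [contractTerm_insertPerm_inl f G h' h hx hy, Finset.sum_const,
    Finset.card_univ, Fintype.card_fin, inv_factorial_succ_mul_smul]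

theorem contractPartRight_succ {b' : ℕ} (h : a + b' = n + 1) (h' : a + b = n)
    (hx : HomTuple H d x) (hy : y ∈ H.gr e) :
    contractPartRight f G h (Fin.cons e d) (Fin.cons y x)
      = contractPart (twist e.2 f) (pderiv y ∘ₗ G) h' x := by
  obtain rfl : b' = b + 1 := by omega
  rw [contractPart_apply _ _ _ hx, contractPartRight]
  simp only [contractTerm_insertPerm_inr f G h' h hx hy, Finset.sum_const, Finset.card_univ,
    Fintype.card_fin, mul_comm (a.factorial : ℝ), inv_factorial_succ_mul_smul]

theorem contractPartRight_eq_zero (h : a + b = n + 1) (hb : b = 0) (d : Fin (n + 1) → ℤ × ZMod 2)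
    (x : Fin (n + 1) → H) : contractPartRight f G h d x = 0 := by
  subst hb
  exact smul_zero _

end ContractPart

/-- The contraction as a sequence of multilinear maps. -/
noncomputable def contractSeries (f : FormalSeries H M) (G : M →ₗ[ℝ] FormalSeries H M') :
    FormalSeries H M' :=
  ⟨fun n => ∑ k : Fin (n + 1), contractPart (a := k) (b := n - k) f G (by omega), by
    intro n d x hx σ
    simp only [sum_apply, Finset.smul_sum, contractPart, smul_apply]
    refine Finset.sum_congr rfl fun k _ => ?_
    rw [isGradedSymm_gradedSymmetrize _ d x hx σ, smul_comm]⟩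

theorem coeff_contractSeries (f : FormalSeries H M) (G : M →ₗ[ℝ] FormalSeries H M') {n : ℕ}
    {d : Fin n → ℤ × ZMod 2} {x : Fin n → H} (hx : HomTuple H d x) :
    coeff n (contractSeries f G) x = ∑ k : Fin (n + 1),
      ((Nat.factorial k : ℝ) * (Nat.factorial (n - k) : ℝ))⁻¹ •
      ∑ σ : Equiv.Perm (Fin n), koszul σ (fun i => (d i).2) •
        coeff (n - k) (G (coeff k f (fun i => x (σ (split k (Sum.inl i))))))
          (fun j => x (σ (split k (Sum.inr j)))) := by
  change (∑ k : Fin (n + 1), contractPart f G _) x = _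
  rw [sum_apply]
  exact Finset.sum_congr rfl fun k _ => contractPart_apply _ _ _ hx

/-- The series `x ↦ (G (f x)) x` obtained by inserting the values of `f` into a linear family `G` of
series. The product of functions, the action of vector fields on functions and the substitution of
series are all built from this operation. -/
noncomputable def contract :
    FormalSeries H M →ₗ[ℝ] (M →ₗ[ℝ] FormalSeries H M') →ₗ[ℝ] FormalSeries H M' :=
  LinearMap.mk₂ ℝ contractSeries
    (fun f g G => formalSeries_ext fun n d x hx => by
      simp only [map_add, add_apply, coeff_contractSeries _ _ hx, smul_add,
        Finset.sum_add_distrib])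
    (fun c f G => formalSeries_ext fun n d x hx => by
      simp only [map_smul, smul_apply, coeff_contractSeries _ _ hx, Finset.smul_sum, smul_comm c])
    (fun f G G' => formalSeries_ext fun n d x hx => by
      simp only [map_add, LinearMap.add_apply, add_apply, coeff_contractSeries _ _ hx, smul_add,
        Finset.sum_add_distrib])
    (fun c f G => formalSeries_ext fun n d x hx => by
      simp only [map_smul, LinearMap.smul_apply, smul_apply, coeff_contractSeries _ _ hx,
        Finset.smul_sum, smul_comm c])

theorem coeff_contract (f : FormalSeries H M) (G : M →ₗ[ℝ] FormalSeries H M') {n : ℕ}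
    {d : Fin n → ℤ × ZMod 2} {x : Fin n → H} (hx : HomTuple H d x) :
    coeff n (contract f G) x = ∑ k : Fin (n + 1),
      ((Nat.factorial k : ℝ) * (Nat.factorial (n - k) : ℝ))⁻¹ •
      ∑ σ : Equiv.Perm (Fin n), koszul σ (fun i => (d i).2) •
        coeff (n - k) (G (coeff k f (fun i => x (σ (split k (Sum.inl i))))))
          (fun j => x (σ (split k (Sum.inr j)))) :=
  coeff_contractSeries f G hx

theorem pderiv_contract (f : FormalSeries H M) (G : M →ₗ[ℝ] FormalSeries H M')
    {e : ℤ × ZMod 2} {y : H} (hy : y ∈ H.gr e) :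
    pderiv y (contract f G)
      = contract (pderiv y f) G + contract (twist e.2 f) (pderiv y ∘ₗ G) := by
  refine formalSeries_ext fun n d x hx => ?_
  change (∑ k : Fin (n + 1 + 1), contractPart f G _) _
    = (∑ k : Fin (n + 1), contractPart _ _ _) x + (∑ k : Fin (n + 1), contractPart _ _ _) x
  simp only [sum_apply]
  rw [Finset.sum_congr rfl fun k _ => contractPart_eq_left_add_right f G _ (hx.cons hy),
    Finset.sum_add_distrib]
  congr 1
  · rw [Fin.sum_univ_succ, show contractPartLeft f G _ _ _ = 0 from smul_zero _, zero_add]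
    exact Finset.sum_congr rfl fun k _ => contractPartLeft_succ f G _ _ (by simp) hx hy
  · rw [Fin.sum_univ_castSucc, contractPartRight_eq_zero f G _ (by simp), add_zero]
    exact Finset.sum_congr rfl fun k _ => contractPartRight_succ f G _ _ hx hy

theorem constantCoeff_contract (f : FormalSeries H M) (G : M →ₗ[ℝ] FormalSeries H M') :
    constantCoeff (contract f G) = constantCoeff (G (constantCoeff f)) := by
  have h := coeff_contract f G (d := Fin.elim0) (x := Fin.elim0) fun i => i.elim0
  simp only [coeff_zero_apply, Fintype.sum_unique, Fin.sum_univ_succ, Fin.sum_univ_zero] at h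
  rw [h, show (default : Equiv.Perm (Fin 0)) = 1 from rfl, koszul_one]
  simp [coeff_zero_apply]

theorem contract_postcomp (φ : M →ₗ[ℝ] M') (f : FormalSeries H M)
    (G : M' →ₗ[ℝ] FormalSeries H M'') : contract (postcomp φ f) G = contract f (G ∘ₗ φ) :=
  formalSeries_ext fun n d x hx => by
    simp only [coeff_contract _ _ hx, coeff_postcomp, LinearMap.comp_apply]

theorem postcomp_contract (φ : M' →ₗ[ℝ] M'') (f : FormalSeries H M)
    (G : M →ₗ[ℝ] FormalSeries H M') :
    postcomp φ (contract f G) = contract f (postcomp φ ∘ₗ G) :=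
  formalSeries_ext fun n d x hx => by
    simp only [coeff_contract _ _ hx, coeff_postcomp, LinearMap.comp_apply, map_sum, map_smul]

theorem twist_contract (δ : ZMod 2) (f : FormalSeries H M) (G : M →ₗ[ℝ] FormalSeries H M') :
    twist δ (contract f G) = contract (twist δ f) (twist δ ∘ₗ G) :=
  formalSeries_ext fun n d x hx => by
    rw [coeff_twist, coeff_contract _ _ fun i => parityOp_mem δ (hx i), coeff_contract _ _ hx]
    rfl

theorem continuous_coeff_contract {X : Type*} [TopologicalSpace X] (f : FormalSeries H M)
    {G : X → M →ₗ[ℝ] FormalSeries H ℝ}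
    (hG : ∀ m n w, Continuous fun a => coeff n (G a m) w) (n : ℕ) (x : Fin n → H) :
    Continuous fun a => coeff n (contract f (G a)) x := by
  change Continuous fun a => (∑ k : Fin (n + 1), contractPart f (G a) _) x
  simp only [contractPart, gradedSymmetrize, sum_apply, smul_apply]
  refine continuous_finsetSum _ fun k _ => continuous_const.mul <|
    continuous_finsetSum _ fun σ _ => continuous_finsetSum _ fun p _ => continuous_const.mul ?_
  exact hG _ _ _

/-! ### Identities for contractions -/

theorem coeff_zero_eq {f g : FormalSeries H M} (h : constantCoeff f = constantCoeff g) :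
    coeff 0 f = coeff 0 g :=
  MultilinearMap.ext fun x => by rw [coeff_zero_apply, coeff_zero_apply, h]

theorem coeff_succ_eq {f g : FormalSeries H M} {n : ℕ}
    (h : ∀ d, ∀ y ∈ H.gr d, coeff n (pderiv y f) = coeff n (pderiv y g)) :
    coeff (n + 1) f = coeff (n + 1) g :=
  multilinearMap_ext_homogeneous fun d x hx => by
    rw [coeff_succ_apply, coeff_succ_apply, h (d 0) (x 0) (hx 0)]

theorem formalSeries_ext_coeff {f g : FormalSeries H M} (h : ∀ n, coeff n f = coeff n g) : f = g :=
  Subtype.ext (funext h)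

theorem formalSeries_ext_pderiv {f g : FormalSeries H M}
    (h₀ : constantCoeff f = constantCoeff g)
    (h : ∀ d, ∀ y ∈ H.gr d, pderiv y f = pderiv y g) : f = g :=
  formalSeries_ext_coeff fun n => match n with
    | 0 => coeff_zero_eq h₀
    | _ + 1 => coeff_succ_eq fun d y hy => congrArg _ (h d y hy)

@[simp] theorem twist_const (δ : ZMod 2) (m : M) :
    twist δ (const m : FormalSeries H M) = const m :=
  formalSeries_ext_coeff fun n => by cases n <;> rfl

theorem contract_const (m : M) (G : M →ₗ[ℝ] FormalSeries H M') :
    contract (const m) G = G m := by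
  refine formalSeries_ext_coeff fun n => ?_
  induction n generalizing G with
  | zero => exact coeff_zero_eq (by simp [constantCoeff_contract])
  | succ n ih =>
    refine coeff_succ_eq fun d y hy => ?_
    rw [pderiv_contract _ _ hy, pderiv_const, map_zero, LinearMap.zero_apply, zero_add, twist_const,
      ih, LinearMap.comp_apply]

theorem contract_assoc (f : FormalSeries H M) (G : M →ₗ[ℝ] FormalSeries H M')
    (K : M' →ₗ[ℝ] FormalSeries H M'') :
    contract (contract f G) K = contract f (contract.flip K ∘ₗ G) := by
  refine formalSeries_ext_coeff fun n => ?_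
  induction n generalizing f G K with
  | zero => exact coeff_zero_eq (by simp [constantCoeff_contract])
  | succ n ih =>
    refine coeff_succ_eq fun d y hy => ?_
    have leibniz : pderiv y ∘ₗ contract.flip K ∘ₗ G = contract.flip K ∘ₗ pderiv y ∘ₗ G
        + contract.flip (pderiv y ∘ₗ K) ∘ₗ twist d.2 ∘ₗ G :=
      LinearMap.ext fun m => pderiv_contract _ _ hy
    rw [pderiv_contract _ _ hy, pderiv_contract _ _ hy, pderiv_contract _ _ hy, twist_contract,
      leibniz]
    simp only [map_add, LinearMap.add_apply, ih, add_assoc]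

/-! ### Graded series -/

/-- The series that map arguments of total degree `s` to `𝒟 s`. -/
def gradedSeries (H : GrSpace.{u}) (𝒟 : ℤ × ZMod 2 → Submodule ℝ M) :
    Submodule ℝ (FormalSeries H M) where
  carrier := {f | ∀ n d x, HomTuple H d x → coeff n f x ∈ 𝒟 (∑ i, d i)}
  add_mem' hf hg n d x hx := add_mem (hf n d x hx) (hg n d x hx)
  zero_mem' _ _ _ _ := zero_mem _
  smul_mem' c _ hf n d x hx := Submodule.smul_mem _ c (hf n d x hx)

/-- The degrees of the values of a map of degree `e`, in terms of the total degree of the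
arguments. -/
def GrSpace.shiftedGr (B : GrSpace.{u}) (e s : ℤ × ZMod 2) : Submodule ℝ B := B.gr (s + e)

theorem GrSpace.shiftedGr_zero (B : GrSpace.{u}) : B.shiftedGr 0 = B.gr :=
  funext fun s => congrArg B.gr (add_zero s)

theorem constantCoeff_mem {𝒟 : ℤ × ZMod 2 → Submodule ℝ M} {f : FormalSeries H M}
    (hf : f ∈ gradedSeries H 𝒟) : constantCoeff f ∈ 𝒟 0 := by
  simpa [coeff_zero_apply] using hf 0 Fin.elim0 Fin.elim0 fun i => i.elim0

theorem const_mem_gradedSeries {𝒟 : ℤ × ZMod 2 → Submodule ℝ M} {m : M} (hm : m ∈ 𝒟 0) :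
    const m ∈ gradedSeries H 𝒟 := by
  rintro (_ | n) d x -
  · simpa [coeff_zero_apply] using hm
  · exact zero_mem _

theorem pderiv_mem_gradedSeries {𝒟 : ℤ × ZMod 2 → Submodule ℝ M} {f : FormalSeries H M}
    (hf : f ∈ gradedSeries H 𝒟) {d : ℤ × ZMod 2} {y : H} (hy : y ∈ H.gr d) :
    pderiv y f ∈ gradedSeries H fun s => 𝒟 (s + d) := fun n c x hx => by
  simpa [Fin.sum_univ_succ, add_comm d] using hf (n + 1) _ _ (hx.cons hy)

theorem pderiv_mem_shiftedGr {B : GrSpace.{u}} {e d : ℤ × ZMod 2} {b : FormalSeries H B}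
    (hb : b ∈ gradedSeries H (B.shiftedGr e)) {y : H} (hy : y ∈ H.gr d) :
    pderiv y b ∈ gradedSeries H (B.shiftedGr (d + e)) := by
  have h := pderiv_mem_gradedSeries hb hy
  simp only [GrSpace.shiftedGr, add_assoc] at h
  exact h

theorem postcomp_mem_gradedSeries {𝒟 : ℤ × ZMod 2 → Submodule ℝ M}
    {𝒟' : ℤ × ZMod 2 → Submodule ℝ M'} {φ : M →ₗ[ℝ] M'} (hφ : ∀ s, ∀ m ∈ 𝒟 s, φ m ∈ 𝒟' s)
    {f : FormalSeries H M} (hf : f ∈ gradedSeries H 𝒟) : postcomp φ f ∈ gradedSeries H 𝒟' :=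
  fun n d x hx => hφ _ _ (hf n d x hx)

theorem contract_mem_gradedSeries {𝒜 : ℤ × ZMod 2 → Submodule ℝ M}
    {𝒟 : ℤ × ZMod 2 → Submodule ℝ M'} {f : FormalSeries H M} (hf : f ∈ gradedSeries H 𝒜)
    {G : M →ₗ[ℝ] FormalSeries H M'}
    (hG : ∀ p, ∀ m ∈ 𝒜 p, G m ∈ gradedSeries H fun s => 𝒟 (s + p)) :
    contract f G ∈ gradedSeries H 𝒟 := by
  intro n d x hx
  rw [coeff_contract f G hx]
  refine sum_mem fun k _ => Submodule.smul_mem _ _ (sum_mem fun σ _ => Submodule.smul_mem _ _ ?_)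
  have total_degree : ∑ j, d (σ (split k (Sum.inr j))) + ∑ i, d (σ (split k (Sum.inl i)))
      = ∑ i, d i := by
    rw [add_comm, ← Fintype.sum_sum_type fun i => d (σ (split k i)),
      (split k).sum_comp fun i => d (σ i), Equiv.sum_comp σ]
  rw [← total_degree]
  exact hG _ _ (hf _ _ _ (hx.comp fun i => σ (split k (Sum.inl i)))) _ _ _
    (hx.comp fun j => σ (split k (Sum.inr j)))

theorem twist_eq_smul_postcomp {B : GrSpace.{u}} {e : ℤ × ZMod 2} {b : FormalSeries H B}
    (hb : b ∈ gradedSeries H (B.shiftedGr e)) (δ : ZMod 2) :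
    twist δ b = swapSign δ e.2 • postcomp (parityOp B δ) b := by
  refine formalSeries_ext fun n d x hx => ?_
  rw [coeff_twist_of_homTuple δ b hx, map_smul, smul_apply, coeff_postcomp,
    parityOp_of_mem δ (hb n d x hx), smul_smul, Prod.snd_add, Prod.snd_sum, swapSign_add_right,
    ← swapSign_sum, mul_comm, mul_assoc, swapSign_mul_self, mul_one]

/-! ### Exchanging the order of two contractions -/

/-- For a bilinear family `G`, the linear family `u ↦ ± (contraction of f with G · u)`, where the
sign is that of moving `f` past an element of degree `u + δ`. -/
noncomputable def braid {B : GrSpace.{u}} (δ : ZMod 2) (f : FormalSeries H M)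
    (G : M →ₗ[ℝ] B →ₗ[ℝ] FormalSeries H M') : B →ₗ[ℝ] FormalSeries H M' :=
  ∑ ε : ZMod 2, contract (twist (ε + δ) f) ∘ₗ G.flip ∘ₗ B.parityProj ε

section Braid

variable {B : GrSpace.{u}}

theorem braid_of_mem (δ : ZMod 2) (f : FormalSeries H M)
    (G : M →ₗ[ℝ] B →ₗ[ℝ] FormalSeries H M') {q : ℤ × ZMod 2} {u : B} (hu : u ∈ B.gr q) :
    braid δ f G u = contract (twist (q.2 + δ) f) (G.flip u) := by
  rw [braid, LinearMap.sum_apply, Finset.sum_eq_single q.2]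
  · simp [B.parityProj_of_mem _ hu]
  · intro ε _ hε
    simp [B.parityProj_of_mem _ hu, hε.symm]
  · simp

theorem differential_contract {f : FormalSeries H M} {G : M →ₗ[ℝ] FormalSeries H M'} :
    differential (contract f G)
      = contract.flip G ∘ₗ differential f + braid 0 f (pderiv.flip ∘ₗ G) := by
  refine linearMap_ext_homogeneous fun d y hy => ?_
  rw [LinearMap.add_apply, braid_of_mem _ _ _ hy, add_zero]
  exact pderiv_contract _ _ hy

theorem pderiv_braid (δ : ZMod 2) (f : FormalSeries H M) (G : M →ₗ[ℝ] B →ₗ[ℝ] FormalSeries H M')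
    {d : ℤ × ZMod 2} {y : H} (hy : y ∈ H.gr d) :
    pderiv y ∘ₗ braid δ f G ∘ₗ parityOp B d.2 = swapSign d.2 δ • braid δ (pderiv y f) G
      + braid δ (twist d.2 f) ((LinearMap.llcomp ℝ _ _ _ (pderiv y)) ∘ₗ
        (LinearMap.lcomp ℝ _ (parityOp B d.2)) ∘ₗ G) := by
  refine linearMap_ext_homogeneous fun q u hu => ?_
  have flip_eq : (((LinearMap.llcomp ℝ _ _ _ (pderiv y)) ∘ₗ
      (LinearMap.lcomp ℝ _ (parityOp B d.2)) ∘ₗ G).flip u : M →ₗ[ℝ] FormalSeries H M')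
      = swapSign d.2 q.2 • (pderiv y ∘ₗ G.flip u) :=
    LinearMap.ext fun m => by simp [parityOp_of_mem _ hu]
  simp only [LinearMap.comp_apply, LinearMap.add_apply, LinearMap.smul_apply,
    parityOp_of_mem _ hu, map_smul]
  rw [braid_of_mem δ _ _ hu, braid_of_mem δ _ _ hu, braid_of_mem δ _ _ hu,
    pderiv_contract _ _ hy, pderiv_twist _ _ hy, flip_eq]
  simp only [map_smul, LinearMap.smul_apply, smul_add, twist_twist, smul_smul, add_comm d.2]
  congr 2
  rw [swapSign_comm (q.2 + δ), swapSign_add_right, ← mul_assoc, swapSign_mul_self, one_mul]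

theorem contract_swap (f : FormalSeries H M) {e : ℤ × ZMod 2} {b : FormalSeries H B}
    (hb : b ∈ gradedSeries H (B.shiftedGr e)) (G : M →ₗ[ℝ] B →ₗ[ℝ] FormalSeries H M') :
    contract f (contract b ∘ₗ G) = contract b (braid e.2 f G) := by
  refine formalSeries_ext_coeff fun n => ?_
  induction n generalizing f e b G with
  | zero =>
    refine coeff_zero_eq ?_
    have hb₀ : constantCoeff b ∈ B.gr e := by
      simpa [GrSpace.shiftedGr] using constantCoeff_mem hb
    simp [constantCoeff_contract, braid_of_mem _ _ _ hb₀]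
  | succ n ih =>
    refine coeff_succ_eq fun d y hy => ?_
    let G' : M →ₗ[ℝ] B →ₗ[ℝ] FormalSeries H M' := (LinearMap.llcomp ℝ _ _ _ (pderiv y)) ∘ₗ
      (LinearMap.lcomp ℝ _ (parityOp B d.2)) ∘ₗ G
    have leibniz : pderiv y ∘ₗ contract b ∘ₗ G
        = contract (pderiv y b) ∘ₗ G + swapSign d.2 e.2 • (contract b ∘ₗ G') := by
      refine LinearMap.ext fun m => ?_
      simp only [LinearMap.comp_apply, pderiv_contract _ _ hy, twist_eq_smul_postcomp hb, map_smul,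
        LinearMap.smul_apply, contract_postcomp, LinearMap.add_apply]
      rfl
    have braid_twist : braid (d + e).2 (twist d.2 f) G = braid e.2 f G := by
      refine linearMap_ext_homogeneous fun q u hu => ?_
      have add_self : d.2 + d.2 = 0 := CharTwo.add_self_eq_zero _
      rw [braid_of_mem _ _ _ hu, braid_of_mem _ _ _ hu, twist_twist, Prod.snd_add,
        show q.2 + (d.2 + e.2) + d.2 = q.2 + e.2 + (d.2 + d.2) by abel, add_self, add_zero]
    rw [pderiv_contract _ _ hy, pderiv_contract _ _ hy, leibniz, twist_eq_smul_postcomp hb]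
    simp only [map_add, map_smul, LinearMap.smul_apply, contract_postcomp]
    rw [ih _ hb, ih _ (pderiv_mem_shiftedGr hb hy), ih _ hb, braid_twist, LinearMap.comp_assoc,
      pderiv_braid _ _ _ hy]
    simp only [map_add, map_smul, smul_add, smul_smul, swapSign_mul_self, one_smul]
    abel

end Braid

/-! ### The order of a series -/

/-- The series whose Taylor coefficients of order less than `n` vanish. -/
def orderGE (H : GrSpace.{u}) (M : Type*) [AddCommGroup M] [Module ℝ M] (n : ℕ) :
    Submodule ℝ (FormalSeries H M) where
  carrier := {f | ∀ k < n, coeff k f = 0}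
  add_mem' hf hg k hk := by rw [map_add, hf k hk, hg k hk, add_zero]
  zero_mem' _ _ := rfl
  smul_mem' c f hf k hk := by rw [map_smul, hf k hk, smul_zero]

@[simp] theorem orderGE_zero : orderGE H M 0 = ⊤ :=
  eq_top_iff.2 fun _ _ _ hk => absurd hk (Nat.not_lt_zero _)

theorem orderGE_antitone {m n : ℕ} (h : m ≤ n) : orderGE H M n ≤ orderGE H M m :=
  fun _ hf k hk => hf k (hk.trans_le h)

theorem mem_orderGE_one {f : FormalSeries H M} : f ∈ orderGE H M 1 ↔ constantCoeff f = 0 :=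
  ⟨fun h => by rw [← coeff_zero_apply f Fin.elim0, h 0 one_pos]; rfl, fun h k hk => by
    obtain rfl : k = 0 := by omega
    exact coeff_zero_eq (g := 0) (by rw [h, map_zero])⟩

theorem mem_orderGE_succ {f : FormalSeries H M} {n : ℕ} : f ∈ orderGE H M (n + 1) ↔
    constantCoeff f = 0 ∧ ∀ d, ∀ y ∈ H.gr d, pderiv y f ∈ orderGE H M n := by
  refine ⟨fun h => ⟨mem_orderGE_one.1 (orderGE_antitone (by omega) h), fun d y _ k hk =>
    MultilinearMap.ext fun x => ?_⟩, fun h k hk => ?_⟩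
  · rw [coeff_pderiv, h (k + 1) (by omega)]
    rfl
  · cases k with
    | zero => exact mem_orderGE_one.2 h.1 0 one_pos
    | succ k =>
      refine coeff_succ_eq (g := 0) fun d y hy => ?_
      rw [h.2 d y hy k (by omega), map_zero, map_zero]

theorem pderiv_mem_orderGE {f : FormalSeries H M} {n : ℕ} (hf : f ∈ orderGE H M (n + 1)) (y : H) :
    pderiv y f ∈ orderGE H M n := fun k hk => MultilinearMap.ext fun x => by
  rw [coeff_pderiv, hf (k + 1) (by omega)]
  rfl

theorem eq_zero_of_forall_mem_orderGE {f : FormalSeries H M} (h : ∀ n, f ∈ orderGE H M n) :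
    f = 0 := formalSeries_ext_coeff fun n => h (n + 1) n n.lt_succ_self

theorem contract_mem_orderGE {f : FormalSeries H M} {G : M →ₗ[ℝ] FormalSeries H M'} {a b : ℕ}
    (hf : f ∈ orderGE H M a) (hG : ∀ m, G m ∈ orderGE H M' b) :
    contract f G ∈ orderGE H M' (a + b) := by
  refine fun n hn => multilinearMap_ext_homogeneous fun d x hx => ?_
  rw [coeff_contract f G hx]
  refine Finset.sum_eq_zero fun k _ => ?_
  rcases lt_or_ge (k : ℕ) a with hk | hk
  · simp [hf k hk]
  · simp [hG _ (n - k) (by omega)]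

/-! ### Vector fields -/

/-- The linear series `x ↦ φ x`. -/
def linear : (H →ₗ[ℝ] M) →ₗ[ℝ] FormalSeries H M where
  toFun φ := ⟨fun n => match n with
    | 1 => MultilinearMap.ofSubsingleton ℝ H M (0 : Fin 1) φ
    | 0 | _ + 2 => 0, by
    rintro (_ | _ | n) d x _ σ
    · simp
    · obtain rfl : σ = 1 := Equiv.ext fun i => Subsingleton.elim (α := Fin 1) _ _
      rw [koszul_one, one_smul]
      rfl
    · simp⟩
  map_add' φ ψ := Subtype.ext (funext fun n => by rcases n with _ | _ | n <;> ext x <;> simp)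
  map_smul' c φ := Subtype.ext (funext fun n => by rcases n with _ | _ | n <;> ext x <;> simp)

theorem coeff_one_linear (φ : H →ₗ[ℝ] M) (x : Fin 1 → H) : coeff 1 (linear φ) x = φ (x 0) := rfl

@[simp] theorem constantCoeff_linear (φ : H →ₗ[ℝ] M) : constantCoeff (linear φ) = 0 := rfl

@[simp] theorem pderiv_linear (y : H) (φ : H →ₗ[ℝ] M) : pderiv y (linear φ) = const (φ y) :=
  formalSeries_ext_coeff fun n => by cases n <;> rfl

@[simp] theorem postcomp_linear (φ : H →ₗ[ℝ] M) (ψ : M →ₗ[ℝ] M') :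
    postcomp ψ (linear φ) = linear (ψ ∘ₗ φ) :=
  formalSeries_ext_coeff fun n => by
    rcases n with _ | _ | n <;> ext x <;> simp [linear, coeff, postcomp]

theorem linear_mem_gradedSeries {𝒟 : ℤ × ZMod 2 → Submodule ℝ M} {φ : H →ₗ[ℝ] M}
    (hφ : ∀ d, ∀ x ∈ H.gr d, φ x ∈ 𝒟 d) : linear φ ∈ gradedSeries H 𝒟 := by
  rintro (_ | _ | n) d x hx
  · exact zero_mem _
  · simpa [coeff_one_linear] using hφ _ _ (hx 0)
  · exact zero_mem _

theorem contract_const_right (f : FormalSeries H M) : contract f const = f := by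
  refine formalSeries_ext_coeff fun n => ?_
  induction n generalizing f with
  | zero => exact coeff_zero_eq (by simp [constantCoeff_contract])
  | succ n ih =>
    refine coeff_succ_eq fun d y hy => ?_
    have pderiv_comp_const : (pderiv y ∘ₗ const : M →ₗ[ℝ] FormalSeries H M) = 0 :=
      LinearMap.ext fun m => pderiv_const y m
    rw [pderiv_contract _ _ hy, pderiv_comp_const, map_zero, add_zero, ih]

/-- The derivative of a series along a vector field. -/
noncomputable def derivAlong :
    FormalSeries H H →ₗ[ℝ] FormalSeries H M →ₗ[ℝ] FormalSeries H M :=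
  contract.compl₂ pderiv.flip

theorem derivAlong_apply (v : FormalSeries H H) (f : FormalSeries H M) :
    derivAlong v f = contract v (differential f) := rfl

theorem derivAlong_postcomp (v : FormalSeries H H) (φ : M →ₗ[ℝ] M') (f : FormalSeries H M) :
    derivAlong v (postcomp φ f) = postcomp φ (derivAlong v f) :=
  (postcomp_contract φ v (differential f)).symm

theorem derivAlong_linear (v : FormalSeries H H) (φ : H →ₗ[ℝ] M) :
    derivAlong v (linear φ) = postcomp φ v := by
  have differential_linear : differential (linear φ) = const ∘ₗ φ :=
    LinearMap.ext fun y => pderiv_linear y φ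
  rw [derivAlong_apply, differential_linear, ← contract_postcomp, contract_const_right]

theorem derivAlong_mem_gradedSeries {e : ℤ × ZMod 2} {v : FormalSeries H H}
    (hv : v ∈ gradedSeries H (H.shiftedGr e)) {𝒟 : ℤ × ZMod 2 → Submodule ℝ M}
    {f : FormalSeries H M} (hf : f ∈ gradedSeries H 𝒟) :
    derivAlong v f ∈ gradedSeries H fun s => 𝒟 (s + e) :=
  contract_mem_gradedSeries hv fun p m hm => by
    simpa only [add_assoc, LinearMap.flip_apply] using pderiv_mem_gradedSeries hf hm

theorem derivAlong_mem_shiftedGr {a b : ℤ × ZMod 2} {v : FormalSeries H H}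
    (hv : v ∈ gradedSeries H (H.shiftedGr a)) {w : FormalSeries H K}
    (hw : w ∈ gradedSeries H (K.shiftedGr b)) :
    derivAlong v w ∈ gradedSeries H (K.shiftedGr (a + b)) := by
  have h := derivAlong_mem_gradedSeries hv hw
  simp only [GrSpace.shiftedGr, add_assoc] at h
  exact h

theorem derivAlong_mem_orderGE {v : FormalSeries H H} {f : FormalSeries H M} {a b : ℕ}
    (hv : v ∈ orderGE H H a) (hf : f ∈ orderGE H M (b + 1)) :
    derivAlong v f ∈ orderGE H M (a + b) :=
  contract_mem_orderGE hv fun y => pderiv_mem_orderGE hf y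

theorem pderiv_comp_differential_comp_parityOp (f : FormalSeries H M) {d : ℤ × ZMod 2} {y : H}
    (hy : y ∈ H.gr d) :
    pderiv y ∘ₗ differential f ∘ₗ parityOp H d.2 = differential (pderiv y f) := by
  refine linearMap_ext_homogeneous fun c z hz => ?_
  simp only [LinearMap.comp_apply, parityOp_of_mem _ hz, map_smul, LinearMap.flip_apply]
  rw [pderiv_pderiv hy hz, smul_smul, swapSign_mul_self, one_smul]

theorem pderiv_derivAlong {e : ℤ × ZMod 2} {v : FormalSeries H H}
    (hv : v ∈ gradedSeries H (H.shiftedGr e)) (f : FormalSeries H M) {d : ℤ × ZMod 2} {y : H}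
    (hy : y ∈ H.gr d) :
    pderiv y (derivAlong v f)
      = derivAlong (pderiv y v) f + swapSign d.2 e.2 • derivAlong v (pderiv y f) := by
  rw [derivAlong_apply, pderiv_contract _ _ hy, twist_eq_smul_postcomp hv, map_smul,
    LinearMap.smul_apply, contract_postcomp, LinearMap.comp_assoc,
    pderiv_comp_differential_comp_parityOp f hy]
  rfl

/-- The second derivative `z ↦ v ⌟ w ⌟ ∂∂f` that remains in an iterated derivative along `v` and `w`
when the derivatives of `w` are subtracted. -/
noncomputable def secondDeriv (v w : FormalSeries H H) (f : FormalSeries H M) :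
    FormalSeries H M :=
  contract v (braid 0 w (pderiv.flip ∘ₗ differential f))

theorem derivAlong_derivAlong (v w : FormalSeries H H) (f : FormalSeries H M) :
    derivAlong v (derivAlong w f) = derivAlong (derivAlong v w) f + secondDeriv v w f := by
  rw [derivAlong_apply v, derivAlong_apply w, differential_contract, map_add, ← contract_assoc]
  rfl

theorem secondDeriv_comm {a b : ℤ × ZMod 2} {v w : FormalSeries H H}
    (hv : v ∈ gradedSeries H (H.shiftedGr a)) (hw : w ∈ gradedSeries H (H.shiftedGr b))
    (f : FormalSeries H M) :
    secondDeriv v w f = swapSign a.2 b.2 • secondDeriv w v f := by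
  let G : H →ₗ[ℝ] H →ₗ[ℝ] FormalSeries H M := pderiv.flip ∘ₗ differential f
  have braid_eq : braid 0 v G = contract v ∘ₗ G ∘ₗ parityOp H a.2 := by
    refine linearMap_ext_homogeneous fun d y hy => ?_
    have symm : G.flip y ∘ₗ parityOp H d.2 = G y :=
      pderiv_comp_differential_comp_parityOp f hy
    rw [braid_of_mem _ _ _ hy, add_zero, twist_eq_smul_postcomp hv, map_smul,
      LinearMap.smul_apply, contract_postcomp, symm]
    simp [parityOp_of_mem _ hy, swapSign_comm a.2]
  have braid_parityOp : braid a.2 w (G ∘ₗ parityOp H a.2) = swapSign a.2 b.2 • braid 0 w G := by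
    refine linearMap_ext_homogeneous fun d y hy => ?_
    have parityOp_sq : parityOp H a.2 ∘ₗ parityOp H a.2 = LinearMap.id :=
      linearMap_ext_homogeneous fun c z hz => by
        simp [parityOp_of_mem _ hz, smul_smul]
    have flip_eq : (G ∘ₗ parityOp H a.2).flip y = G.flip y ∘ₗ parityOp H a.2 := rfl
    rw [LinearMap.smul_apply, braid_of_mem _ _ _ hy, braid_of_mem _ _ _ hy, add_zero,
      ← twist_twist, twist_eq_smul_postcomp hw, map_smul, twist_postcomp, map_smul,
      LinearMap.smul_apply, contract_postcomp, flip_eq, LinearMap.comp_assoc, parityOp_sq,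
      LinearMap.comp_id]
  have swap := contract_swap w hv (G ∘ₗ parityOp H a.2)
  rw [braid_parityOp, ← braid_eq, map_smul] at swap
  change contract v (braid 0 w G) = swapSign a.2 b.2 • contract w (braid 0 v G)
  rw [swap, smul_smul, swapSign_mul_self, one_smul]

theorem derivAlong_comm {a b : ℤ × ZMod 2} {v w : FormalSeries H H}
    (hv : v ∈ gradedSeries H (H.shiftedGr a)) (hw : w ∈ gradedSeries H (H.shiftedGr b))
    (f : FormalSeries H M) :
    derivAlong v (derivAlong w f) - swapSign a.2 b.2 • derivAlong w (derivAlong v f)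
      = derivAlong (derivAlong v w - swapSign a.2 b.2 • derivAlong w v) f := by
  rw [derivAlong_derivAlong, derivAlong_derivAlong, secondDeriv_comm hv hw]
  simp only [map_sub, map_smul, LinearMap.sub_apply, LinearMap.smul_apply, smul_add]
  abel

/-! ### Sums of series of increasing order -/

/-- The sum of a sequence of series `s 0, s 1, …` in which `s k` has order at least `k`. -/
def seriesSum (s : ℕ → FormalSeries H M) : FormalSeries H M :=
  ⟨fun n => coeff n (∑ k ∈ Finset.range (n + 1), s k), fun _ => isGradedSymm_coeff _ _⟩

theorem coeff_seriesSum (s : ℕ → FormalSeries H M) (n : ℕ) :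
    coeff n (seriesSum s) = coeff n (∑ k ∈ Finset.range (n + 1), s k) := rfl

theorem seriesSum_sub_sum_mem_orderGE {s : ℕ → FormalSeries H M} (hs : ∀ k, s k ∈ orderGE H M k)
    (n : ℕ) : seriesSum s - ∑ k ∈ Finset.range n, s k ∈ orderGE H M n := by
  intro m hm
  rw [map_sub, coeff_seriesSum, ← Finset.sum_range_add_sum_Ico s hm, map_add, sub_add_cancel_left,
    neg_eq_zero, map_sum]
  exact Finset.sum_eq_zero fun k hk => hs k m (Finset.mem_Ico.1 hk).1

/-- The property of being in `S` is a condition on each Taylor coefficient separately. -/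
def IsCoeffwise (S : Submodule ℝ (FormalSeries H M)) : Prop :=
  ∀ f, (∀ n, ∃ s ∈ S, coeff n f = coeff n s) → f ∈ S

theorem isCoeffwise_gradedSeries (𝒟 : ℤ × ZMod 2 → Submodule ℝ M) :
    IsCoeffwise (gradedSeries H 𝒟) := fun f h n d x hx => by
  obtain ⟨s, hs, h⟩ := h n
  exact h ▸ hs n d x hx

theorem isCoeffwise_orderGE (n : ℕ) : IsCoeffwise (orderGE H M n) := fun f h k hk => by
  obtain ⟨s, hs, h⟩ := h k
  exact h.trans (hs k hk)

theorem IsCoeffwise.inf {S T : Submodule ℝ (FormalSeries H M)} (hS : IsCoeffwise S)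
    (hT : IsCoeffwise T) : IsCoeffwise (S ⊓ T) := fun f h =>
  ⟨hS f fun n => (h n).imp fun _ hs => ⟨hs.1.1, hs.2⟩,
    hT f fun n => (h n).imp fun _ hs => ⟨hs.1.2, hs.2⟩⟩

theorem exists_apply_eq_of_approx {A : FormalSeries K M →ₗ[ℝ] FormalSeries H M'}
    (hA : ∀ n, ∀ f ∈ orderGE K M n, A f ∈ orderGE H M' n)
    {S : Submodule ℝ (FormalSeries K M)} (hS : IsCoeffwise S)
    {F : ℕ → Submodule ℝ (FormalSeries H M')} (hF : ∀ k, F k ≤ orderGE H M' k)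
    (approx : ∀ k, ∀ r ∈ F k, ∃ s ∈ S, s ∈ orderGE K M k ∧ r - A s ∈ F (k + 1))
    {g : FormalSeries H M'} (hg : g ∈ F 0) : ∃ f ∈ S, A f = g := by
  choose! s hsS hs hr using approx
  let r : ℕ → FormalSeries H M' := Nat.rec g fun k r => r - A (s k r)
  have r_mem (k : ℕ) : r k ∈ F k := Nat.rec hg (fun k ih => hr k _ ih) k
  have r_eq (k : ℕ) : r k = g - A (∑ j ∈ Finset.range k, s j (r j)) := by
    induction k with
    | zero => simp [r]
    | succ k ih => rw [Finset.sum_range_succ, map_add, ← sub_sub, ← ih]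
  let f := seriesSum fun k => s k (r k)
  refine ⟨f, hS f fun n => ⟨_, sum_mem fun k _ => hsS k _ (r_mem k), rfl⟩,
    sub_eq_zero.1 (eq_zero_of_forall_mem_orderGE fun n => ?_)⟩
  have tail := hA n _ (seriesSum_sub_sum_mem_orderGE (fun k => hs k _ (r_mem k)) n)
  have remainder := hF n (r_mem n)
  rw [r_eq] at remainder
  rw [map_sub] at tail
  simpa using sub_mem tail remainder

/-! ### Substitution of series -/

/-- The Taylor series of a map `M_H → M_K` of formal pointed graded manifolds. -/
structure TaylorMap (H K : GrSpace.{u}) where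
  series : FormalSeries H K
  mem_gradedSeries : series ∈ gradedSeries H K.gr
  constantCoeff_series : constantCoeff series = 0

theorem TaylorMap.ext {Φ Ψ : TaylorMap H K} (h : Φ.series = Ψ.series) : Φ = Ψ := by
  cases Φ; cases Ψ; congr

section Substitution

variable (Φ : TaylorMap H K)

theorem TaylorMap.mem_orderGE_one : Φ.series ∈ orderGE H K 1 :=
  QMan.mem_orderGE_one.2 Φ.constantCoeff_series

theorem TaylorMap.mem_shiftedGr_zero : Φ.series ∈ gradedSeries H (K.shiftedGr 0) :=
  K.shiftedGr_zero.symm ▸ Φ.mem_gradedSeries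

theorem TaylorMap.twist_series (δ : ZMod 2) :
    twist δ Φ.series = postcomp (parityOp K δ) Φ.series := by
  simpa using twist_eq_smul_postcomp Φ.mem_shiftedGr_zero δ

theorem TaylorMap.pderiv_series_mem {d : ℤ × ZMod 2} {y : H} (hy : y ∈ H.gr d) :
    pderiv y Φ.series ∈ gradedSeries H (K.shiftedGr d) := by
  simpa using pderiv_mem_shiftedGr Φ.mem_shiftedGr_zero hy

/-- The part `x ↦ (1/k!) f_k(Φ x, …, Φ x)` of the substitution of `Φ` in a series `f`. -/
noncomputable def substTerm : ℕ → FormalSeries K M →ₗ[ℝ] FormalSeries H M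
  | 0 => const ∘ₗ constantCoeff
  | k + 1 => ((k : ℝ) + 1)⁻¹ • contract Φ.series ∘ₗ
      LinearMap.llcomp ℝ _ _ _ (substTerm k) ∘ₗ pderiv.flip

theorem substTerm_zero (f : FormalSeries K M) : substTerm Φ 0 f = const (constantCoeff f) := rfl

theorem substTerm_succ (k : ℕ) (f : FormalSeries K M) :
    substTerm Φ (k + 1) f
      = ((k : ℝ) + 1)⁻¹ • contract Φ.series (substTerm Φ k ∘ₗ differential f) := rfl

theorem contract_substTerm (k : ℕ) (f : FormalSeries K M) :
    contract Φ.series (substTerm Φ k ∘ₗ differential f)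
      = ((k : ℝ) + 1) • substTerm Φ (k + 1) f := by
  rw [substTerm_succ, smul_inv_smul₀ (by positivity)]

theorem pderiv_substTerm (k : ℕ) (f : FormalSeries K M) {d : ℤ × ZMod 2} {y : H}
    (hy : y ∈ H.gr d) :
    pderiv y (substTerm Φ (k + 1) f)
      = contract (pderiv y Φ.series) (substTerm Φ k ∘ₗ differential f) := by
  induction k generalizing f with
  | zero =>
    have pderiv_substTerm_zero : pderiv y ∘ₗ substTerm Φ 0 ∘ₗ differential f = 0 :=
      LinearMap.ext fun _ => pderiv_const _ _
    simp [substTerm_succ, pderiv_contract _ _ hy, pderiv_substTerm_zero]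
  | succ k ih =>
    let G : K →ₗ[ℝ] K →ₗ[ℝ] FormalSeries H M :=
      LinearMap.llcomp ℝ _ _ _ (substTerm Φ k) ∘ₗ pderiv.flip ∘ₗ differential f ∘ₗ parityOp K d.2
    have pderiv_differential :
        (pderiv y ∘ₗ substTerm Φ (k + 1) ∘ₗ differential f) ∘ₗ parityOp K d.2
          = contract (pderiv y Φ.series) ∘ₗ G :=
      LinearMap.ext fun z => ih _
    have braid_eq : braid d.2 Φ.series G
        = ((k : ℝ) + 1) • (substTerm Φ (k + 1) ∘ₗ differential f) := by
      refine linearMap_ext_homogeneous fun q u hu => ?_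
      have symm : G.flip u ∘ₗ parityOp K (q.2 + d.2)
          = substTerm Φ k ∘ₗ differential (pderiv u f) := by
        refine linearMap_ext_homogeneous fun c z hz => ?_
        simp only [G, LinearMap.comp_apply, LinearMap.flip_apply, LinearMap.llcomp_apply,
          parityOp_of_mem _ hz, map_smul, LinearMap.smul_apply, smul_smul, swapSign_add_left]
        rw [pderiv_pderiv hu hz, map_smul, smul_smul, mul_assoc (swapSign q.2 c.2),
          swapSign_mul_self, mul_one, swapSign_mul_self, one_smul]
      rw [braid_of_mem _ _ _ hu, Φ.twist_series, contract_postcomp, symm, contract_substTerm]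
      rfl
    have add_smul_self (g : FormalSeries H M) :
        g + ((k : ℝ) + 1) • g = ((k : ℝ) + 1 + 1) • g := by module
    rw [substTerm_succ, map_smul, pderiv_contract _ _ hy, Φ.twist_series, contract_postcomp,
      pderiv_differential, contract_swap _ (Φ.pderiv_series_mem hy), braid_eq, map_smul,
      add_smul_self, Nat.cast_succ, inv_smul_smul₀ (by positivity)]

theorem substTerm_mem_orderGE (k : ℕ) (f : FormalSeries K M) :
    substTerm Φ k f ∈ orderGE H M k := by
  induction k generalizing f with
  | zero => simp
  | succ k ih =>
    have h := contract_mem_orderGE Φ.mem_orderGE_one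
      (G := substTerm Φ k ∘ₗ differential f) fun z => ih _
    rw [add_comm] at h
    exact Submodule.smul_mem _ _ h

theorem substTerm_mem_gradedSeries (k : ℕ) {𝒟 : ℤ × ZMod 2 → Submodule ℝ M}
    {f : FormalSeries K M} (hf : f ∈ gradedSeries K 𝒟) :
    substTerm Φ k f ∈ gradedSeries H 𝒟 := by
  induction k generalizing 𝒟 f with
  | zero => exact const_mem_gradedSeries (constantCoeff_mem hf)
  | succ k ih =>
    exact Submodule.smul_mem _ _ (contract_mem_gradedSeries Φ.mem_gradedSeries fun p z hz =>
      ih (pderiv_mem_gradedSeries hf hz))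

/-- The substitution `f ↦ f ∘ Φ`. -/
noncomputable def subst : FormalSeries K M →ₗ[ℝ] FormalSeries H M where
  toFun f := seriesSum fun k => substTerm Φ k f
  map_add' f g := formalSeries_ext_coeff fun n => by
    simp [coeff_seriesSum, Finset.sum_add_distrib]
  map_smul' c f := formalSeries_ext_coeff fun n => by
    simp [coeff_seriesSum, Finset.smul_sum]

theorem coeff_subst (f : FormalSeries K M) (n : ℕ) :
    coeff n (subst Φ f) = coeff n (∑ k ∈ Finset.range (n + 1), substTerm Φ k f) := rfl

theorem subst_sub_sum_mem_orderGE (f : FormalSeries K M) (n : ℕ) :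
    subst Φ f - ∑ k ∈ Finset.range n, substTerm Φ k f ∈ orderGE H M n :=
  seriesSum_sub_sum_mem_orderGE (fun k => substTerm_mem_orderGE Φ k f) n

theorem subst_mem_gradedSeries {𝒟 : ℤ × ZMod 2 → Submodule ℝ M} {f : FormalSeries K M}
    (hf : f ∈ gradedSeries K 𝒟) : subst Φ f ∈ gradedSeries H 𝒟 :=
  isCoeffwise_gradedSeries 𝒟 _ fun _ =>
    ⟨_, sum_mem fun k _ => substTerm_mem_gradedSeries Φ k hf, rfl⟩

@[simp] theorem constantCoeff_subst (f : FormalSeries K M) :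
    constantCoeff (subst Φ f) = constantCoeff f := by
  rw [← coeff_zero_apply _ Fin.elim0, coeff_subst]
  simp [substTerm_zero, coeff_zero_apply]

theorem pderiv_subst (f : FormalSeries K M) (y : H) :
    pderiv y (subst Φ f) = contract (pderiv y Φ.series) (subst Φ ∘ₗ differential f) := by
  suffices differential (subst Φ f)
      = contract.flip (subst Φ ∘ₗ differential f) ∘ₗ differential Φ.series from
    LinearMap.congr_fun this y
  refine linearMap_ext_homogeneous fun d y hy => sub_eq_zero.1 ?_
  refine eq_zero_of_forall_mem_orderGE fun n => ?_
  let partialSum : FormalSeries K M →ₗ[ℝ] FormalSeries H M :=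
    ∑ k ∈ Finset.range n, substTerm Φ k
  have partialSum_differential : partialSum ∘ₗ differential f
      = ∑ k ∈ Finset.range n, substTerm Φ k ∘ₗ differential f :=
    LinearMap.ext fun z => by simp [partialSum]
  have left : pderiv y (subst Φ f) - contract (pderiv y Φ.series) (partialSum ∘ₗ differential f)
      ∈ orderGE H M n := by
    have h := pderiv_mem_orderGE (subst_sub_sum_mem_orderGE Φ f (n + 1)) y
    rw [Finset.sum_range_succ', map_sub, map_add, substTerm_zero, pderiv_const, add_zero,
      map_sum] at h
    simpa only [pderiv_substTerm Φ _ f hy, partialSum_differential, map_sum] using h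
  have right : contract (pderiv y Φ.series) (subst Φ ∘ₗ differential f)
      - contract (pderiv y Φ.series) (partialSum ∘ₗ differential f) ∈ orderGE H M n := by
    rw [← map_sub, ← LinearMap.sub_comp, ← zero_add n]
    exact contract_mem_orderGE (by simp) fun z => by
      simpa [partialSum] using subst_sub_sum_mem_orderGE Φ (pderiv z f) n
  simpa using sub_mem left right

theorem subst_mem_orderGE {n : ℕ} {f : FormalSeries K M} (hf : f ∈ orderGE K M n) :
    subst Φ f ∈ orderGE H M n := by
  induction n generalizing f with
  | zero => simp
  | succ n ih =>
    refine mem_orderGE_succ.2 ⟨by rw [constantCoeff_subst, (mem_orderGE_succ.1 hf).1],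
      fun d y _ => ?_⟩
    rw [pderiv_subst, ← zero_add n]
    exact contract_mem_orderGE (by simp) fun z => ih (pderiv_mem_orderGE hf z)

theorem eq_of_chain_rule {A B : FormalSeries K M →ₗ[ℝ] FormalSeries H M'}
    (h₀ : ∀ f, constantCoeff (A f) = constantCoeff (B f))
    (hA : ∀ f d, ∀ y ∈ H.gr d, pderiv y (A f) = contract (pderiv y Φ.series) (A ∘ₗ differential f))
    (hB : ∀ f d, ∀ y ∈ H.gr d,
      pderiv y (B f) = contract (pderiv y Φ.series) (B ∘ₗ differential f)) : A = B := by
  refine LinearMap.ext fun f => sub_eq_zero.1 (eq_zero_of_forall_mem_orderGE fun n => ?_)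
  induction n generalizing f with
  | zero => simp
  | succ n ih =>
    refine mem_orderGE_succ.2 ⟨by rw [map_sub, h₀, sub_self], fun d y hy => ?_⟩
    rw [map_sub, hA f d y hy, hB f d y hy, ← map_sub, ← LinearMap.sub_comp, ← zero_add n]
    exact contract_mem_orderGE (by simp) fun z => ih _

@[simp] theorem subst_const (m : M) : subst Φ (const m) = const m := by
  have differential_const : differential (const m : FormalSeries K M) = 0 :=
    LinearMap.ext fun y => pderiv_const y m
  exact formalSeries_ext_pderiv (by simp) fun d y _ => by simp [pderiv_subst, differential_const]

@[simp] theorem subst_linear (φ : K →ₗ[ℝ] M) : subst Φ (linear φ) = postcomp φ Φ.series := by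
  refine formalSeries_ext_pderiv (by simp [Φ.constantCoeff_series]) fun d y _ => ?_
  have differential_linear : subst Φ ∘ₗ differential (linear φ) = const ∘ₗ φ :=
    LinearMap.ext fun y => by simp
  rw [pderiv_subst, differential_linear, ← contract_postcomp, contract_const_right,
    pderiv_postcomp]

theorem subst_postcomp (φ : M →ₗ[ℝ] M') (f : FormalSeries K M) :
    subst Φ (postcomp φ f) = postcomp φ (subst Φ f) := by
  refine LinearMap.congr_fun (eq_of_chain_rule Φ (A := subst Φ ∘ₗ postcomp φ)
    (B := postcomp φ ∘ₗ subst Φ) (fun f => by simp) (fun f d y _ => pderiv_subst Φ _ y)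
    fun f d y _ => ?_) f
  rw [LinearMap.comp_apply, pderiv_postcomp, pderiv_subst, postcomp_contract]
  rfl

theorem subst_twist (δ : ZMod 2) (f : FormalSeries K M) :
    subst Φ (twist δ f) = twist δ (subst Φ f) := by
  suffices twist δ ∘ₗ subst Φ ∘ₗ twist δ = subst Φ by
    have h := LinearMap.congr_fun this (twist δ f)
    simpa [CharTwo.add_self_eq_zero] using h.symm
  refine eq_of_chain_rule Φ (fun f => by simp) (fun f d y hy => ?_)
    fun f d y _ => pderiv_subst Φ f y
  have differential_twist : (twist δ ∘ₗ subst Φ ∘ₗ differential (twist δ f)) ∘ₗ parityOp K δ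
      = (twist δ ∘ₗ subst Φ ∘ₗ twist δ) ∘ₗ differential f :=
    linearMap_ext_homogeneous fun c z hz => by
      simp [parityOp_of_mem _ hz, pderiv_twist _ _ hz, smul_smul]
  rw [LinearMap.comp_apply, pderiv_twist _ _ hy, LinearMap.comp_apply, pderiv_subst,
    twist_contract, twist_eq_smul_postcomp (Φ.pderiv_series_mem hy), map_smul,
    LinearMap.smul_apply, contract_postcomp, smul_smul, swapSign_mul_self, one_smul,
    differential_twist]

theorem subst_contract (f : FormalSeries K M) (G : M →ₗ[ℝ] FormalSeries K M') :
    subst Φ (contract f G) = contract (subst Φ f) (subst Φ ∘ₗ G) := by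
  refine sub_eq_zero.1 (eq_zero_of_forall_mem_orderGE fun n => ?_)
  induction n generalizing f G with
  | zero => simp
  | succ n ih =>
    refine mem_orderGE_succ.2 ⟨by simp [constantCoeff_contract], fun d y hy => ?_⟩
    let G' : M →ₗ[ℝ] K →ₗ[ℝ] FormalSeries H M' :=
      LinearMap.llcomp ℝ _ _ _ (subst Φ) ∘ₗ pderiv.flip ∘ₗ G
    have pderiv_comp : pderiv y ∘ₗ subst Φ ∘ₗ G = contract (pderiv y Φ.series) ∘ₗ G' :=
      LinearMap.ext fun m => pderiv_subst Φ (G m) y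
    rw [map_sub, pderiv_subst, pderiv_contract _ _ hy, pderiv_subst, contract_assoc, pderiv_comp,
      contract_swap _ (Φ.pderiv_series_mem hy), ← map_add, ← map_sub, ← zero_add n]
    refine contract_mem_orderGE (by simp) (map_mem_of_homogeneous fun q u hu => ?_)
    have first_summand := ih (pderiv u f) G
    have second_summand := ih (twist q.2 f) (pderiv u ∘ₗ G)
    have add_self : d.2 + d.2 = 0 := CharTwo.add_self_eq_zero _
    rw [LinearMap.sub_apply, LinearMap.add_apply, braid_of_mem _ _ _ hu, differential_contract,
      LinearMap.comp_apply, LinearMap.add_apply, braid_of_mem _ _ _ hu, twist_twist, add_zero,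
      add_assoc, add_self, add_zero, map_add, ← subst_twist, add_sub_add_comm]
    exact add_mem first_summand second_summand

theorem derivAlong_subst (q : FormalSeries H H) (f : FormalSeries K M) :
    derivAlong q (subst Φ f) = contract (derivAlong q Φ.series) (subst Φ ∘ₗ differential f) := by
  rw [derivAlong_apply, derivAlong_apply, contract_assoc]
  exact congrArg _ (LinearMap.ext fun y => pderiv_subst Φ f y)

theorem continuous_coeff_subst {X : Type*} [TopologicalSpace X] {f : X → FormalSeries K ℝ}
    (hf : ∀ n w, Continuous fun a => coeff n (f a) w) (n : ℕ) (x : Fin n → H) :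
    Continuous fun a => coeff n (subst Φ (f a)) x := by
  suffices ∀ k n x, Continuous fun a => coeff n (substTerm Φ k (f a)) x by
    simp only [coeff_subst, map_sum, sum_apply]
    exact continuous_finsetSum _ fun k _ => this k n x
  intro k
  induction k generalizing f with
  | zero =>
    rintro (_ | n) _
    · exact hf 0 _
    · exact continuous_const
  | succ k ih =>
    exact fun n x => continuous_const.mul (continuous_coeff_contract _
      (G := fun a => substTerm Φ k ∘ₗ differential (f a))
      (fun z => ih (f := fun a => pderiv z (f a)) fun n w => hf (n + 1) (Fin.cons z w)) n x)

end Substitution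

namespace TaylorMap

variable {L : GrSpace.{u}}

/-- The map of formal manifolds given by a linear map of degree zero. -/
def ofLinear (χ : H →ₗ[ℝ] K) (hχ : ∀ d, ∀ x ∈ H.gr d, χ x ∈ K.gr d) : TaylorMap H K :=
  ⟨linear χ, linear_mem_gradedSeries hχ, rfl⟩

/-- The composition `Φ ∘ Ψ` of maps of formal manifolds. -/
noncomputable def comp (Φ : TaylorMap K L) (Ψ : TaylorMap H K) : TaylorMap H L :=
  ⟨subst Ψ Φ.series, subst_mem_gradedSeries Ψ Φ.mem_gradedSeries, by
    rw [constantCoeff_subst, Φ.constantCoeff_series]⟩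

end TaylorMap

theorem subst_subst {L : GrSpace.{u}} (Φ : TaylorMap K L) (Ψ : TaylorMap H K)
    (f : FormalSeries L M) : subst Ψ (subst Φ f) = subst (Φ.comp Ψ) f := by
  refine LinearMap.congr_fun (eq_of_chain_rule (Φ.comp Ψ) (A := subst Ψ ∘ₗ subst Φ)
    (fun f => by simp) (fun f d y _ => ?_) fun f d y _ => pderiv_subst _ f y) f
  have chain_rule : subst Ψ ∘ₗ differential (subst Φ f)
      = contract.flip ((subst Ψ ∘ₗ subst Φ) ∘ₗ differential f) ∘ₗ
        subst Ψ ∘ₗ differential Φ.series :=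
    LinearMap.ext fun z => by
      simp only [LinearMap.comp_apply, LinearMap.flip_apply, pderiv_subst, subst_contract]
      rfl
  rw [LinearMap.comp_apply, pderiv_subst, chain_rule, ← contract_assoc, ← pderiv_subst]
  rfl

theorem pderiv_subst_ofLinear {χ : H →ₗ[ℝ] K} (hχ : ∀ d, ∀ x ∈ H.gr d, χ x ∈ K.gr d)
    (f : FormalSeries K M) (y : H) :
    pderiv y (subst (.ofLinear χ hχ) f) = subst (.ofLinear χ hχ) (pderiv (χ y) f) := by
  simp [pderiv_subst, TaylorMap.ofLinear, contract_const]

theorem coeff_subst_ofLinear {χ : H →ₗ[ℝ] K} (hχ : ∀ d, ∀ x ∈ H.gr d, χ x ∈ K.gr d)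
    (f : FormalSeries K M) (n : ℕ) (x : Fin n → H) :
    coeff n (subst (.ofLinear χ hχ) f) x = coeff n f fun i => χ (x i) := by
  induction n generalizing f with
  | zero => simp [coeff_zero_apply]
  | succ n ih =>
    rw [coeff_succ_apply, pderiv_subst_ofLinear, coeff_succ_apply f]
    exact ih _ _

theorem coeff_one_eq (f : FormalSeries H M) (x : Fin 1 → H) :
    coeff 1 f x = constantCoeff (pderiv (x 0) f) := by
  rw [coeff_succ_apply, coeff_zero_apply]

/-! ### Inverse function theorem -/

/-- The linear part `x ↦ f_1(x)` of a series. -/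
noncomputable def linearPart (f : FormalSeries H M) : H →ₗ[ℝ] M := constantCoeff ∘ₗ differential f

theorem linearPart_apply (f : FormalSeries H M) (x : H) :
    linearPart f x = constantCoeff (pderiv x f) := rfl

@[simp] theorem linearPart_linear (φ : H →ₗ[ℝ] M) : linearPart (linear φ) = φ :=
  LinearMap.ext fun x => by simp [linearPart_apply]

theorem linearPart_sub (f g : FormalSeries H M) :
    linearPart (f - g) = linearPart f - linearPart g :=
  LinearMap.ext fun x => by simp [linearPart_apply]

theorem linearPart_subst (Φ : TaylorMap H K) (f : FormalSeries K M) :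
    linearPart (subst Φ f) = linearPart f ∘ₗ linearPart Φ.series :=
  LinearMap.ext fun x => by
    simp [linearPart_apply, pderiv_subst, constantCoeff_contract]

theorem linearPart_mem {𝒟 : ℤ × ZMod 2 → Submodule ℝ M} {f : FormalSeries H M}
    (hf : f ∈ gradedSeries H 𝒟) {d : ℤ × ZMod 2} {x : H} (hx : x ∈ H.gr d) :
    linearPart f x ∈ 𝒟 d := by
  simpa [linearPart_apply] using constantCoeff_mem (pderiv_mem_gradedSeries hf hx)

theorem mem_orderGE_two {f : FormalSeries H M} :
    f ∈ orderGE H M 2 ↔ constantCoeff f = 0 ∧ linearPart f = 0 := by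
  simp only [mem_orderGE_succ (n := 1), mem_orderGE_one, ← linearPart_apply]
  exact and_congr_right fun _ =>
    ⟨fun h => linearMap_ext_homogeneous h, fun h d y _ => LinearMap.congr_fun h y⟩

theorem subst_sub_self_mem_orderGE {Φ : TaylorMap H H} (hΦ : linearPart Φ.series = .id) {n : ℕ}
    {f : FormalSeries H M} (hf : f ∈ orderGE H M n) : subst Φ f - f ∈ orderGE H M (n + 1) := by
  induction n generalizing f with
  | zero => simp [mem_orderGE_one]
  | succ n ih =>
    refine mem_orderGE_succ.2 ⟨by simp, fun d y _ => ?_⟩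
    have remainder_mem : pderiv y Φ.series - const y ∈ orderGE H H 1 := by
      simp [mem_orderGE_one, ← linearPart_apply, hΦ]
    have decomposition : pderiv y (subst Φ f - f)
        = contract (pderiv y Φ.series - const y) (subst Φ ∘ₗ differential f)
          + (subst Φ (pderiv y f) - pderiv y f) := by
      simp [pderiv_subst, contract_const]
    rw [decomposition]
    refine add_mem ?_ (ih (pderiv_mem_orderGE hf y))
    rw [add_comm]
    exact contract_mem_orderGE remainder_mem fun z =>
      subst_mem_orderGE Φ (pderiv_mem_orderGE hf z)

namespace TaylorMap

variable {L : GrSpace.{u}}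

/-- The identity map of a formal manifold. -/
def id (H : GrSpace.{u}) : TaylorMap H H := ofLinear .id fun _ _ hx => hx

theorem subst_id (f : FormalSeries H M) : subst (TaylorMap.id H) f = f :=
  formalSeries_ext fun n _ x _ => coeff_subst_ofLinear _ f n x

theorem id_comp (Φ : TaylorMap H K) : (TaylorMap.id K).comp Φ = Φ :=
  TaylorMap.ext (subst_linear Φ _)

theorem comp_id (Φ : TaylorMap H K) : Φ.comp (TaylorMap.id H) = Φ :=
  TaylorMap.ext (subst_id _)

theorem comp_assoc {L' : GrSpace.{u}} (Φ : TaylorMap L L') (Ψ : TaylorMap K L)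
    (Ω : TaylorMap H K) : (Φ.comp Ψ).comp Ω = Φ.comp (Ψ.comp Ω) :=
  TaylorMap.ext (subst_subst Ψ Ω Φ.series)

theorem exists_leftInverse (Φ : TaylorMap H K) (e : H ≃ₗ[ℝ] K) (hΦ : linearPart Φ.series = e) :
    ∃ Ψ : TaylorMap K H, Ψ.comp Φ = TaylorMap.id H ∧ linearPart Ψ.series = e.symm := by
  have he (d) (x) (hx : x ∈ H.gr d) : e x ∈ K.gr d := by
    rw [← LinearEquiv.coe_coe, ← hΦ]
    exact linearPart_mem Φ.mem_gradedSeries hx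
  let χ : TaylorMap K H := ofLinear e.symm fun d y hy => GrSpace.symm_apply_mem_gr he hy
  have linearPart_χ_comp : linearPart (χ.comp Φ).series = .id := by
    change linearPart (subst Φ (linear _)) = _
    rw [linearPart_subst, linearPart_linear, hΦ, e.symm_comp]
  obtain ⟨f, hf, subst_f⟩ := exists_apply_eq_of_approx (A := subst Φ) (g := linear .id)
    (fun n f => subst_mem_orderGE Φ) (isCoeffwise_gradedSeries H.gr)
    (F := fun k => orderGE H H k ⊓ gradedSeries H H.gr) (fun k => inf_le_left)
    (fun k r hr => ⟨subst χ r, subst_mem_gradedSeries χ hr.2, subst_mem_orderGE χ hr.1, by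
      rw [subst_subst, ← neg_sub]
      exact neg_mem ⟨subst_sub_self_mem_orderGE linearPart_χ_comp hr.1,
        sub_mem (subst_mem_gradedSeries _ hr.2) hr.2⟩⟩)
    ⟨by simp, linear_mem_gradedSeries fun d x hx => hx⟩
  refine ⟨⟨f, hf, by rw [← constantCoeff_subst Φ, subst_f, constantCoeff_linear]⟩,
    TaylorMap.ext subst_f, LinearMap.ext fun y => ?_⟩
  have h := congrArg linearPart subst_f
  rw [linearPart_subst, hΦ, linearPart_linear] at h
  simpa using LinearMap.congr_fun h (e.symm y)

theorem exists_inverse (Φ : TaylorMap H K) (hΦ : Function.Bijective (linearPart Φ.series)) :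
    ∃ Ψ : TaylorMap K H, Ψ.comp Φ = TaylorMap.id H ∧ Φ.comp Ψ = TaylorMap.id K := by
  obtain ⟨Ψ, leftInverse, linearPart_Ψ⟩ :=
    Φ.exists_leftInverse (LinearEquiv.ofBijective _ hΦ) (LinearMap.ext fun _ => rfl)
  obtain ⟨Ω, hΩ, -⟩ := Ψ.exists_leftInverse _ linearPart_Ψ
  have Ω_eq : Ω = Φ := by
    rw [← Ω.comp_id, ← leftInverse, ← comp_assoc, hΩ, id_comp]
  exact ⟨Ψ, leftInverse, Ω_eq ▸ hΩ⟩

end TaylorMap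

/-! ### Euler-like vector fields -/

section EulerLike

variable {P : H →ₗ[ℝ] H} (hP : ∀ d, ∀ x ∈ H.gr d, P x ∈ H.gr d)

/-- The vector field `θ` of degree zero vanishes on the submanifold `M_(Im P)` of `M_H`, and its
component along `1 - P` is the Euler vector field. -/
structure IsEulerLike (θ : FormalSeries H H) : Prop where
  mem_gradedSeries : θ ∈ gradedSeries H (H.shiftedGr 0)
  subst_eq_zero : subst (.ofLinear P hP) θ = 0
  postcomp_eq : postcomp (LinearMap.id - P) θ = linear (LinearMap.id - P)

/-- The series that vanish to order at least `k` along the submanifold `M_(Im P)` of `M_H`. -/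
noncomputable def normalOrderGE (M : Type*) [AddCommGroup M] [Module ℝ M] :
    ℕ → Submodule ℝ (FormalSeries H M)
  | 0 => ⊤
  | k + 1 => LinearMap.ker (subst (.ofLinear P hP)) ⊓
      ⨅ (d : ℤ × ZMod 2), ⨅ y ∈ H.gr d, (normalOrderGE M k).comap (pderiv y)

theorem mem_normalOrderGE_succ {k : ℕ} {f : FormalSeries H M} :
    f ∈ normalOrderGE hP M (k + 1) ↔ subst (.ofLinear P hP) f = 0 ∧
      ∀ d, ∀ y ∈ H.gr d, pderiv y f ∈ normalOrderGE hP M k := by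
  simp [normalOrderGE]

theorem mem_normalOrderGE_one {f : FormalSeries H M} :
    f ∈ normalOrderGE hP M 1 ↔ subst (.ofLinear P hP) f = 0 := by
  simp [normalOrderGE]

theorem normalOrderGE_succ_le (k : ℕ) :
    normalOrderGE hP M (k + 1) ≤ normalOrderGE hP M k := by
  induction k with
  | zero => exact le_top
  | succ k ih =>
    intro f hf
    rw [mem_normalOrderGE_succ] at hf ⊢
    exact ⟨hf.1, fun d y hy => ih (hf.2 d y hy)⟩

theorem normalOrderGE_le_orderGE (k : ℕ) : normalOrderGE hP M k ≤ orderGE H M k := by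
  induction k with
  | zero => simp
  | succ k ih =>
    intro f hf
    rw [mem_normalOrderGE_succ] at hf
    refine mem_orderGE_succ.2 ⟨?_, fun d y hy => ih (hf.2 d y hy)⟩
    rw [← constantCoeff_subst (.ofLinear P hP), hf.1, map_zero]

theorem contract_mem_normalOrderGE (f : FormalSeries H M) {k : ℕ}
    {G : M →ₗ[ℝ] FormalSeries H M'} (hG : ∀ m, G m ∈ normalOrderGE hP M' k) :
    contract f G ∈ normalOrderGE hP M' k := by
  induction k generalizing f G with
  | zero => trivial
  | succ k ih =>
    have hG' := fun m => (mem_normalOrderGE_succ hP).1 (hG m)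
    refine (mem_normalOrderGE_succ hP).2 ⟨?_, fun d y hy => ?_⟩
    · have subst_comp : subst (.ofLinear P hP) ∘ₗ G = 0 := LinearMap.ext fun m => (hG' m).1
      rw [subst_contract, subst_comp, map_zero]
    · rw [pderiv_contract _ _ hy]
      exact add_mem (ih _ fun m => normalOrderGE_succ_le hP k (hG m))
        (ih _ fun m => (hG' m).2 d y hy)

theorem subst_pderiv_map {f : FormalSeries H M} (hf : subst (.ofLinear P hP) f = 0) (z : H) :
    subst (.ofLinear P hP) (pderiv (P z) f) = 0 := by
  rw [← pderiv_subst_ofLinear, hf, map_zero]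

theorem pderiv_map_mem_normalOrderGE {k : ℕ} {f : FormalSeries H M}
    (hf : f ∈ normalOrderGE hP M k) (z : H) : pderiv (P z) f ∈ normalOrderGE hP M k := by
  refine map_mem_of_homogeneous (f := differential f ∘ₗ P) (fun d z hz => ?_) z
  induction k generalizing f with
  | zero => trivial
  | succ k ih =>
    rw [mem_normalOrderGE_succ] at hf ⊢
    refine ⟨subst_pderiv_map hP hf.1 z, fun c y hy => ?_⟩
    rw [LinearMap.comp_apply, LinearMap.flip_apply, pderiv_pderiv hy (hP d z hz)]
    exact Submodule.smul_mem _ _ (ih (hf.2 c y hy))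

variable {hP} {θ : FormalSeries H H} (hθ : IsEulerLike hP θ)
include hθ

theorem IsEulerLike.mem_orderGE_one : θ ∈ orderGE H H 1 := by
  rw [QMan.mem_orderGE_one, ← constantCoeff_subst (.ofLinear P hP), hθ.subst_eq_zero, map_zero]

theorem IsEulerLike.derivAlong_mem_orderGE {n : ℕ} {f : FormalSeries H M}
    (hf : f ∈ orderGE H M n) : derivAlong θ f ∈ orderGE H M n := by
  cases n with
  | zero => simp
  | succ n => exact add_comm 1 n ▸ QMan.derivAlong_mem_orderGE hθ.mem_orderGE_one hf

theorem IsEulerLike.subst_derivAlong (f : FormalSeries H M) :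
    subst (.ofLinear P hP) (derivAlong θ f) = 0 := by
  rw [derivAlong_apply, subst_contract, hθ.subst_eq_zero, map_zero, LinearMap.zero_apply]

theorem IsEulerLike.derivAlong_pderiv (f : FormalSeries H M) (y : H) :
    derivAlong (pderiv y θ) f = pderiv y f - pderiv (P y) f
      + contract (pderiv y θ) (differential f ∘ₗ P) := by
  have normal_part : contract (pderiv y θ) (differential f ∘ₗ (LinearMap.id - P))
      = pderiv y f - pderiv (P y) f := by
    rw [← contract_postcomp, ← pderiv_postcomp, hθ.postcomp_eq, pderiv_linear, contract_const]
    simp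
  rw [← normal_part, ← map_add, ← LinearMap.comp_add, sub_add_cancel, LinearMap.comp_id,
    derivAlong_apply]

theorem IsEulerLike.derivAlong_sub_smul_mem {k : ℕ} {f : FormalSeries H M}
    (hf : f ∈ normalOrderGE hP M k) :
    derivAlong θ f - (k : ℝ) • f ∈ normalOrderGE hP M (k + 1) := by
  induction k generalizing f with
  | zero => simpa [mem_normalOrderGE_one] using hθ.subst_derivAlong f
  | succ k ih =>
    obtain ⟨subst_f, pderiv_f⟩ := (mem_normalOrderGE_succ hP).1 hf
    refine (mem_normalOrderGE_succ hP).2 ⟨by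
      rw [map_sub, map_smul, hθ.subst_derivAlong, subst_f, smul_zero, sub_zero], fun d y hy => ?_⟩
    have decomposition : pderiv y (derivAlong θ f - ((k + 1 : ℕ) : ℝ) • f)
        = contract (pderiv y θ) (differential f ∘ₗ P) - pderiv (P y) f
          + (derivAlong θ (pderiv y f) - (k : ℝ) • pderiv y f) := by
      rw [map_sub, map_smul, pderiv_derivAlong hθ.mem_gradedSeries f hy, hθ.derivAlong_pderiv,
        Prod.snd_zero, swapSign_zero_right]
      push_cast
      module
    rw [decomposition]
    exact add_mem (sub_mem (contract_mem_normalOrderGE hP _ (pderiv_map_mem_normalOrderGE hP hf))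
      (pderiv_map_mem_normalOrderGE hP hf y)) (ih (pderiv_f d y hy))

theorem IsEulerLike.eq_zero {f : FormalSeries H M} (hf : subst (.ofLinear P hP) f = 0)
    (hθf : derivAlong θ f = 0) : f = 0 := by
  refine eq_zero_of_forall_mem_orderGE fun n =>
    orderGE_antitone n.le_succ (normalOrderGE_le_orderGE hP (n + 1) ?_)
  induction n with
  | zero => exact (mem_normalOrderGE_one hP).2 hf
  | succ n ih =>
    have h := hθ.derivAlong_sub_smul_mem ih
    rw [hθf, zero_sub, neg_mem_iff] at h
    exact (Submodule.smul_mem_iff _ (by positivity)).1 h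

theorem IsEulerLike.exists_derivAlong_eq {S : Submodule ℝ (FormalSeries H M)}
    (hS : IsCoeffwise S) (hθS : ∀ f ∈ S, derivAlong θ f ∈ S) {f : FormalSeries H M} (hf : f ∈ S)
    (hf₀ : subst (.ofLinear P hP) f = 0) :
    ∃ g ∈ S, subst (.ofLinear P hP) g = 0 ∧ derivAlong θ g = f := by
  have isCoeffwise_ker : IsCoeffwise (LinearMap.ker (subst (M := M) (.ofLinear P hP))) :=
    fun f h => formalSeries_ext fun n d x _ => by
      obtain ⟨s, hs, h⟩ := h n
      rw [coeff_subst_ofLinear, h, ← coeff_subst_ofLinear hP, hs]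
  have approximation (k : ℕ) : ∀ r ∈ normalOrderGE hP M (k + 1) ⊓ S,
      ∃ s ∈ LinearMap.ker (subst (.ofLinear P hP)) ⊓ S, s ∈ orderGE H M k ∧
        r - derivAlong θ s ∈ normalOrderGE hP M (k + 1 + 1) ⊓ S := by
    intro r hr
    let s := ((k + 1 : ℕ) : ℝ)⁻¹ • r
    have hs : s ∈ normalOrderGE hP M (k + 1) ⊓ S := Submodule.smul_mem _ _ hr
    have remainder_eq : r - derivAlong θ s
        = -(((k + 1 : ℕ) : ℝ)⁻¹ • (derivAlong θ r - ((k + 1 : ℕ) : ℝ) • r)) := by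
      rw [map_smul, smul_sub, inv_smul_smul₀ (by positivity), neg_sub]
    refine ⟨s, ⟨((mem_normalOrderGE_succ hP).1 hs.1).1, hs.2⟩,
      orderGE_antitone k.le_succ (normalOrderGE_le_orderGE hP _ hs.1), ?_,
      sub_mem hr.2 (hθS _ hs.2)⟩
    rw [remainder_eq]
    exact neg_mem (Submodule.smul_mem _ _ (hθ.derivAlong_sub_smul_mem hr.1))
  obtain ⟨g, hg, θ_g⟩ := exists_apply_eq_of_approx (A := derivAlong θ) (g := f)
    (fun n f => hθ.derivAlong_mem_orderGE) (isCoeffwise_ker.inf hS)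
    (F := fun k => normalOrderGE hP M (k + 1) ⊓ S)
    (fun k r hr => orderGE_antitone k.le_succ (normalOrderGE_le_orderGE hP _ hr.1))
    approximation ⟨(mem_normalOrderGE_one hP).2 hf₀, hf⟩
  exact ⟨g, hg.2, hg.1, θ_g⟩

end EulerLike

/-! ### Related vector fields -/

theorem linearPart_derivAlong {e : ℤ × ZMod 2} {v : FormalSeries H H}
    (hv : v ∈ gradedSeries H (H.shiftedGr e)) (hv₀ : constantCoeff v = 0) (f : FormalSeries H M) :
    linearPart (derivAlong v f) = linearPart f ∘ₗ linearPart v :=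
  linearMap_ext_homogeneous fun d y hy => by
    rw [linearPart_apply, pderiv_derivAlong hv f hy, map_add, map_smul, derivAlong_apply,
      derivAlong_apply, constantCoeff_contract, constantCoeff_contract, hv₀]
    simp [linearPart_apply]

namespace TaylorMap

variable {L W : GrSpace.{u}}

/-- The vector fields `q` on `M_H` and `q'` on `M_K` are `Φ`-related: the derivative of `Φ`
carries `q` to `q'`. -/
def IsRelated (Φ : TaylorMap H K) (q : FormalSeries H H) (q' : FormalSeries K K) : Prop :=
  derivAlong q Φ.series = subst Φ q'

theorem IsRelated.linearPart_comp {e : ℤ × ZMod 2} {Φ : TaylorMap H K} {q : FormalSeries H H}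
    {q' : FormalSeries K K} (h : Φ.IsRelated q q') (hq : q ∈ gradedSeries H (H.shiftedGr e))
    (hq₀ : constantCoeff q = 0) :
    linearPart Φ.series ∘ₗ linearPart q = linearPart q' ∘ₗ linearPart Φ.series := by
  rw [← linearPart_derivAlong hq hq₀, h, linearPart_subst]

theorem IsRelated.derivAlong_subst {Φ : TaylorMap H K} {q : FormalSeries H H}
    {q' : FormalSeries K K} (h : Φ.IsRelated q q') (f : FormalSeries K M) :
    derivAlong q (subst Φ f) = subst Φ (derivAlong q' f) := by
  rw [QMan.derivAlong_subst, h, derivAlong_apply, subst_contract]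

theorem IsRelated.comp {Φ : TaylorMap K L} {Ψ : TaylorMap H K} {q : FormalSeries H H}
    {q' : FormalSeries K K} {q'' : FormalSeries L L} (hΦ : Φ.IsRelated q' q'')
    (hΨ : Ψ.IsRelated q q') : (Φ.comp Ψ).IsRelated q q'' := by
  change derivAlong q (subst Ψ Φ.series) = _
  rw [hΨ.derivAlong_subst, hΦ, subst_subst]

theorem subst_subst_of_comp_eq_id {Φ : TaylorMap H K} {Ψ : TaylorMap K H}
    (h : Ψ.comp Φ = TaylorMap.id H) (f : FormalSeries H M) : subst Φ (subst Ψ f) = f := by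
  rw [subst_subst, h, subst_id]

theorem IsRelated.symm {Φ : TaylorMap H K} {Ψ : TaylorMap K H} (h : Ψ.comp Φ = TaylorMap.id H)
    (h' : Φ.comp Ψ = TaylorMap.id K) {q : FormalSeries H H} {q' : FormalSeries K K}
    (hΦ : Φ.IsRelated q q') : Ψ.IsRelated q' q := by
  refine (subst_subst_of_comp_eq_id h' (derivAlong q' Ψ.series)).symm.trans (congrArg _ ?_)
  rw [← hΦ.derivAlong_subst]
  change derivAlong q (Ψ.comp Φ).series = q
  rw [h]
  exact derivAlong_linear q .id

theorem ofLinear_comp (φ : K →ₗ[ℝ] L) (hφ : ∀ d, ∀ x ∈ K.gr d, φ x ∈ L.gr d) (Φ : TaylorMap H K) :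
    ((ofLinear φ hφ).comp Φ).series = postcomp φ Φ.series :=
  subst_linear Φ φ

/-- The inclusion `M_K → M_K × M_W`. -/
def inl (K W : GrSpace.{u}) : TaylorMap K (K.prod W) :=
  ofLinear (LinearMap.inl ℝ K W) fun _ _ => GrSpace.inl_mem_gr

/-- The projection `M_K × M_W → M_K`. -/
def fst (K W : GrSpace.{u}) : TaylorMap (K.prod W) K :=
  ofLinear (LinearMap.fst ℝ K W) fun _ _ => GrSpace.fst_mem_gr

/-- The projection `M_K × M_W → M_W`. -/
def snd (K W : GrSpace.{u}) : TaylorMap (K.prod W) W :=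
  ofLinear (LinearMap.snd ℝ K W) fun _ _ => GrSpace.snd_mem_gr

theorem fst_comp_inl : (fst K W).comp (inl K W) = TaylorMap.id K :=
  TaylorMap.ext ((ofLinear_comp _ _ _).trans (postcomp_linear _ _))

/-- The map `(Φ, Ψ) : M_H → M_K × M_W`. -/
noncomputable def prodMk (Φ : TaylorMap H K) (Ψ : TaylorMap H W) : TaylorMap H (K.prod W) where
  series := postcomp (LinearMap.inl ℝ K W) Φ.series + postcomp (LinearMap.inr ℝ K W) Ψ.series
  mem_gradedSeries := add_mem
    (postcomp_mem_gradedSeries (fun _ _ => GrSpace.inl_mem_gr) Φ.mem_gradedSeries)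
    (postcomp_mem_gradedSeries (fun _ _ => GrSpace.inr_mem_gr) Ψ.mem_gradedSeries)
  constantCoeff_series := by simp [Φ.constantCoeff_series, Ψ.constantCoeff_series]

theorem linearPart_prodMk (Φ : TaylorMap H K) (Ψ : TaylorMap H W) :
    linearPart (Φ.prodMk Ψ).series = (linearPart Φ.series).prod (linearPart Ψ.series) :=
  LinearMap.ext fun x => by simp [prodMk, linearPart_apply]

theorem fst_comp_prodMk (Φ : TaylorMap H K) (Ψ : TaylorMap H W) :
    (fst K W).comp (Φ.prodMk Ψ) = Φ :=
  TaylorMap.ext ((ofLinear_comp _ _ _).trans (by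
    simp [prodMk, LinearMap.fst_comp_inl, LinearMap.fst_comp_inr]))

theorem snd_comp_prodMk (Φ : TaylorMap H K) (Ψ : TaylorMap H W) :
    (snd K W).comp (Φ.prodMk Ψ) = Ψ :=
  TaylorMap.ext ((ofLinear_comp _ _ _).trans (by
    simp [prodMk, LinearMap.snd_comp_inl, LinearMap.snd_comp_inr]))

end TaylorMap

/-- The vector field `(q, q')` on the product `M_K × M_W`. -/
noncomputable def prodField {W : GrSpace.{u}} (q : FormalSeries K K) (q' : FormalSeries W W) :
    FormalSeries (K.prod W) (K.prod W) :=
  postcomp (LinearMap.inl ℝ K W) (subst (.fst K W) q)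
    + postcomp (LinearMap.inr ℝ K W) (subst (.snd K W) q')

theorem TaylorMap.IsRelated.prodMk {W : GrSpace.{u}} {Φ : TaylorMap H K} {Ψ : TaylorMap H W}
    {q : FormalSeries H H} {qK : FormalSeries K K} {qW : FormalSeries W W}
    (hΦ : Φ.IsRelated q qK) (hΨ : Ψ.IsRelated q qW) :
    (Φ.prodMk Ψ).IsRelated q (prodField qK qW) := by
  rw [IsRelated, prodField, map_add, subst_postcomp, subst_postcomp, subst_subst, subst_subst,
    fst_comp_prodMk, snd_comp_prodMk, ← hΦ, ← hΨ, ← derivAlong_postcomp, ← derivAlong_postcomp,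
    ← map_add]
  rfl

theorem TaylorMap.isRelated_fst {W : GrSpace.{u}} (q : FormalSeries K K) (qW : FormalSeries W W) :
    (TaylorMap.fst K W).IsRelated (prodField q qW) q := by
  refine (derivAlong_linear _ _).trans ?_
  simp [prodField, LinearMap.fst_comp_inl, LinearMap.fst_comp_inr]

theorem TaylorMap.isRelated_inl {W : GrSpace.{u}} (q : FormalSeries K K) {qW : FormalSeries W W}
    (hqW : constantCoeff qW = 0) : (TaylorMap.inl K W).IsRelated q (prodField q qW) := by
  refine (derivAlong_linear _ _).trans ?_
  have subst_snd : subst (.inl K W) (subst (.snd K W) qW) = 0 := by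
    refine formalSeries_ext fun n d x _ => ?_
    rw [TaylorMap.inl, TaylorMap.snd, coeff_subst_ofLinear, coeff_subst_ofLinear]
    cases n with
    | zero => exact (coeff_zero_apply _ _).trans hqW
    | succ n => exact MultilinearMap.map_coord_zero _ 0 rfl
  rw [prodField, map_add, subst_postcomp, subst_postcomp, subst_subst, fst_comp_inl, subst_id,
    subst_snd, map_zero, add_zero]

/-! ### Homological vector fields -/

/-- The series `q` is a vector field on `M_H` of degree `1` and odd parity that vanishes at the base
point and satisfies `[q, q] = 0`. -/
structure IsHomological (q : FormalSeries H H) : Prop where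
  mem_gradedSeries : q ∈ gradedSeries H (H.shiftedGr (1, 1))
  constantCoeff_eq : constantCoeff q = 0
  derivAlong_self : derivAlong q q = 0

namespace IsHomological

variable {q : FormalSeries H H} (hq : IsHomological q)
include hq

theorem derivAlong_derivAlong (f : FormalSeries H M) : derivAlong q (derivAlong q f) = 0 := by
  have antisymm := secondDeriv_comm hq.mem_gradedSeries hq.mem_gradedSeries f
  rw [swapSign_one_one] at antisymm
  rw [QMan.derivAlong_derivAlong, hq.derivAlong_self, map_zero, LinearMap.zero_apply, zero_add]
  linear_combination (norm := module) (1 / 2 : ℝ) • antisymm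

theorem derivAlong_mem_shiftedGr {Φ : TaylorMap H K} :
    derivAlong q Φ.series ∈ gradedSeries H (K.shiftedGr (1, 1)) :=
  QMan.derivAlong_mem_gradedSeries hq.mem_gradedSeries Φ.mem_gradedSeries

theorem constantCoeff_derivAlong (f : FormalSeries H M) : constantCoeff (derivAlong q f) = 0 := by
  rw [derivAlong_apply, constantCoeff_contract, hq.constantCoeff_eq, map_zero, map_zero]

theorem of_isRelated {Φ : TaylorMap H K} {Ψ : TaylorMap K H} (h : Φ.comp Ψ = TaylorMap.id K)
    {q' : FormalSeries K K} (hΦ : Φ.IsRelated q q') : IsHomological q' := by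
  have q'_eq : q' = subst Ψ (derivAlong q Φ.series) := by
    rw [hΦ, TaylorMap.subst_subst_of_comp_eq_id h]
  refine ⟨?_, ?_, ?_⟩
  · exact q'_eq ▸ subst_mem_gradedSeries Ψ hq.derivAlong_mem_shiftedGr
  · rw [q'_eq, constantCoeff_subst, hq.constantCoeff_derivAlong]
  · rw [← TaylorMap.subst_subst_of_comp_eq_id h (derivAlong q' q'), ← hΦ.derivAlong_subst, ← hΦ,
      hq.derivAlong_derivAlong, map_zero]

theorem exists_isRelated {Φ : TaylorMap H K} {Ψ : TaylorMap K H}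
    (h : Ψ.comp Φ = TaylorMap.id H) (h' : Φ.comp Ψ = TaylorMap.id K) :
    ∃ q', IsHomological q' ∧ Φ.IsRelated q q' := by
  have hΦ : Φ.IsRelated q (subst Ψ (derivAlong q Φ.series)) :=
    (TaylorMap.subst_subst_of_comp_eq_id h _).symm
  exact ⟨_, hq.of_isRelated h' hΦ, hΦ⟩

end IsHomological

/-! ### Trivialization of homological vector fields -/

/-- The vector field `[q, η] = q η + η q`, where `η` stands for the linear vector field with
components `η`. -/
noncomputable def homotopyField (q : FormalSeries H H) (η : H →ₗ[ℝ] H) : FormalSeries H H :=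
  derivAlong q (linear η) + derivAlong (linear η) q

section HomotopyField

variable {q : FormalSeries H H} (hq : IsHomological q) {η : H →ₗ[ℝ] H}
  (hη : ∀ d, ∀ x ∈ H.gr d, η x ∈ H.shiftedGr (-1, 1) d)
include hq hη

theorem homotopyField_mem : homotopyField q η ∈ gradedSeries H (H.shiftedGr 0) := by
  have hη' := linear_mem_gradedSeries hη
  have degree_add : ((1, 1) : ℤ × ZMod 2) + (-1, 1) = 0 := by decide
  have degree_add' : ((-1, 1) : ℤ × ZMod 2) + (1, 1) = 0 := by decide
  refine add_mem ?_ ?_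
  · exact degree_add ▸ derivAlong_mem_shiftedGr hq.mem_gradedSeries hη'
  · exact degree_add' ▸ derivAlong_mem_shiftedGr hη' hq.mem_gradedSeries

theorem derivAlong_homotopyField (f : FormalSeries H M) :
    derivAlong (homotopyField q η) f
      = derivAlong q (derivAlong (linear η) f) + derivAlong (linear η) (derivAlong q f) := by
  have commutator := derivAlong_comm hq.mem_gradedSeries (linear_mem_gradedSeries hη) f
  rw [swapSign_one_one, map_sub, map_smul, LinearMap.sub_apply, LinearMap.smul_apply]
    at commutator
  rw [homotopyField, map_add, LinearMap.add_apply]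
  linear_combination (norm := module) -commutator

theorem derivAlong_homotopyField_comm (f : FormalSeries H M) :
    derivAlong (homotopyField q η) (derivAlong q f)
      = derivAlong q (derivAlong (homotopyField q η) f) := by
  rw [derivAlong_homotopyField hq hη, derivAlong_homotopyField hq hη, map_add,
    hq.derivAlong_derivAlong, hq.derivAlong_derivAlong, map_zero, add_zero, zero_add]

end HomotopyField

/-- The underlying graded space of the product `M_K × T[1]V`. -/
abbrev bundleSpace (K V : GrSpace.{u}) : GrSpace.{u} := K.prod (V.prod V.shift)

/-- The differential `(v, v') ↦ (v', 0)` of the complex `V ⊕ V[1]`. -/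
def tangentDifferential (V : GrSpace.{u}) : V.prod V.shift →ₗ[ℝ] V.prod V.shift :=
  LinearMap.inl ℝ V V ∘ₗ LinearMap.snd ℝ V V

/-- The contracting homotopy `(k, v, v') ↦ (0, 0, v)` of the fibres of `M_K × T[1]V`. -/
def fibreHomotopy (K V : GrSpace.{u}) : bundleSpace K V →ₗ[ℝ] bundleSpace K V :=
  LinearMap.inr ℝ K (V × V) ∘ₗ LinearMap.inr ℝ V V ∘ₗ LinearMap.fst ℝ V V ∘ₗ
    LinearMap.snd ℝ K (V × V)

/-- The projection `(k, v, v') ↦ (k, 0, 0)` onto the zero section of `M_K × T[1]V`. -/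
def zeroSectionProj (K V : GrSpace.{u}) : bundleSpace K V →ₗ[ℝ] bundleSpace K V :=
  LinearMap.inl ℝ K (V × V) ∘ₗ LinearMap.fst ℝ K (V × V)

section Adapted

variable {K V : GrSpace.{u}}

theorem fibreHomotopy_mem (d : ℤ × ZMod 2) (x : bundleSpace K V) (hx : x ∈ (bundleSpace K V).gr d) :
    fibreHomotopy K V x ∈ (bundleSpace K V).shiftedGr (-1, 1) d := by
  have degree_add : d + (-1, 1) + (1, 1) = d := by
    rw [add_assoc, show ((-1, 1) : ℤ × ZMod 2) + (1, 1) = 0 by decide, add_zero]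
  refine GrSpace.inr_mem_gr (GrSpace.inr_mem_gr ?_)
  change x.2.1 ∈ V.gr (d + (-1, 1) + (1, 1))
  exact degree_add.symm ▸ hx.2.1

theorem zeroSectionProj_mem (d : ℤ × ZMod 2) (x : bundleSpace K V)
    (hx : x ∈ (bundleSpace K V).gr d) : zeroSectionProj K V x ∈ (bundleSpace K V).gr d :=
  GrSpace.inl_mem_gr (GrSpace.fst_mem_gr hx)

theorem TaylorMap.inl_comp_fst : (TaylorMap.inl K (V.prod V.shift)).comp (.fst K (V.prod V.shift))
    = .ofLinear (zeroSectionProj K V) zeroSectionProj_mem :=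
  TaylorMap.ext ((TaylorMap.ofLinear_comp _ _ _).trans (postcomp_linear _ _))

/-- A homological vector field on `M_K × T[1]V` whose component along `T[1]V` is `d_V` and whose
component along `M_K` has no linear part. -/
structure IsAdapted (q : FormalSeries (bundleSpace K V) (bundleSpace K V)) : Prop
    extends IsHomological q where
  isRelated_snd : (TaylorMap.snd K (V.prod V.shift)).IsRelated q (linear (tangentDifferential V))
  fst_comp_linearPart : LinearMap.fst ℝ K (V × V) ∘ₗ linearPart q = 0

namespace IsAdapted

variable {q : FormalSeries (bundleSpace K V) (bundleSpace K V)} (hq : IsAdapted q)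
include hq

theorem postcomp_snd : postcomp (LinearMap.snd ℝ K (V × V)) q
    = linear (tangentDifferential V ∘ₗ LinearMap.snd ℝ K (V × V)) := by
  refine (derivAlong_linear _ _).symm.trans (hq.isRelated_snd.trans ?_)
  rw [subst_linear]
  exact postcomp_linear _ _

theorem postcomp_fst_mem :
    postcomp (LinearMap.fst ℝ K (V × V)) q ∈ orderGE (bundleSpace K V) K 2 :=
  mem_orderGE_two.2
    ⟨by rw [constantCoeff_postcomp, hq.constantCoeff_eq, map_zero], hq.fst_comp_linearPart⟩

theorem isEulerLike :
    IsEulerLike (zeroSectionProj_mem (K := K) (V := V)) (homotopyField q (fibreHomotopy K V)) where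
  mem_gradedSeries := homotopyField_mem hq.toIsHomological fibreHomotopy_mem
  subst_eq_zero := by
    have subst_snd : postcomp (LinearMap.snd ℝ K (V × V))
        (subst (.ofLinear _ zeroSectionProj_mem) q) = 0 := by
      rw [← subst_postcomp, hq.postcomp_snd, subst_linear]
      exact (postcomp_linear _ _).trans (map_zero linear)
    have along_homotopy : subst (.ofLinear _ zeroSectionProj_mem) (linear (fibreHomotopy K V))
        = 0 := by
      rw [subst_linear]
      exact (postcomp_linear _ _).trans (map_zero linear)
    rw [homotopyField, map_add, derivAlong_linear, subst_postcomp, derivAlong_apply,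
      subst_contract, along_homotopy, map_zero, LinearMap.zero_apply, add_zero, fibreHomotopy,
      ← postcomp_postcomp, ← postcomp_postcomp, ← postcomp_postcomp, subst_snd, map_zero, map_zero,
      map_zero]
  postcomp_eq := by
    have complement : LinearMap.id - zeroSectionProj K V
        = LinearMap.inr ℝ K (V × V) ∘ₗ LinearMap.snd ℝ K (V × V) :=
      LinearMap.ext fun x => by simp [zeroSectionProj, Prod.ext_iff]
    have homotopy_identity : LinearMap.inr ℝ V V ∘ₗ LinearMap.fst ℝ V V ∘ₗ
        tangentDifferential V ∘ₗ LinearMap.snd ℝ K (V × V)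
          + (tangentDifferential V ∘ₗ LinearMap.snd ℝ K (V × V)) ∘ₗ fibreHomotopy K V
        = LinearMap.snd ℝ K (V × V) :=
      LinearMap.ext fun x => by simp [tangentDifferential, fibreHomotopy]
    have snd_component : postcomp (LinearMap.snd ℝ K (V × V))
        (homotopyField q (fibreHomotopy K V)) = linear (LinearMap.snd ℝ K (V × V)) := by
      rw [homotopyField, map_add, derivAlong_linear, ← derivAlong_postcomp, hq.postcomp_snd,
        derivAlong_linear, postcomp_linear]
      change postcomp (LinearMap.inr ℝ V V ∘ₗ LinearMap.fst ℝ V V)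
        (postcomp (LinearMap.snd ℝ K (V × V)) q) + _ = _
      rw [hq.postcomp_snd, postcomp_linear, ← map_add]
      exact congrArg linear homotopy_identity
    rw [complement, ← postcomp_postcomp, snd_component, postcomp_linear]

end IsAdapted

end Adapted

namespace IsAdapted

variable {K V : GrSpace.{u}} {q : FormalSeries (bundleSpace K V) (bundleSpace K V)}
  (hq : IsAdapted q)
include hq

theorem exists_invariant_retraction :
    ∃ ρ : TaylorMap (bundleSpace K V) K,
      derivAlong (homotopyField q (fibreHomotopy K V)) ρ.series = 0 ∧
      ρ.comp (.ofLinear _ zeroSectionProj_mem) = .fst K (V.prod V.shift) ∧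
      linearPart ρ.series = LinearMap.fst ℝ K (V × V) := by
  have hθ := hq.isEulerLike
  set θ := homotopyField q (fibreHomotopy K V)
  have linear_fst_mem : linear (LinearMap.fst ℝ K (V × V)) ∈ gradedSeries (bundleSpace K V) K.gr :=
    linear_mem_gradedSeries fun _ _ => GrSpace.fst_mem_gr
  have graded_mem (f) (hf : f ∈ gradedSeries (bundleSpace K V) K.gr) :
      derivAlong θ f ∈ gradedSeries (bundleSpace K V) K.gr := by
    simpa using derivAlong_mem_gradedSeries hθ.mem_gradedSeries hf
  have θ_fst_mem : derivAlong θ (linear (LinearMap.fst ℝ K (V × V)))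
      ∈ orderGE (bundleSpace K V) K 2 := by
    have along_homotopy : derivAlong θ (linear (LinearMap.fst ℝ K (V × V)))
        = derivAlong (linear (fibreHomotopy K V)) (postcomp (LinearMap.fst ℝ K (V × V)) q) := by
      rw [derivAlong_homotopyField hq.toIsHomological fibreHomotopy_mem, derivAlong_linear q,
        derivAlong_linear, postcomp_linear]
      exact (congrArg (· + _) (congrArg (derivAlong q) (map_zero linear))).trans
        ((congrArg (· + _) (map_zero _)).trans (zero_add _))
    rw [along_homotopy]
    exact derivAlong_mem_orderGE (mem_orderGE_one.2 (constantCoeff_linear _)) hq.postcomp_fst_mem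
  obtain ⟨c, ⟨c_graded, c_order⟩, subst_c, θ_c⟩ := hθ.exists_derivAlong_eq
    ((isCoeffwise_gradedSeries K.gr).inf (isCoeffwise_orderGE 2))
    (fun f hf => ⟨graded_mem f hf.1, hθ.derivAlong_mem_orderGE hf.2⟩)
    ⟨graded_mem _ linear_fst_mem, θ_fst_mem⟩ (hθ.subst_derivAlong _)
  obtain ⟨c_zero, c_linear⟩ := mem_orderGE_two.1 c_order
  refine ⟨⟨linear (LinearMap.fst ℝ K (V × V)) - c, sub_mem linear_fst_mem c_graded, ?_⟩, ?_, ?_, ?_⟩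
  · rw [map_sub, constantCoeff_linear, c_zero, sub_zero]
  · rw [map_sub, θ_c, sub_self]
  · refine TaylorMap.ext ((map_sub _ _ _).trans ?_)
    rw [subst_c, sub_zero, subst_linear]
    exact postcomp_linear _ _
  · rw [linearPart_sub, linearPart_linear, c_linear, sub_zero]

theorem exists_retraction :
    ∃ (ρ : TaylorMap (bundleSpace K V) K) (qK : FormalSeries K K), IsHomological qK ∧
      linearPart qK = 0 ∧ ρ.IsRelated q qK ∧ linearPart ρ.series = LinearMap.fst ℝ K (V × V) := by
  obtain ⟨ρ, invariant, restriction, linearPart_ρ⟩ := hq.exists_invariant_retraction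
  have proj_section : (TaylorMap.ofLinear _ zeroSectionProj_mem).comp
      (.inl K (V.prod V.shift)) = .inl K (V.prod V.shift) :=
    TaylorMap.ext ((TaylorMap.ofLinear_comp _ _ _).trans (postcomp_linear _ _))
  have leftInverse : ρ.comp (.inl K (V.prod V.shift)) = .id K := by
    rw [← proj_section, ← TaylorMap.comp_assoc, restriction, TaylorMap.fst_comp_inl]
  have hρ : ρ.IsRelated q (subst (.inl K (V.prod V.shift)) (derivAlong q ρ.series)) := by
    refine sub_eq_zero.1 (hq.isEulerLike.eq_zero ?_ ?_)
    · rw [map_sub, subst_subst ρ, restriction, subst_subst, TaylorMap.inl_comp_fst, sub_self]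
    · rw [map_sub, derivAlong_homotopyField_comm hq.toIsHomological fibreHomotopy_mem,
        derivAlong_subst, invariant, map_zero, map_zero, LinearMap.zero_apply, sub_zero]
  refine ⟨ρ, _, hq.of_isRelated leftInverse hρ, ?_, hρ, linearPart_ρ⟩
  rw [linearPart_subst, linearPart_derivAlong hq.mem_gradedSeries hq.constantCoeff_eq, linearPart_ρ,
    hq.fst_comp_linearPart, LinearMap.zero_comp]

end IsAdapted

theorem IsAdapted.exists_normalForm {K V : GrSpace.{u}}
    {q : FormalSeries (bundleSpace K V) (bundleSpace K V)} (hq : IsAdapted q) :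
    ∃ qK : FormalSeries K K, IsHomological qK ∧ linearPart qK = 0 ∧
      ∃ Φ Ψ : TaylorMap (bundleSpace K V) (bundleSpace K V),
        Ψ.comp Φ = .id _ ∧ Φ.comp Ψ = .id _ ∧
        Φ.IsRelated q (prodField qK (linear (tangentDifferential V))) ∧
        linearPart Φ.series = .id ∧
        (TaylorMap.snd K (V.prod V.shift)).comp Φ = .snd K (V.prod V.shift) := by
  obtain ⟨ρ, qK, qK_homological, linearPart_qK, hρ, linearPart_ρ⟩ := hq.exists_retraction
  have linearPart_Φ : linearPart (ρ.prodMk (.snd K (V.prod V.shift))).series = .id := by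
    rw [TaylorMap.linearPart_prodMk, linearPart_ρ]
    exact LinearMap.ext fun _ => rfl
  obtain ⟨Ψ, hΨ, hΨ'⟩ := (ρ.prodMk (.snd K (V.prod V.shift))).exists_inverse
    (linearPart_Φ ▸ Function.bijective_id)
  exact ⟨qK, qK_homological, linearPart_qK, _, Ψ, hΨ, hΨ', hρ.prodMk hq.isRelated_snd, linearPart_Φ,
    TaylorMap.snd_comp_prodMk _ _⟩

namespace IsHomological

variable {K V : GrSpace.{u}} {q : FormalSeries H H} (hq : IsHomological q)

/-- The map `x ↦ (e x, e (q x))` from `M_H` to `T[1]V`. -/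
noncomputable def tangentLift (hq : IsHomological q) (e : H →ₗ[ℝ] V)
    (he : ∀ d, ∀ x ∈ H.gr d, e x ∈ V.gr d) : TaylorMap H (V.prod V.shift) :=
  (TaylorMap.ofLinear e he).prodMk
    { series := postcomp e q
      mem_gradedSeries :=
        postcomp_mem_gradedSeries (fun d => he (d + (1, 1))) hq.mem_gradedSeries
      constantCoeff_series := by rw [constantCoeff_postcomp, hq.constantCoeff_eq, map_zero] }

theorem isRelated_tangentLift (e : H →ₗ[ℝ] V) (he : ∀ d, ∀ x ∈ H.gr d, e x ∈ V.gr d) :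
    (hq.tangentLift e he).IsRelated q (linear (tangentDifferential V)) := by
  rw [TaylorMap.IsRelated, subst_linear, tangentLift, TaylorMap.prodMk, map_add, map_add,
    derivAlong_postcomp, derivAlong_postcomp, derivAlong_postcomp, hq.derivAlong_self]
  change postcomp _ (derivAlong q (linear e)) + _ = postcomp _ (postcomp _ (linear e)) + _
  rw [derivAlong_linear, map_zero, map_zero, add_zero]
  exact (zero_add _).symm

theorem exists_trivialization (e₁ : H →ₗ[ℝ] K) (he₁ : ∀ d, ∀ x ∈ H.gr d, e₁ x ∈ K.gr d)
    (e₂ : H →ₗ[ℝ] V) (he₂ : ∀ d, ∀ x ∈ H.gr d, e₂ x ∈ V.gr d) (he₁q : e₁ ∘ₗ linearPart q = 0)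
    (bijective : Function.Bijective (e₁.prod (e₂.prod (e₂ ∘ₗ linearPart q)))) :
    ∃ qK : FormalSeries K K, IsHomological qK ∧ linearPart qK = 0 ∧
      ∃ (t : TaylorMap H (bundleSpace K V)) (t' : TaylorMap (bundleSpace K V) H),
        t'.comp t = .id _ ∧ t.comp t' = .id _ ∧
        t.IsRelated q (prodField qK (linear (tangentDifferential V))) ∧
        linearPart t.series = e₁.prod (e₂.prod (e₂ ∘ₗ linearPart q)) ∧
        (TaylorMap.snd K (V.prod V.shift)).comp t = hq.tangentLift e₂ he₂ := by
  let Φ : TaylorMap H (bundleSpace K V) :=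
    (TaylorMap.ofLinear e₁ he₁).prodMk (hq.tangentLift e₂ he₂)
  have linearPart_Φ : linearPart Φ.series = e₁.prod (e₂.prod (e₂ ∘ₗ linearPart q)) := by
    rw [TaylorMap.linearPart_prodMk, tangentLift, TaylorMap.linearPart_prodMk]
    exact congrArg₂ LinearMap.prod (linearPart_linear e₁)
      (congrArg₂ LinearMap.prod (linearPart_linear e₂) rfl)
  obtain ⟨Φ', hΦ, hΦ'⟩ := Φ.exists_inverse (linearPart_Φ ▸ bijective)
  obtain ⟨q', q'_homological, related⟩ := hq.exists_isRelated hΦ hΦ'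
  have q'_adapted : IsAdapted q' := by
    refine ⟨q'_homological, ?_, ?_⟩
    · have snd_eq : TaylorMap.snd K (V.prod V.shift) = (hq.tangentLift e₂ he₂).comp Φ' := by
        rw [← TaylorMap.snd_comp_prodMk (.ofLinear e₁ he₁) (hq.tangentLift e₂ he₂),
          TaylorMap.comp_assoc, hΦ', TaylorMap.comp_id]
      rw [snd_eq]
      exact (hq.isRelated_tangentLift e₂ he₂).comp (related.symm hΦ hΦ')
    · rw [← LinearMap.cancel_right (linearPart_Φ ▸ bijective.surjective), LinearMap.comp_assoc,
        ← related.linearPart_comp hq.mem_gradedSeries hq.constantCoeff_eq, linearPart_Φ,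
        ← LinearMap.comp_assoc, LinearMap.fst_prod, he₁q, LinearMap.zero_comp]
  obtain ⟨qK, qK_homological, linearPart_qK, Ψ, Ψ', hΨ, hΨ', relatedΨ, linearPart_Ψ, snd_Ψ⟩ :=
    q'_adapted.exists_normalForm
  refine ⟨qK, qK_homological, linearPart_qK, Ψ.comp Φ, Φ'.comp Ψ', ?_, ?_, relatedΨ.comp related,
    ?_, ?_⟩
  · rw [TaylorMap.comp_assoc, ← TaylorMap.comp_assoc Ψ', hΨ, TaylorMap.id_comp, hΦ]
  · rw [TaylorMap.comp_assoc, ← TaylorMap.comp_assoc Φ, hΦ', TaylorMap.id_comp, hΨ']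
  · exact (linearPart_subst Φ Ψ.series).trans (by rw [linearPart_Ψ, linearPart_Φ]; rfl)
  · rw [← TaylorMap.comp_assoc, snd_Ψ, TaylorMap.snd_comp_prodMk]

end IsHomological

/-! ### Comparison with functions, formal maps and `L_∞`-structures -/

/-- Functions on `M_H` as real-valued formal series. -/
def toSeries (H : GrSpace.{u}) : FormalFun H ≃ₗ[ℝ] FormalSeries H ℝ where
  toFun f := ⟨f.1, f.2⟩
  invFun f := ⟨f.1, f.2⟩
  map_add' _ _ := rfl
  map_smul' _ _ := rfl

theorem coeff_toSeries (n : ℕ) (f : FormalFun H) : coeff n (toSeries H f) = f.1 n := rfl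

theorem continuous_coeff_toSeries (n : ℕ) (x : Fin n → H) :
    Continuous fun f => coeff n (toSeries H f) x := by
  have continuous_coeffs : Continuous
      fun (f : FormalFun H) (a : Σ n : ℕ, (Fin n → H)) => f.1 a.1 a.2 := continuous_induced_dom
  exact (continuous_apply ⟨n, x⟩).comp continuous_coeffs

theorem toSeries_mul (f g : FormalFun H) :
    toSeries H (f * g)
      = contract (toSeries H f) (LinearMap.toSpanSingleton ℝ _ (toSeries H g)) := by
  refine formalSeries_ext fun n d x hx => ?_
  rw [coeff_contract _ _ hx]
  change (∑ k : Fin (n + 1), ((Nat.factorial k : ℝ) * (Nat.factorial (n - k) : ℝ))⁻¹ •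
      symmetrize (((LinearMap.mul' ℝ ℝ).compMultilinearMap
        ((f.1 k).domCoprod (g.1 (n - k)))).domDomCongr (split k))) x = _
  rw [sum_apply]
  refine Finset.sum_congr rfl fun k _ => ?_
  rw [smul_apply, symmetrize_apply _ hx]
  rfl

theorem toSeries_one : toSeries H 1 = const 1 := by
  refine formalSeries_ext fun n d x _ => ?_
  cases n with
  | zero =>
    rw [coeff_zero_apply, coeff_zero_apply, constantCoeff_const]
    exact Fin.prod_univ_zero fun i => i.elim0
  | succ n => rfl

/-- The values allowed to a function of degree `d` on vectors of total degree `s`. -/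
def scalarsOfDegree (d s : ℤ × ZMod 2) : Submodule ℝ ℝ := if d = -s then ⊤ else ⊥

theorem isHomogeneous_iff (f : FormalFun H) (d : ℤ × ZMod 2) :
    f.IsHomogeneous d ↔ toSeries H f ∈ gradedSeries H (scalarsOfDegree d) := by
  refine forall₃_congr fun n e x => forall_congr' fun _ => ?_
  unfold scalarsOfDegree
  split_ifs with h
  · simp [h]
  · simp only [h, imp_false, not_not, Submodule.mem_bot, coeff_toSeries]

namespace TaylorMap

/-- The morphism of formal pointed manifolds with the given Taylor series. -/
noncomputable def toFormalMap (Φ : TaylorMap H K) : FormalMap H K where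
  pullback := (toSeries H).symm.toLinearMap ∘ₗ subst Φ ∘ₗ (toSeries K).toLinearMap
  map_one := (toSeries H).symm_apply_eq.2 <|
    (congrArg (subst Φ) toSeries_one).trans ((subst_const Φ 1).trans toSeries_one.symm)
  map_mul f g := by
    refine (toSeries H).injective ?_
    simp only [LinearMap.comp_apply, LinearEquiv.coe_coe, LinearEquiv.apply_symm_apply,
      toSeries_mul, subst_contract, LinearMap.comp_toSpanSingleton]
  continuous := continuous_induced_rng.2 <| continuous_pi fun a =>
    continuous_coeff_subst Φ continuous_coeff_toSeries a.1 a.2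
  degree f d hf := (isHomogeneous_iff _ d).2 <|
    subst_mem_gradedSeries Φ ((isHomogeneous_iff f d).1 hf)
  basePoint f := constantCoeff_subst Φ (toSeries K f)

theorem toSeries_pullback (Φ : TaylorMap H K) (f : FormalFun K) :
    toSeries H (Φ.toFormalMap.pullback f) = subst Φ (toSeries K f) := rfl

theorem pullback_pullback_of_comp_eq_id {Φ : TaylorMap H K} {Ψ : TaylorMap K H}
    (h : Ψ.comp Φ = TaylorMap.id H) (f : FormalFun H) :
    Φ.toFormalMap.pullback (Ψ.toFormalMap.pullback f) = f :=
  (toSeries H).injective (subst_subst_of_comp_eq_id h (toSeries H f))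

theorem hasLinearPart_toFormalMap (Φ : TaylorMap H K) :
    Φ.toFormalMap.HasLinearPart (linearPart Φ.series) :=
  fun f x => (coeff_one_eq _ _).trans <|
    (LinearMap.congr_fun (linearPart_subst Φ (toSeries K f)) x).trans
      (coeff_one_eq (toSeries K f) fun _ => _).symm

theorem fstPullback_eq {W : GrSpace.{u}} (f : FormalFun K) :
    f.fstPullback W = (fst K W).toFormalMap.pullback f :=
  (toSeries _).injective <| formalSeries_ext fun n _ x _ =>
    (coeff_subst_ofLinear (fun _ _ => GrSpace.fst_mem_gr) (toSeries K f) n x).symm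

end TaylorMap

namespace LInfty

variable (L : LInfty H)

/-- The Taylor series of the homological vector field of an `L_∞`-algebra. -/
def vectorField : FormalSeries H H := ⟨L.l, L.symm⟩

theorem toSeries_Q (f : FormalFun H) :
    toSeries H (L.Q f) = derivAlong L.vectorField (toSeries H f) := by
  refine formalSeries_ext fun n d x hx => ?_
  rw [derivAlong_apply, coeff_contract _ _ hx]
  change (∑ k : Fin (n + 1), ((Nat.factorial k : ℝ) * (Nat.factorial (n - k) : ℝ))⁻¹ •
      symmetrize ((MultilinearMap.uncurrySum (R := ℝ) (N := fun _ => (H : Type u))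
        ((f.1 (n - k + 1)).curryLeft.compMultilinearMap (L.l k))).domDomCongr (split k))) x = _
  rw [sum_apply]
  refine Finset.sum_congr rfl fun k _ => ?_
  rw [smul_apply, symmetrize_apply _ hx]
  rfl

theorem isHomological_vectorField : IsHomological L.vectorField where
  mem_gradedSeries := L.degree
  constantCoeff_eq := congrArg (fun l => l Fin.elim0) L.l_zero
  derivAlong_self := formalSeries_ext fun n d x hx => by
    rw [derivAlong_apply, coeff_contract _ _ hx]
    exact L.jacobi n d x hx

/-- The `L_∞`-algebra whose structure maps are the Taylor coefficients of a homological vector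
field. -/
def ofVectorField {q : FormalSeries H H} (hq : IsHomological q) : LInfty H where
  l := q.1
  l_zero := MultilinearMap.ext fun x => (coeff_zero_apply q x).trans hq.constantCoeff_eq
  degree := hq.mem_gradedSeries
  symm := q.2
  jacobi n d x hx := by
    have jacobi := congrArg (fun f => coeff n f x) hq.derivAlong_self
    simp only [derivAlong_apply, coeff_contract _ _ hx] at jacobi
    exact jacobi

theorem linearPart_vectorField : linearPart L.vectorField = L.D := by
  refine LinearMap.ext fun x => ?_
  exact (coeff_one_eq L.vectorField fun _ => x).symm

theorem isQMap_toFormalMap {L : LInfty H} {L' : LInfty K} {Φ : TaylorMap H K}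
    (h : Φ.IsRelated L.vectorField L'.vectorField) : L.IsQMap L' Φ.toFormalMap := fun f => by
  refine (toSeries H).injective ?_
  rw [toSeries_Q, TaylorMap.toSeries_pullback, TaylorMap.toSeries_pullback, toSeries_Q,
    h.derivAlong_subst]

theorem vectorField_prod (L' : LInfty K) :
    (L.prod L').vectorField = prodField L.vectorField L'.vectorField := by
  refine formalSeries_ext fun n d x _ => ?_
  rw [prodField, map_add, add_apply, coeff_postcomp, coeff_postcomp, TaylorMap.fst, TaylorMap.snd]
  simp only [coeff_subst_ofLinear, LinearMap.inl_apply,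
    LinearMap.inr_apply, Prod.mk_add_mk, add_zero, zero_add]
  rfl

theorem vectorField_shiftedTangent (V : GrSpace.{u}) :
    (shiftedTangent V).vectorField = linear (tangentDifferential V) := by
  refine formalSeries_ext fun n d x _ => ?_
  match n with
  | 0 => rfl
  | 1 => rfl
  | n + 2 => rfl

end LInfty

/-! ### Splittings of the linear part -/

namespace LInfty

variable {L : LInfty H} {E F : Submodule ℝ H}

theorem D_D (L : LInfty H) (x : H) : L.D (L.D x) = 0 := by
  have hq := L.isHomological_vectorField
  have linearPart_sq := linearPart_derivAlong hq.mem_gradedSeries hq.constantCoeff_eq L.vectorField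
  rw [hq.derivAlong_self, linearPart_vectorField] at linearPart_sq
  exact (LinearMap.congr_fun linearPart_sq x).symm

theorem D_mem (L : LInfty H) {d : ℤ × ZMod 2} {x : H} (hx : x ∈ H.gr d) :
    L.D x ∈ H.gr (d + (1, 1)) :=
  L.linearPart_vectorField ▸ linearPart_mem L.isHomological_vectorField.mem_gradedSeries hx

theorem D_degProj (L : LInfty H) (d : ℤ × ZMod 2) (x : H) :
    L.D (H.degProj d x) = H.degProj (d + (1, 1)) (L.D x) := by
  have commute : L.D ∘ₗ H.degProj d = H.degProj (d + (1, 1)) ∘ₗ L.D :=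
    linearMap_ext_homogeneous fun e x hx => by
      simp [GrSpace.degProj_of_mem hx, GrSpace.degProj_of_mem (L.D_mem hx), apply_ite L.D]
  exact LinearMap.congr_fun commute x

theorem isGraded_ker (L : LInfty H) : H.IsGraded (LinearMap.ker L.D) :=
  GrSpace.isGraded_iff.2 fun x hx d => by
    rw [LinearMap.mem_ker, D_degProj, LinearMap.mem_ker.1 hx, map_zero]

theorem isGraded_range (L : LInfty H) : H.IsGraded (LinearMap.range L.D) := by
  refine GrSpace.isGraded_iff.2 ?_
  rintro _ ⟨y, rfl⟩ d
  exact ⟨H.degProj (d - (1, 1)) y, by rw [D_degProj, sub_add_cancel]⟩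

theorem range_le_ker (L : LInfty H) : LinearMap.range L.D ≤ LinearMap.ker L.D :=
  LinearMap.range_le_ker_iff.2 (LinearMap.ext L.D_D)

theorem exists_isSplitting (L : LInfty H) : ∃ E F : Submodule ℝ H, L.IsSplitting E F := by
  have isGraded_top : H.IsGraded ⊤ := GrSpace.isGraded_iff.2 fun _ _ _ => trivial
  obtain ⟨E, gradedE, disjointE, supE⟩ :=
    GrSpace.exists_isGraded_compl L.range_le_ker L.isGraded_range L.isGraded_ker
  obtain ⟨F, gradedF, disjointF, supF⟩ :=
    GrSpace.exists_isGraded_compl le_top L.isGraded_ker isGraded_top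
  exact ⟨E, F, gradedE, gradedF, disjointE, supE, disjointF, codisjoint_iff.2 supF⟩

namespace IsSplitting

variable (h : L.IsSplitting E F)
include h

theorem mem_ker {x : H} (hx : x ∈ E) : x ∈ LinearMap.ker L.D :=
  h.sup_eq ▸ Submodule.mem_sup_left hx

theorem exists_cohomology_equiv : ∃ e : E ≃ₗ[ℝ] L.Cohomology, ∀ x : E,
    ∃ hx : (x : H) ∈ LinearMap.ker L.D, e x = Submodule.Quotient.mk ⟨(x : H), hx⟩ := by
  let toCohomology : E →ₗ[ℝ] L.Cohomology :=
    Submodule.mkQ _ ∘ₗ Submodule.inclusion fun _ => h.mem_ker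
  have injective : Function.Injective toCohomology := by
    refine (injective_iff_map_eq_zero _).2 fun x hx => Subtype.ext ?_
    have x_mem : (x : H) ∈ LinearMap.range L.D :=
      (Submodule.Quotient.mk_eq_zero ((LinearMap.range L.D).submoduleOf (LinearMap.ker L.D))).1 hx
    exact Submodule.disjoint_def.1 h.disjoint _ x.2 x_mem
  have surjective : Function.Surjective toCohomology := by
    intro y
    obtain ⟨⟨y, hy⟩, rfl⟩ := Submodule.Quotient.mk_surjective _ y
    obtain ⟨x, hx, z, hz, rfl⟩ := Submodule.mem_sup.1 (h.sup_eq.symm ▸ hy)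
    refine ⟨⟨x, hx⟩, (Submodule.Quotient.eq _).2 ?_⟩
    change x - (x + z) ∈ LinearMap.range L.D
    simpa using hz
  exact ⟨.ofBijective _ ⟨injective, surjective⟩, fun x => ⟨h.mem_ker x.2, rfl⟩⟩

theorem isQuasiIso {L' : LInfty (H.sub E h.gradedE)} (hL' : L'.D = 0) :
    L'.IsQuasiIso L E.subtype where
  comm x := by
    rw [hL', LinearMap.zero_apply, map_zero]
    exact (h.mem_ker x.2).symm
  injective x _ hx := by
    rw [show x = 0 from Subtype.ext (Submodule.disjoint_def.1 h.disjoint _ x.2 hx)]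
    exact zero_mem _
  surjective y hy := by
    obtain ⟨x, hx, z, hz, rfl⟩ := Submodule.mem_sup.1 (h.sup_eq.symm ▸ LinearMap.mem_ker.2 hy)
    refine ⟨⟨x, hx⟩, LinearMap.congr_fun hL' _, ?_⟩
    change x + z - x ∈ LinearMap.range L.D
    simpa using hz

theorem isCompl_left : IsCompl E (LinearMap.range L.D ⊔ F) :=
  h.disjoint.isCompl_sup_right_of_isCompl_sup_left (h.sup_eq ▸ h.isCompl.symm)

theorem isCompl_range : IsCompl (LinearMap.range L.D) (E ⊔ F) :=
  h.disjoint.symm.isCompl_sup_right_of_isCompl_sup_left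
    (sup_comm E _ ▸ h.sup_eq ▸ h.isCompl.symm)

/-- The projection of `H = E ⊕ F ⊕ Im D` onto `E`. -/
noncomputable def harmonicProj : H →ₗ[ℝ] H.sub E h.gradedE :=
  E.projectionOnto _ h.isCompl_left

/-- The projection of `H = E ⊕ F ⊕ Im D` onto `Im D`. -/
noncomputable def boundaryProj : H →ₗ[ℝ] H.sub (LinearMap.range L.D) L.isGraded_range :=
  (LinearMap.range L.D).projectionOnto _ h.isCompl_range

theorem harmonicProj_mem (d : ℤ × ZMod 2) (x : H) (hx : x ∈ H.gr d) :
    h.harmonicProj x ∈ (H.sub E h.gradedE).gr d :=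
  GrSpace.projectionOnto_mem_gr h.gradedE (L.isGraded_range.sup h.gradedF) h.isCompl_left hx

theorem boundaryProj_mem (d : ℤ × ZMod 2) (x : H) (hx : x ∈ H.gr d) :
    h.boundaryProj x ∈ (H.sub (LinearMap.range L.D) L.isGraded_range).gr d :=
  GrSpace.projectionOnto_mem_gr L.isGraded_range (h.gradedE.sup h.gradedF) h.isCompl_range hx

theorem harmonicProj_coe (x : E) : h.harmonicProj x = x :=
  Submodule.projectionOnto_apply_left h.isCompl_left x

theorem harmonicProj_eq_zero_of_mem {x : H} (hx : x ∈ LinearMap.range L.D ⊔ F) :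
    h.harmonicProj x = 0 :=
  (Submodule.projectionOnto_apply_eq_zero_iff h.isCompl_left).2 hx

theorem boundaryProj_coe (x : LinearMap.range L.D) : h.boundaryProj x = x :=
  Submodule.projectionOnto_apply_left h.isCompl_range x

theorem ker_boundaryProj : LinearMap.ker h.boundaryProj = E ⊔ F :=
  Submodule.ker_projectionOnto h.isCompl_range

theorem boundaryProj_eq_zero_of_mem {x : H} (hx : x ∈ E ⊔ F) : h.boundaryProj x = 0 :=
  LinearMap.mem_ker.1 (h.ker_boundaryProj ▸ hx)

theorem harmonicProj_comp_D : h.harmonicProj ∘ₗ L.D = 0 :=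
  LinearMap.ext fun x => h.harmonicProj_eq_zero_of_mem (Submodule.mem_sup_left ⟨x, rfl⟩)

theorem eq_zero_of_proj_eq_zero {x : H} (harmonic : h.harmonicProj x = 0)
    (boundary : h.boundaryProj x = 0) (boundary_D : h.boundaryProj (L.D x) = 0) : x = 0 := by
  have D_x : L.D x = 0 :=
    congrArg Subtype.val ((h.boundaryProj_coe ⟨_, x, rfl⟩).symm.trans boundary_D)
  obtain ⟨a, ha, b, hb, rfl⟩ := Submodule.mem_sup.1 (h.sup_eq.symm ▸ LinearMap.mem_ker.2 D_x)
  lift a to E using ha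
  lift b to LinearMap.range L.D using hb
  rw [map_add, h.harmonicProj_coe, h.harmonicProj_eq_zero_of_mem (Submodule.mem_sup_left b.2),
    add_zero] at harmonic
  rw [map_add, h.boundaryProj_coe, h.boundaryProj_eq_zero_of_mem (Submodule.mem_sup_left a.2),
    zero_add] at boundary
  rw [harmonic, boundary, Submodule.coe_zero, Submodule.coe_zero, add_zero]

theorem exists_mem_D_eq (x : H) : ∃ f ∈ F, L.D f = L.D x := by
  obtain ⟨f, hf, k, hk, rfl⟩ := Submodule.mem_sup.1
    (h.isCompl.sup_eq_top ▸ Submodule.mem_top : x ∈ F ⊔ LinearMap.ker L.D)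
  exact ⟨f, hf, by rw [map_add, LinearMap.mem_ker.1 hk, add_zero]⟩

theorem bijective_prod :
    Function.Bijective (h.harmonicProj.prod (h.boundaryProj.prod (h.boundaryProj ∘ₗ L.D))) := by
  refine ⟨(injective_iff_map_eq_zero _).2 fun x hx => h.eq_zero_of_proj_eq_zero
    (congrArg Prod.fst hx) (congrArg (fun z => z.2.1) hx) (congrArg (fun z => z.2.2) hx), ?_⟩
  rintro ⟨a, b, ⟨_, y, rfl⟩⟩
  obtain ⟨f, hf, D_f⟩ := h.exists_mem_D_eq y
  have D_sum : L.D (a + b + f) = L.D y := by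
    rw [map_add, map_add, LinearMap.mem_ker.1 (h.mem_ker a.2),
      LinearMap.mem_ker.1 (L.range_le_ker b.2), zero_add, zero_add, D_f]
  refine ⟨a + b + f, Prod.ext ?_ (Prod.ext ?_ (Subtype.ext ?_))⟩
  · simp [h.harmonicProj_coe, h.harmonicProj_eq_zero_of_mem (Submodule.mem_sup_left b.2),
      h.harmonicProj_eq_zero_of_mem (Submodule.mem_sup_right hf)]
  · simp [h.boundaryProj_coe, h.boundaryProj_eq_zero_of_mem (Submodule.mem_sup_left a.2),
      h.boundaryProj_eq_zero_of_mem (Submodule.mem_sup_right hf)]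
  · refine (congrArg (fun z => (h.boundaryProj z : H)) D_sum).trans ?_
    exact congrArg Subtype.val (h.boundaryProj_coe ⟨_, y, rfl⟩)

end IsSplitting

end LInfty

/-! ### Ideals of functions vanishing on a linear subspace -/

theorem isEulerLike_linear {P : H →ₗ[ℝ] H} (hP : ∀ d, ∀ x ∈ H.gr d, P x ∈ H.gr d)
    (idempotent : P ∘ₗ P = P) : IsEulerLike hP (linear (LinearMap.id - P)) where
  mem_gradedSeries := linear_mem_gradedSeries fun d x hx =>
    H.shiftedGr_zero ▸ sub_mem hx (hP d x hx)
  subst_eq_zero := by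
    rw [subst_linear, TaylorMap.ofLinear, postcomp_linear, LinearMap.sub_comp, idempotent,
      LinearMap.id_comp, sub_self, map_zero]
  postcomp_eq := by
    rw [postcomp_linear, LinearMap.comp_sub, LinearMap.comp_id, LinearMap.sub_comp, idempotent,
      LinearMap.id_comp, sub_self, sub_zero]

theorem pderiv_derivAlong_linear {φ : H →ₗ[ℝ] H} (hφ : ∀ d, ∀ x ∈ H.gr d, φ x ∈ H.gr d)
    (f : FormalSeries H M) (y : H) :
    pderiv y (derivAlong (linear φ) f) = pderiv (φ y) f + derivAlong (linear φ) (pderiv y f) := by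
  have degree_zero : linear φ ∈ gradedSeries H (H.shiftedGr 0) :=
    linear_mem_gradedSeries (H.shiftedGr_zero ▸ hφ)
  have homogeneous : differential (derivAlong (linear φ) f)
      = differential f ∘ₗ φ + derivAlong (linear φ) ∘ₗ differential f :=
    linearMap_ext_homogeneous fun d y hy => by
      change pderiv y (derivAlong (linear φ) f)
        = pderiv (φ y) f + derivAlong (linear φ) (pderiv y f)
      rw [pderiv_derivAlong degree_zero f hy, pderiv_linear, derivAlong_apply (const _),
        contract_const, Prod.snd_zero, swapSign_zero_right, one_smul]
      rfl
  exact LinearMap.congr_fun homogeneous y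

theorem coeff_derivAlong_linear {φ : H →ₗ[ℝ] H} (hφ : ∀ d, ∀ x ∈ H.gr d, φ x ∈ H.gr d)
    (f : FormalSeries H M) {n : ℕ} (x : Fin n → H) :
    coeff n (derivAlong (linear φ) f) x
      = ∑ i, coeff n f (Function.update x i (φ (x i))) := by
  induction n generalizing f with
  | zero => simp [coeff_zero_apply, derivAlong_apply, constantCoeff_contract]
  | succ n ih =>
    rw [coeff_succ_apply, pderiv_derivAlong_linear hφ, map_add, add_apply, ih,
      Fin.sum_univ_succ]
    refine congrArg₂ (· + ·) ?_ (Finset.sum_congr rfl fun i _ => ?_)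
    · rw [coeff_succ_apply, Function.update_self, Fin.tail_update_zero]
    · rw [coeff_succ_apply, Function.update_of_ne (Fin.succ_ne_zero i).symm,
        Fin.tail_update_succ]
      rfl

section Truncation

variable {ι : Type*} (b : Module.Basis ι ℝ H)

/-- The projection of `H` onto the span of finitely many vectors of a basis. -/
noncomputable def truncation (S : Finset ι) : H →ₗ[ℝ] H := ∑ j ∈ S, (b.coord j).smulRight (b j)

theorem truncation_mem {deg : ι → ℤ × ZMod 2} (hb : ∀ j, b j ∈ H.gr (deg j)) (S : Finset ι)
    (d : ℤ × ZMod 2) (x : H) (hx : x ∈ H.gr d) : truncation b S x ∈ H.gr d := by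
  have commute : truncation b S ∘ₗ H.degProj d = H.degProj d ∘ₗ truncation b S :=
    b.ext fun k => by
      classical
      by_cases k_mem : k ∈ S <;> by_cases deg_k : deg k = d <;>
        simp [truncation, GrSpace.degProj_of_mem (hb _), Finsupp.single_apply, k_mem, deg_k]
  rw [← GrSpace.degProj_self hx]
  exact (LinearMap.congr_fun commute x) ▸ GrSpace.degProj_mem d _

theorem truncation_eq_self {S : Finset ι} {x : H} (hx : (b.repr x).support ⊆ S) :
    truncation b S x = x := by
  conv_rhs => rw [← b.linearCombination_repr x, Finsupp.linearCombination_apply,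
    Finsupp.sum_of_support_subset _ hx (fun i a => a • b i) fun _ _ => zero_smul _ _]
  simp [truncation]

end Truncation

namespace FormalFun

/-- The linear function on `M_H` given by a linear functional on `H`. -/
def ofLinear (φ : H →ₗ[ℝ] ℝ) : FormalFun H := (toSeries H).symm (linear φ)

section IsIdeal

variable {J : Submodule ℝ (FormalFun H)} (hJ : IsIdeal J)
include hJ

theorem IsIdeal.derivAlong_smulRight_mem {φ : H →ₗ[ℝ] ℝ} (hφ : ofLinear φ ∈ J) (y : H)
    (f : FormalSeries H ℝ) :
    (toSeries H).symm (derivAlong (linear (φ.smulRight y)) f) ∈ J := by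
  have product : toSeries H (ofLinear φ * (toSeries H).symm (pderiv y f))
      = derivAlong (linear (φ.smulRight y)) f := by
    have smulRight_eq : φ.smulRight y = LinearMap.toSpanSingleton ℝ H y ∘ₗ φ :=
      LinearMap.ext fun _ => rfl
    rw [toSeries_mul, derivAlong_apply, smulRight_eq, ← postcomp_linear, contract_postcomp,
      LinearMap.comp_toSpanSingleton, ofLinear, LinearEquiv.apply_symm_apply,
      LinearEquiv.apply_symm_apply]
    rfl
  rw [← product, LinearEquiv.symm_apply_apply]
  exact (hJ _ _ hφ).2

variable {P : H →ₗ[ℝ] H} (hφ : ∀ φ : H →ₗ[ℝ] ℝ, φ ∘ₗ P = 0 → ofLinear φ ∈ J)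
include hφ

theorem IsIdeal.derivAlong_truncation_mem (idempotent : P ∘ₗ P = P) {ι : Type*}
    (b : Module.Basis ι ℝ H) (S : Finset ι) (f : FormalSeries H ℝ) :
    (toSeries H).symm (derivAlong (linear (truncation b S ∘ₗ (LinearMap.id - P))) f) ∈ J := by
  have sum_eq : truncation b S ∘ₗ (LinearMap.id - P)
      = ∑ j ∈ S, (b.coord j ∘ₗ (LinearMap.id - P)).smulRight (b j) :=
    LinearMap.ext fun x => by simp [truncation]
  rw [sum_eq, map_sum, map_sum, LinearMap.sum_apply, map_sum]
  refine sum_mem fun j _ => hJ.derivAlong_smulRight_mem (hφ _ ?_) _ _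
  rw [LinearMap.comp_assoc, LinearMap.sub_comp, idempotent, LinearMap.id_comp, sub_self,
    LinearMap.comp_zero]

variable (hP : ∀ d, ∀ x ∈ H.gr d, P x ∈ H.gr d) (idempotent : P ∘ₗ P = P) {g : FormalFun H}
  (hg : subst (.ofLinear P hP) (toSeries H g) = 0)
include idempotent hg

theorem IsIdeal.mem_of_finiteDimensional [FiniteDimensional ℝ H] : g ∈ J := by
  obtain ⟨f, -, -, f_eq⟩ := (isEulerLike_linear hP idempotent).exists_derivAlong_eq (S := ⊤)
    (fun _ _ => trivial) (fun _ _ => trivial) trivial hg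
  have truncation_univ : truncation (Module.finBasis ℝ H) Finset.univ = .id :=
    LinearMap.ext fun x => truncation_eq_self _ (Finset.subset_univ _)
  have mem := hJ.derivAlong_truncation_mem hφ idempotent (Module.finBasis ℝ H) Finset.univ f
  rwa [truncation_univ, LinearMap.id_comp, f_eq, LinearEquiv.symm_apply_apply] at mem

theorem IsIdeal.mem_of_isClosed (closed : IsClosed (J : Set (FormalFun H))) : g ∈ J := by
  classical
  obtain ⟨f, -, -, f_eq⟩ := (isEulerLike_linear hP idempotent).exists_derivAlong_eq (S := ⊤)
    (fun _ _ => trivial) (fun _ _ => trivial) trivial hg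
  obtain ⟨ι, b, deg, hb⟩ := H.exists_homogeneous_basis
  have tendsto : Filter.Tendsto (fun S : Finset ι => (toSeries H).symm
      (derivAlong (linear (truncation b S ∘ₗ (LinearMap.id - P))) f)) Filter.atTop (nhds g) := by
    rw [nhds_induced, Filter.tendsto_comap_iff, tendsto_pi_nhds]
    rintro ⟨n, x⟩
    refine tendsto_const_nhds.congr' ?_
    filter_upwards [Filter.eventually_ge_atTop
      (Finset.univ.biUnion fun i => (b.repr (x i - P (x i))).support)] with S hS
    change coeff n (toSeries H g) x = coeff n (derivAlong _ f) x
    have complement_mem : ∀ d, ∀ x ∈ H.gr d, (LinearMap.id - P : H →ₗ[ℝ] H) x ∈ H.gr d :=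
      fun d x hx => sub_mem hx (hP d x hx)
    rw [← f_eq, coeff_derivAlong_linear complement_mem, coeff_derivAlong_linear fun d x hx =>
      truncation_mem b hb S d ((LinearMap.id - P : H →ₗ[ℝ] H) x) (complement_mem d x hx)]
    refine Finset.sum_congr rfl fun i _ => congrArg (fun y => coeff n f (Function.update x i y)) ?_
    exact (truncation_eq_self b ((Finset.subset_biUnion_of_mem
      (fun i => (b.repr (x i - P (x i))).support) (Finset.mem_univ i)).trans hS)).symm
  exact closed.mem_of_tendsto tendsto <| Filter.Eventually.of_forall fun S =>
    hJ.derivAlong_truncation_mem hφ idempotent b S f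

end IsIdeal

end FormalFun

/-! ### Reduction along a trivialization -/

namespace FormalFun

instance : T2Space (FormalFun H) :=
  Topology.IsEmbedding.t2Space (f := fun f (a : Σ n : ℕ, (Fin n → H)) => f.1 a.1 a.2)
    ⟨⟨rfl⟩, fun _ _ h => Subtype.ext <| funext fun n => MultilinearMap.ext fun x =>
      congrFun h ⟨n, x⟩⟩

theorem toSeries_pullback_ofLinear (Φ : TaylorMap H K) (φ : K →ₗ[ℝ] ℝ) :
    toSeries H (Φ.toFormalMap.pullback (ofLinear φ)) = postcomp φ Φ.series :=
  subst_linear Φ φ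

theorem ofLinear_zero : ofLinear (0 : H →ₗ[ℝ] ℝ) = 0 :=
  (congrArg (toSeries H).symm (map_zero _)).trans (map_zero _)

theorem isIdeal_bot : IsIdeal (⊥ : Submodule ℝ (FormalFun H)) := by
  rintro f _ rfl
  refine ⟨(toSeries H).injective ?_, (toSeries H).injective ?_⟩
  · rw [toSeries_mul, map_zero, LinearMap.toSpanSingleton_zero, map_zero]
  · rw [toSeries_mul, map_zero, map_zero, LinearMap.zero_apply]

theorem IsIdeal.comap {J : Submodule ℝ (FormalFun H)} (hJ : IsIdeal J) (φ : FormalMap H K) :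
    IsIdeal (J.comap φ.pullback) := fun f g hg => by
  rw [Submodule.mem_comap, Submodule.mem_comap, φ.map_mul, φ.map_mul]
  exact hJ _ _ hg

theorem mem_linearVanishing_iff {E F : Submodule ℝ H} {V : Type*} [AddCommGroup V] [Module ℝ V]
    {e : H →ₗ[ℝ] V} (ker_e : LinearMap.ker e = E ⊔ F) {w : FormalFun H} :
    w ∈ linearVanishing H E F ↔ ∃ ψ : V →ₗ[ℝ] ℝ, ofLinear (ψ ∘ₗ e) = w := by
  constructor
  · rintro ⟨hw, vanishing⟩
    have mem_annihilator : (MultilinearMap.ofSubsingleton ℝ (H : Type u) ℝ (0 : Fin 1)).symm (w.1 1)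
        ∈ (LinearMap.ker e).dualAnnihilator :=
      (Submodule.mem_dualAnnihilator _).2 fun x hx => vanishing x (ker_e ▸ hx)
    rw [← LinearMap.range_dualMap_eq_dualAnnihilator_ker] at mem_annihilator
    obtain ⟨ψ, hψ⟩ := mem_annihilator
    refine ⟨ψ, Subtype.ext (funext fun n => ?_)⟩
    match n with
    | 0 => exact (hw 0 Nat.zero_ne_one).symm
    | 1 => exact (Equiv.symm_apply_eq _).1 hψ.symm |>.symm
    | n + 2 => exact (hw (n + 2) (by omega)).symm
  · rintro ⟨ψ, rfl⟩
    refine ⟨fun n hn => ?_, fun x hx => ?_⟩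
    · match n with
      | 0 => rfl
      | 1 => exact absurd rfl hn
      | n + 2 => rfl
    · exact (congrArg ψ (LinearMap.mem_ker.1 (ker_e ▸ hx))).trans (map_zero ψ)

end FormalFun

theorem LInfty.Q_zero (L : LInfty H) : L.Q 0 = 0 := by
  refine (toSeries H).injective ?_
  rw [toSeries_Q, map_zero, map_zero]

theorem TaylorMap.linearPart_comp_of_comp_eq_id {Φ : TaylorMap H K} {Ψ : TaylorMap K H}
    (h : Ψ.comp Φ = .id H) : linearPart Ψ.series ∘ₗ linearPart Φ.series = .id := by
  rw [← linearPart_subst]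
  change linearPart (Ψ.comp Φ).series = _
  rw [h]
  exact linearPart_linear _

/-- An isomorphism from `(M_H, Q)` to a product `(M_K, Q_K) × (T[1]V, d_V)` of formal pointed
`Q`-manifolds whose component in `T[1]V` is the map `x ↦ (e x, e (Q x))`. -/
structure TangentTrivialization {V : GrSpace.{u}} (L : LInfty H) (L' : LInfty K) (e : H →ₗ[ℝ] V)
    (he : ∀ d, ∀ x ∈ H.gr d, e x ∈ V.gr d) where
  toProd : TaylorMap H (bundleSpace K V)
  ofProd : TaylorMap (bundleSpace K V) H
  ofProd_comp_toProd : ofProd.comp toProd = .id H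
  toProd_comp_ofProd : toProd.comp ofProd = .id (bundleSpace K V)
  isRelated : toProd.IsRelated L.vectorField (L'.prod (LInfty.shiftedTangent V)).vectorField
  snd_comp_toProd :
    (TaylorMap.snd K (V.prod V.shift)).comp toProd = L.isHomological_vectorField.tangentLift e he

namespace TangentTrivialization

variable {V : GrSpace.{u}} {L : LInfty H} {L' : LInfty K} {e : H →ₗ[ℝ] V}
  {he : ∀ d, ∀ x ∈ H.gr d, e x ∈ V.gr d} (T : TangentTrivialization L L' e he)

/-- The section of the trivialized bundle `M_H → M_K` over the base point of `T[1]V`. -/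
noncomputable def zeroSection : TaylorMap K H := T.ofProd.comp (.inl K (V.prod V.shift))

/-- The projection of the trivialized bundle `M_H → M_K`. -/
noncomputable def projection : TaylorMap H K := (TaylorMap.fst K (V.prod V.shift)).comp T.toProd

theorem toProd_comp_zeroSection :
    T.toProd.comp T.zeroSection = .inl K (V.prod V.shift) := by
  rw [zeroSection, ← TaylorMap.comp_assoc, T.toProd_comp_ofProd, TaylorMap.id_comp]

theorem projection_comp_zeroSection : T.projection.comp T.zeroSection = .id K := by
  rw [projection, TaylorMap.comp_assoc, toProd_comp_zeroSection, TaylorMap.fst_comp_inl]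

theorem linearPart_zeroSection {s : K →ₗ[ℝ] H}
    (hs : linearPart T.toProd.series ∘ₗ s = LinearMap.inl ℝ K (V × V)) :
    linearPart T.zeroSection.series = s := by
  refine (linearPart_subst _ _).trans ?_
  rw [TaylorMap.inl, TaylorMap.ofLinear, linearPart_linear, ← hs, ← LinearMap.comp_assoc,
    TaylorMap.linearPart_comp_of_comp_eq_id T.ofProd_comp_toProd, LinearMap.id_comp]

theorem isQMap_zeroSection : L'.IsQMap L T.zeroSection.toFormalMap := by
  refine LInfty.isQMap_toFormalMap
    ((T.isRelated.symm T.ofProd_comp_toProd T.toProd_comp_ofProd).comp ?_)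
  rw [LInfty.vectorField_prod]
  exact TaylorMap.isRelated_inl _
    (LInfty.shiftedTangent V).isHomological_vectorField.constantCoeff_eq

theorem isQMap_projection : L.IsQMap L' T.projection.toFormalMap := by
  refine LInfty.isQMap_toFormalMap (TaylorMap.IsRelated.comp ?_ T.isRelated)
  rw [LInfty.vectorField_prod]
  exact TaylorMap.isRelated_fst _ _

theorem isEquivalentReduction : L'.IsEquivalentReduction L T.zeroSection.toFormalMap :=
  ⟨T.isQMap_zeroSection, T.projection.toFormalMap, T.isQMap_projection,
    TaylorMap.pullback_pullback_of_comp_eq_id T.projection_comp_zeroSection,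
    V, T.toProd.toFormalMap, T.ofProd.toFormalMap, LInfty.isQMap_toFormalMap T.isRelated,
    LInfty.isQMap_toFormalMap (T.isRelated.symm T.ofProd_comp_toProd T.toProd_comp_ofProd),
    TaylorMap.pullback_pullback_of_comp_eq_id T.toProd_comp_ofProd,
    TaylorMap.pullback_pullback_of_comp_eq_id T.ofProd_comp_toProd, fun f => by
      rw [TaylorMap.fstPullback_eq]
      exact (toSeries H).injective (subst_subst _ _ _)⟩

theorem surjective_pullback_zeroSection :
    Function.Surjective T.zeroSection.toFormalMap.pullback := fun f =>
  ⟨_, TaylorMap.pullback_pullback_of_comp_eq_id T.projection_comp_zeroSection f⟩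

theorem pullback_toProd_ofLinear (ψ₀ ψ₁ : V →ₗ[ℝ] ℝ) :
    T.toProd.toFormalMap.pullback (.ofLinear (ψ₀.coprod ψ₁ ∘ₗ LinearMap.snd ℝ K (V × V)))
      = .ofLinear (ψ₀ ∘ₗ e) + L.Q (.ofLinear (ψ₁ ∘ₗ e)) := by
  refine (toSeries H).injective ?_
  have snd_series : postcomp (LinearMap.snd ℝ K (V × V)) T.toProd.series
      = (L.isHomological_vectorField.tangentLift e he).series :=
    (TaylorMap.ofLinear_comp _ _ _).symm.trans (congrArg TaylorMap.series T.snd_comp_toProd)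
  have Q_ofLinear : toSeries H (L.Q (.ofLinear (ψ₁ ∘ₗ e))) = postcomp (ψ₁ ∘ₗ e) L.vectorField :=
    (L.toSeries_Q _).trans (derivAlong_linear _ _)
  have coprod_tangentLift :
      postcomp (ψ₀.coprod ψ₁) (L.isHomological_vectorField.tangentLift e he).series
        = linear (ψ₀ ∘ₗ e) + postcomp (ψ₁ ∘ₗ e) L.vectorField := by
    rw [IsHomological.tangentLift, TaylorMap.prodMk, TaylorMap.ofLinear, map_add,
      postcomp_postcomp, postcomp_postcomp, postcomp_postcomp, LinearMap.coprod_inl,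
      LinearMap.coprod_inr, postcomp_linear]
  rw [FormalFun.toSeries_pullback_ofLinear, map_add, Q_ofLinear, ← postcomp_postcomp,
    snd_series, coprod_tangentLift]
  rfl

theorem pullback_zeroSection_pullback_toProd (g : FormalFun (bundleSpace K V)) :
    T.zeroSection.toFormalMap.pullback (T.toProd.toFormalMap.pullback g)
      = (TaylorMap.inl K (V.prod V.shift)).toFormalMap.pullback g :=
  (toSeries K).injective <| (subst_subst _ _ _).trans (by rw [toProd_comp_zeroSection]; rfl)

theorem pullback_zeroSection_ofLinear (ψ : V →ₗ[ℝ] ℝ) :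
    T.zeroSection.toFormalMap.pullback (.ofLinear (ψ ∘ₗ e)) = 0 := by
  have lift : T.toProd.toFormalMap.pullback
      (.ofLinear (ψ.coprod 0 ∘ₗ LinearMap.snd ℝ K (V × V))) = .ofLinear (ψ ∘ₗ e) := by
    rw [pullback_toProd_ofLinear, LinearMap.zero_comp, FormalFun.ofLinear_zero, L.Q_zero, add_zero]
  rw [← lift, pullback_zeroSection_pullback_toProd]
  refine (toSeries K).injective ((FormalFun.toSeries_pullback_ofLinear _ _).trans ?_)
  refine (postcomp_linear _ _).trans ?_
  rw [LinearMap.comp_assoc, LinearMap.snd_comp_inl, LinearMap.comp_zero, map_zero, map_zero]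

theorem exists_pullback_toProd_eq {f : FormalFun H}
    (hf : f ∈ LinearMap.ker T.zeroSection.toFormalMap.pullback) :
    ∃ g, T.toProd.toFormalMap.pullback g = f ∧
      subst (.ofLinear (zeroSectionProj K V) zeroSectionProj_mem) (toSeries _ g) = 0 := by
  refine ⟨T.ofProd.toFormalMap.pullback f,
    TaylorMap.pullback_pullback_of_comp_eq_id T.ofProd_comp_toProd f, ?_⟩
  have vanishing : subst T.zeroSection (toSeries H f) = 0 := hf
  rw [TaylorMap.toSeries_pullback, ← TaylorMap.inl_comp_fst, subst_subst,
    ← TaylorMap.comp_assoc, ← subst_subst]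
  exact (congrArg (subst _) vanishing).trans (map_zero _)

theorem finiteDimensional_bundleSpace (T : TangentTrivialization L L' e he)
    [FiniteDimensional ℝ H] : FiniteDimensional ℝ (bundleSpace K V) :=
  Module.Finite.of_surjective (linearPart T.toProd.series) <| Function.LeftInverse.surjective <|
    LinearMap.congr_fun (TaylorMap.linearPart_comp_of_comp_eq_id T.toProd_comp_ofProd)

variable {E F : Submodule ℝ H} (ker_e : LinearMap.ker e = E ⊔ F)
include ker_e

theorem generators_subset_ker : linearVanishing H E F ∪ L.Q '' linearVanishing H E F
    ⊆ LinearMap.ker T.zeroSection.toFormalMap.pullback := by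
  have vanishing : linearVanishing H E F ⊆ LinearMap.ker T.zeroSection.toFormalMap.pullback := by
    intro w hw
    obtain ⟨ψ, rfl⟩ := (FormalFun.mem_linearVanishing_iff ker_e).1 hw
    exact T.pullback_zeroSection_ofLinear ψ
  refine Set.union_subset vanishing ?_
  rintro _ ⟨w, hw, rfl⟩
  refine LinearMap.mem_ker.2 ?_
  rw [T.isQMap_zeroSection, LinearMap.mem_ker.1 (vanishing hw), L'.Q_zero]

section Ideal

variable {J : Submodule ℝ (FormalFun H)} (hJ : FormalFun.IsIdeal J)
  (generators_mem : linearVanishing H E F ∪ L.Q '' linearVanishing H E F ⊆ J)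
include generators_mem

theorem ofLinear_mem_comap (φ : bundleSpace K V →ₗ[ℝ] ℝ) (hφ : φ ∘ₗ zeroSectionProj K V = 0) :
    .ofLinear φ ∈ J.comap T.toProd.toFormalMap.pullback := by
  let ψ₀ : V →ₗ[ℝ] ℝ := φ ∘ₗ LinearMap.inr ℝ K (V × V) ∘ₗ LinearMap.inl ℝ V V
  let ψ₁ : V →ₗ[ℝ] ℝ := φ ∘ₗ LinearMap.inr ℝ K (V × V) ∘ₗ LinearMap.inr ℝ V V
  have φ_eq : φ = ψ₀.coprod ψ₁ ∘ₗ LinearMap.snd ℝ K (V × V) := LinearMap.ext fun ⟨k, v, v'⟩ => by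
    have decomposition : (k, v, v') = zeroSectionProj K V (k, 0, 0)
        + ((0, v, 0) + (0, 0, v') : K × V × V) := by
      simp [zeroSectionProj]
    have φ_zero : φ (zeroSectionProj K V (k, 0, 0)) = 0 := LinearMap.congr_fun hφ _
    rw [decomposition, map_add, map_add, φ_zero, zero_add]
    simp [ψ₀, ψ₁, zeroSectionProj]
  have ofLinear_mem (ψ : V →ₗ[ℝ] ℝ) : .ofLinear (ψ ∘ₗ e) ∈ linearVanishing H E F :=
    (FormalFun.mem_linearVanishing_iff ker_e).2 ⟨ψ, rfl⟩
  rw [φ_eq, Submodule.mem_comap, pullback_toProd_ofLinear]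
  exact add_mem (generators_mem (.inl (ofLinear_mem ψ₀)))
    (generators_mem (.inr ⟨_, ofLinear_mem ψ₁, rfl⟩))

end Ideal

theorem ker_eq_closedIdealGen : LinearMap.ker T.zeroSection.toFormalMap.pullback =
    FormalFun.closedIdealGen (linearVanishing H E F ∪ L.Q '' linearVanishing H E F) := by
  refine le_antisymm (le_sInf ?_) (sInf_le ⟨?_, ?_, T.generators_subset_ker ker_e⟩)
  · rintro J ⟨hJ, closed, generators_mem⟩ f hf
    obtain ⟨g, rfl, hg⟩ := T.exists_pullback_toProd_eq hf
    exact (hJ.comap T.toProd.toFormalMap).mem_of_isClosed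
      (T.ofLinear_mem_comap ker_e generators_mem) zeroSectionProj_mem rfl hg
      (closed.preimage T.toProd.toFormalMap.continuous)
  · exact FormalFun.isIdeal_bot.comap _
  · exact isClosed_singleton.preimage T.zeroSection.toFormalMap.continuous

theorem ker_eq_idealGen [FiniteDimensional ℝ H] :
    LinearMap.ker T.zeroSection.toFormalMap.pullback =
      FormalFun.idealGen (linearVanishing H E F ∪ L.Q '' linearVanishing H E F) := by
  have := T.finiteDimensional_bundleSpace
  refine le_antisymm (le_sInf ?_) (sInf_le ⟨FormalFun.isIdeal_bot.comap _,
    T.generators_subset_ker ker_e⟩)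
  rintro J ⟨hJ, generators_mem⟩ f hf
  obtain ⟨g, rfl, hg⟩ := T.exists_pullback_toProd_eq hf
  exact (hJ.comap T.toProd.toFormalMap).mem_of_finiteDimensional
    (T.ofLinear_mem_comap ker_e generators_mem) zeroSectionProj_mem rfl hg

end TangentTrivialization

namespace LInfty

variable {L : LInfty H} {E F : Submodule ℝ H}

theorem isMinimalModel {L' : LInfty K} {Φ : TaylorMap K H} (hL' : L'.D = 0)
    (hΦ : L'.IsQMap L Φ.toFormalMap) (quasiIso : L'.IsQuasiIso L (linearPart Φ.series)) :
    L'.IsMinimalModel L :=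
  ⟨(MultilinearMap.ofSubsingleton ℝ (K : Type u) K (0 : Fin 1)).symm.injective hL', _, _, hΦ,
    Φ.hasLinearPart_toFormalMap, quasiIso⟩

theorem IsSplitting.exists_trivialization (h : L.IsSplitting E F) :
    ∃ (L' : LInfty (H.sub E h.gradedE))
      (T : TangentTrivialization L L' h.boundaryProj h.boundaryProj_mem),
      L'.D = 0 ∧ linearPart T.zeroSection.series = E.subtype := by
  obtain ⟨qE, qE_homological, linearPart_qE, t, t', ht, ht', related, linearPart_t, snd_t⟩ :=
    L.isHomological_vectorField.exists_trivialization h.harmonicProj h.harmonicProj_mem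
      h.boundaryProj h.boundaryProj_mem (by rw [linearPart_vectorField, h.harmonicProj_comp_D])
      (by rw [linearPart_vectorField]; exact h.bijective_prod)
  let T : TangentTrivialization L (LInfty.ofVectorField qE_homological) h.boundaryProj
      h.boundaryProj_mem :=
    { toProd := t
      ofProd := t'
      ofProd_comp_toProd := ht
      toProd_comp_ofProd := ht'
      isRelated := by rwa [vectorField_prod, vectorField_shiftedTangent]
      snd_comp_toProd := snd_t }
  refine ⟨_, T, (linearPart_vectorField _).symm.trans linearPart_qE,
    T.linearPart_zeroSection (LinearMap.ext fun x => ?_)⟩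
  change linearPart t.series x = _
  rw [linearPart_t, linearPart_vectorField]
  have D_x : L.D x = 0 := h.mem_ker x.2
  exact congrArg₂ Prod.mk (h.harmonicProj_coe x) (congrArg₂ Prod.mk
    (h.boundaryProj_eq_zero_of_mem (Submodule.mem_sup_left x.2))
    ((congrArg h.boundaryProj D_x).trans (map_zero _)))

end LInfty

end QMan

theorem mainTheorem1 (H : QMan.GrSpace.{u}) (L : QMan.LInfty H) :
    (∃ E F : Submodule ℝ H, L.IsSplitting E F) ∧
    ∀ (E F : Submodule ℝ H) (h : L.IsSplitting E F),
      (∃ e : E ≃ₗ[ℝ] L.Cohomology, ∀ x : E, ∃ hx : (x : H) ∈ LinearMap.ker L.D,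
        e x = Submodule.Quotient.mk ⟨(x : H), hx⟩) ∧
      ∃ (L' : QMan.LInfty (H.sub E h.gradedE)) (i : QMan.FormalMap (H.sub E h.gradedE) H),
        L'.IsEquivalentReduction L i ∧
        L'.IsMinimalModel L ∧
        i.HasLinearPart E.subtype ∧
        L'.IsQuasiIso L E.subtype ∧
        Function.Surjective i.pullback ∧
        LinearMap.ker i.pullback = QMan.FormalFun.closedIdealGen
          (QMan.linearVanishing H E F ∪ L.Q '' QMan.linearVanishing H E F) ∧
        (FiniteDimensional ℝ H → LinearMap.ker i.pullback = QMan.FormalFun.idealGen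
          (QMan.linearVanishing H E F ∪ L.Q '' QMan.linearVanishing H E F)) := by
  refine ⟨L.exists_isSplitting, fun E F h => ⟨h.exists_cohomology_equiv, ?_⟩⟩
  obtain ⟨L', T, hL', linearPart_eq⟩ := h.exists_trivialization
  have quasiIso := h.isQuasiIso hL'
  have hasLinearPart := T.zeroSection.hasLinearPart_toFormalMap
  rw [linearPart_eq] at hasLinearPart
  exact ⟨L', T.zeroSection.toFormalMap, T.isEquivalentReduction,
    QMan.LInfty.isMinimalModel hL' T.isQMap_zeroSection (linearPart_eq ▸ quasiIso),
    hasLinearPart, quasiIso, T.surjective_pullback_zeroSection,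
    T.ker_eq_closedIdealGen h.ker_boundaryProj, fun _ => T.ker_eq_idealGen h.ker_boundaryProj⟩
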